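/- **Theorem 4 (APMC-PnP).** Let $p>0$ be a probability density on $\mathbb R^n$ (the prior), and for a fixed observation $y$ let $\ell(x)=\ell(y\,|\,x)>0$ be a likelihood with $\int \ell\,p\,dx<\infty$. Put $g=-\log\ell$ and let $\pi\propto \ell\,p$ be the posterior distribution. For $\sigma>0$ let $p_\sigma(x)=\int p(z)\,\phi_\sigma(x-z)\,dz$, where $\phi_\sigma$ is the density of $\mathcal N(0,\sigma^2 I)$, and let $\mathcal S(x,\sigma)\in\mathbb R^n$ be a score network. Assume, for all $x,x_1,x_2\in\mathbb R^n$ and all $\sigma>0$ (with $\|\cdot\|$ the Euclidean norm), that 1. $\log \ell$ is differentiable and $\|\nabla\log\ell(x_1)-\nabla\log\ell(x_2)\|\le L_g\|x_1-x_2\|$, with $L_g>0$; 2. $\log p$ is differentiable and $\|\nabla\log p(x_1)-\nabla\log p(x_2)\|\le L_p\|x_1-x_2\|$, with $L_p>0$; 3. $\|\mathcal S(x_1,\sigma)-\mathcal S(x_2,\sigma)\|\le L_\sigma\|x_1-x_2\|$ with $L_\sigma>0$, and $\|\mathcal S(x,\sigma)-\nabla\log p_\sigma(x)\|\le\varepsilon_\sigma<\infty$;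 4. $\|\nabla\log p_\sigma(x)-\nabla\log p(x)\|\le\sigma C$; 5. $\|\nabla g(x)\|\le R_g$, with $R_g>0$; 6. $\|\mathcal S(x,\sigma)\|\le R_s$. Let $0\le K<N$ be integers and let $(\alpha_k)_{k=0}^{N-1}$ and $(\sigma_k)_{k=0}^{N-1}$ be (not necessarily strictly) decreasing sequences with $\sigma_k>0$ for all $k$ and $\alpha_K=\dots=\alpha_{N-1}=1$. Let $\gamma>0$ and $\mathcal P_k(x)=\nabla g(x)-\alpha_k\,\mathcal S\big(x-\gamma\nabla g(x),\sigma_k\big)$. Let $x_0$ be a random vector in $\mathbb R^n$ with an arbitrary law, independent of a standard $n$-dimensional Brownian motion $(B_t)_{t\ge0}$, and define the continuous interpolation of the APMC-PnP iterates by $$x_t=x_{k\gamma}-(t-k\gamma)\,\mathcal P_k(x_{k\gamma})+\sqrt2\,(B_t-B_{k\gamma}),\qquad t\in[k\gamma,(k+1)\gamma],\quad 0\le k<N .$$ Let $\nu_t$ be the law of $x_t$. Put $L_k=L_g+\max\{\alpha_kL_{\sigma_k}+\alpha_k\gamma L_gL_{\sigma_k},\,L_p\}$, $L_{\max}=\max_{0\le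 k<N}L_k$, $L_{\sigma,\max}=\max_{0\le k<N}L_{\sigma_k}$, $\bar\sigma^2=\frac1N\sum_{k=0}^{N-1}\sigma_k^2$, $\bar\epsilon^2=\frac1N\sum_{k=0}^{N-1}\varepsilon_{\sigma_k}^2$ and $\zeta=48\sum_{k=0}^{K-1}(\alpha_k-1)^2R_s^2$. If $\gamma L_{\max}\le 1/\sqrt{32}$, then $$\frac1{N\gamma}\int_0^{N\gamma}\mathrm{FI}(\nu_t\,\|\,\pi)\,dt\;\le\;\frac{4\,\mathrm{KL}(\nu_0\,\|\,\pi)+\gamma\zeta}{N\gamma}+\big(24\,nL_{\max}^2+9\,L_{\sigma,\max}R_g^2\big)\gamma+48\,C^2\,\bar\sigma^2+48\,\bar\epsilon^2 ,$$ where $\mathrm{KL}$ is the Kullback–Leibler divergence (possibly $+\infty$) and $\mathrm{FI}(\nu\,\|\,\pi)=\int_{\mathbb R^n}\big\|\nabla\log\frac{\nu(x)}{\pi(x)}\big\|^2\,\nu(x)\,dx$ is the relative Fisher information. -/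

import Mathlib

open MeasureTheory ProbabilityTheory
open scoped ENNReal NNReal

noncomputable section

/-- The density `φ_s` of the centred Gaussian law `N(0, s² I)` on `ℝⁿ`. -/
def gaussianDensity {n : ℕ} (s : ℝ) (u : EuclideanSpace ℝ (Fin n)) : ℝ :=
  (2 * Real.pi * s ^ 2) ^ (-((n : ℝ) / 2)) * Real.exp (-(‖u‖ ^ 2 / (2 * s ^ 2)))

/-- The smoothed prior `p_s(x) = ∫ p(z) φ_s(x - z) dz`. -/
def smoothedPrior {n : ℕ} (p : EuclideanSpace ℝ (Fin n) → ℝ) (s : ℝ)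
    (x : EuclideanSpace ℝ (Fin n)) : ℝ :=
  ∫ z, p z * gaussianDensity s (x - z)

/-- The score `∇ log q` of a density `q`. -/
def score {n : ℕ} (q : EuclideanSpace ℝ (Fin n) → ℝ) (x : EuclideanSpace ℝ (Fin n)) :
    EuclideanSpace ℝ (Fin n) :=
  gradient (fun y => Real.log (q y)) x

/-- The gradient `∇g` of the data-fidelity term `g(x) = -log ℓ(y | x)`, where `ℓ` stands for the
likelihood `x ↦ ℓ(y | x)` of the fixed observation `y`. -/
def gradFidelity {n : ℕ} (ℓ : EuclideanSpace ℝ (Fin n) → ℝ) (x : EuclideanSpace ℝ (Fin n)) :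
    EuclideanSpace ℝ (Fin n) :=
  gradient (fun z => -Real.log (ℓ z)) x

/-- The posterior distribution, with density `ℓ p / ∫ ℓ p`. -/
def posteriorLaw {n : ℕ} (ℓ p : EuclideanSpace ℝ (Fin n) → ℝ) :
    Measure (EuclideanSpace ℝ (Fin n)) :=
  volume.withDensity fun x => ENNReal.ofReal (ℓ x * p x / ∫ z, ℓ z * p z)

/-- The relative Fisher information `FI(ν ‖ π) = ∫ ‖∇ log (dν/dπ)‖² dν`, computed with the
positive differentiable version `h` of the density ratio `dν/dπ`; the value is `∞` if there is no
such version. (If every non-empty open set has positive `π`-measure, there is at most one `h`.) -/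
def fisherInfo {n : ℕ} (ν π : Measure (EuclideanSpace ℝ (Fin n))) : ℝ≥0∞ :=
  ⨅ (h : EuclideanSpace ℝ (Fin n) → ℝ) (_ : Differentiable ℝ h) (_ : ∀ x, 0 < h x)
    (_ : ν = π.withDensity fun x => ENNReal.ofReal (h x)),
    ∫⁻ x, ‖gradient (fun y => Real.log (h y)) x‖ₑ ^ 2 ∂ν

/-- Standard Brownian motion in `ℝⁿ`: its coordinates are independent real Brownian motions. -/
structure IsStandardBrownianMotion {n : ℕ} {Ω : Type*} [MeasurableSpace Ω]
    (B : ℝ≥0 → Ω → EuclideanSpace ℝ (Fin n)) (P : Measure Ω) : Prop where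
  measurable : ∀ t, Measurable (B t)
  coord : ∀ i, IsBrownianReal (fun t ω => B t ω i) P
  indep : iIndepFun (fun (i : Fin n) (ω : Ω) (t : ℝ≥0) => B t ω i) P

/-- The map `P_k(x) = ∇g(x) - a S(x - γ ∇g(x), s)` of the plug-and-play discretization, with
annealing parameters `a = α_k` and `s = σ_k`. -/
def pnpMap {n : ℕ} (ℓ : EuclideanSpace ℝ (Fin n) → ℝ)
    (S : EuclideanSpace ℝ (Fin n) → ℝ → EuclideanSpace ℝ (Fin n)) (γ a s : ℝ)
    (x : EuclideanSpace ℝ (Fin n)) : EuclideanSpace ℝ (Fin n) :=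
  gradFidelity ℓ x - a • S (x - γ • gradFidelity ℓ x) s

/-- The iterates `x_{k+1} = x_k - γ P_k(x_k) + √(2γ) Z_k` of APMC-PnP, where
`Z_k = (B_{(k+1)γ} - B_{kγ}) / √γ` are independent standard normal vectors. -/
def apmcPnP {n : ℕ} {Ω : Type*} (ℓ : EuclideanSpace ℝ (Fin n) → ℝ)
    (S : EuclideanSpace ℝ (Fin n) → ℝ → EuclideanSpace ℝ (Fin n)) (γ : ℝ) (α σ : ℕ → ℝ)
    (B : ℝ≥0 → Ω → EuclideanSpace ℝ (Fin n)) (x₀ : Ω → EuclideanSpace ℝ (Fin n)) :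
    ℕ → Ω → EuclideanSpace ℝ (Fin n)
  | 0, ω => x₀ ω
  | k + 1, ω =>
      apmcPnP ℓ S γ α σ B x₀ k ω - γ • pnpMap ℓ S γ (α k) (σ k) (apmcPnP ℓ S γ α σ B x₀ k ω)
        + √2 • (B (Real.toNNReal ((k + 1) * γ)) ω - B (Real.toNNReal (k * γ)) ω)

/-- The continuous interpolation of APMC-PnP: for `kγ ≤ t < (k+1)γ` (and, by continuity, for
`t = (k+1)γ`), `x_t = x_{kγ} - (t - kγ) P_k(x_{kγ}) + √2 (B_t - B_{kγ})`. -/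
def apmcPnPInterp {n : ℕ} {Ω : Type*} (ℓ : EuclideanSpace ℝ (Fin n) → ℝ)
    (S : EuclideanSpace ℝ (Fin n) → ℝ → EuclideanSpace ℝ (Fin n)) (γ : ℝ) (α σ : ℕ → ℝ)
    (B : ℝ≥0 → Ω → EuclideanSpace ℝ (Fin n)) (x₀ : Ω → EuclideanSpace ℝ (Fin n))
    (t : ℝ) (ω : Ω) : EuclideanSpace ℝ (Fin n) :=
  let k : ℕ := ⌊t / γ⌋₊
  apmcPnP ℓ S γ α σ B x₀ k ω
    - (t - k * γ) • pnpMap ℓ S γ (α k) (σ k) (apmcPnP ℓ S γ α σ B x₀ k ω)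
    + √2 • (B (Real.toNNReal t) ω - B (Real.toNNReal (k * γ)) ω)

/-- The constants `L_k = L_g + max {α_k L_{σ_k} + α_k γ L_g L_{σ_k}, L_p}`. -/
def stepLipschitz (Lg Lp γ : ℝ) (L : ℝ → ℝ) (α σ : ℕ → ℝ) (k : ℕ) : ℝ :=
  Lg + max (α k * L (σ k) + α k * γ * Lg * L (σ k)) Lp

end

/-! The argument is the interpolation method for Langevin schemes, run on each step separately.
Within a step the drift `b = -P_k` is frozen at the starting point `y`, so given `y` the position
after elapsed time `s` is Gaussian with mean `y + s b(y)` and covariance `2 s I`. With `k_s(x, y)`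
its density, the law of the step is the smooth positive mixture `ρ_s(x) = ∫ k_s(x, y) dν(y)`, and
the pair (start, end) has density `k_s` with respect to `ν ⊗ volume`. Averages over this explicit
joint law replace conditional expectations throughout.

Let `q` be the posterior density, `F = ∇ log q` and `W = ∇ log (ρ_s / q)`. The Fokker-Planck
equation and Young's inequality give, formally, `d/ds KL ≤ -(3/4) FI + D` with `D = E ‖b(y) -
F(x)‖²` (`integral_mul_stepDensityDt_le`). Both `b` and `F` are `Lmax`-Lipschitz and they differ by
at most `e`, a sum of the network error, the smoothing error, the shift of the network's argument
and the annealing error. For `s Lmax ≤ 1/√32` this gives `D ≤ FI/3 + (44/3) n Lmax² s + (8/3) e²`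
(`driftError_le`); the second moment of `F` met there is absorbed through `E ‖F‖² ≤ FI + 2 n Lmax`
(`integral_stepDensity_mul_sq_norm_le`). A dissipation of `3/4 - 1/3 = 5/12` of the Fisher
information survives. Integrating over a step, summing over the steps and multiplying by `12/5`
gives the theorem, with room in every constant.

Two points need care, since the initial law is arbitrary. First, the entropy need not be
differentiable under the integral sign. Its integrand is therefore truncated so that its derivative
is `m arctan (log (ρ/q) / m)`, a bounded function of the log-ratio whose slope lies in `(0, 1]`. The
truncated entropy is finite and obeys the same dissipation inequality (`truncEntropy_add_le`); as `m
→ ∞`, Fatou's lemma handles the entropy and dominated convergence the Fisher information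
(`klDiv_stepLaw_add_le`). Secondly, the bounds blow up at `s = 0`, so the inequality is first proved
on `[a, c]` with `a > 0`. Data processing compares `ν` with the posterior after the same short step,
and the posterior moved by that step has density at most `c_a q` with `c_a → 1`; hence the entropy
at time `a` is at most the initial one plus `log c_a` (`klDiv_stepLaw_le`).

The link with the random process is that the Brownian increment after time `kγ` is Gaussian and
independent of the iterate, a function of the initial value and the earlier path
(`map_apmcPnP_add`). -/

noncomputable section

/-! ### Gaussian integrals and moments -/

/-- The heat kernel: the density of the centred Gaussian law `N(0, 2 s I)` on `ℝⁿ`. -/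
def heatKernel {n : ℕ} (s : ℝ) (u : EuclideanSpace ℝ (Fin n)) : ℝ :=
  (4 * Real.pi * s) ^ (-((n : ℝ) / 2)) * Real.exp (-(‖u‖ ^ 2 / (4 * s)))

section HeatKernel

variable {n : ℕ}

lemma heatKernel_pos {s : ℝ} (hs : 0 < s) (u : EuclideanSpace ℝ (Fin n)) :
    0 < heatKernel s u := by
  unfold heatKernel; positivity

lemma measurable_heatKernel_uncurry :
    Measurable fun z : ℝ × EuclideanSpace ℝ (Fin n) => heatKernel z.1 z.2 := by
  unfold heatKernel
  fun_prop

lemma continuous_heatKernel (s : ℝ) :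
    Continuous (heatKernel s : EuclideanSpace ℝ (Fin n) → ℝ) := by
  unfold heatKernel
  fun_prop

lemma heatKernel_eq_exp (s : ℝ) (u : EuclideanSpace ℝ (Fin n)) :
    heatKernel s u
      = (4 * Real.pi * s) ^ (-((n : ℝ) / 2)) * Real.exp (-(1 / (4 * s)) * ‖u‖ ^ 2) := by
  unfold heatKernel
  congr 2
  ring

/-- An integral that is undefined has value 0, whereas the Gaussian formula gives a positive value;
this forces integrability. -/
lemma integrable_exp_neg_mul_sq_norm {a : ℝ} (ha : 0 < a) :
    Integrable fun u : EuclideanSpace ℝ (Fin n) => Real.exp (-a * ‖u‖ ^ 2) := by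
  by_contra h
  have h1 := GaussianFourier.integral_rexp_neg_mul_sq_norm (V := EuclideanSpace ℝ (Fin n)) ha
  rw [integral_undef h] at h1
  have : 0 < (Real.pi / a) ^ ((Module.finrank ℝ (EuclideanSpace ℝ (Fin n)) : ℝ) / 2) := by
    positivity
  linarith

lemma integrable_heatKernel {s : ℝ} (hs : 0 < s) :
    Integrable (heatKernel s : EuclideanSpace ℝ (Fin n) → ℝ) := by
  have := (integrable_exp_neg_mul_sq_norm (n := n) (a := 1 / (4 * s)) (by positivity)).const_mul
    ((4 * Real.pi * s) ^ (-((n : ℝ) / 2)))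
  exact this.congr (.of_forall fun u => (heatKernel_eq_exp s u).symm)

lemma integral_heatKernel {s : ℝ} (hs : 0 < s) :
    ∫ u : EuclideanSpace ℝ (Fin n), heatKernel s u = 1 := by
  simp_rw [heatKernel_eq_exp]
  rw [integral_const_mul, GaussianFourier.integral_rexp_neg_mul_sq_norm (by positivity),
    finrank_euclideanSpace_fin, show Real.pi / (1 / (4 * s)) = 4 * Real.pi * s by field_simp,
    ← Real.rpow_add (by positivity)]
  simp

/-- A Gaussian beats the exponential of a multiple of the norm. -/
lemma exp_mul_heatKernel_le {s c : ℝ} (hs : 0 < s) (u : EuclideanSpace ℝ (Fin n)) :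
    Real.exp (c * ‖u‖) * heatKernel s u
      ≤ (4 * Real.pi * s) ^ (-((n : ℝ) / 2)) * Real.exp (2 * c ^ 2 * s)
        * Real.exp (-(1 / (8 * s)) * ‖u‖ ^ 2) := by
  rw [heatKernel_eq_exp, mul_left_comm, ← Real.exp_add, mul_assoc (_ ^ _) (Real.exp _), ← Real.exp_add]
  refine mul_le_mul_of_nonneg_left (Real.exp_le_exp.2 ?_) (by positivity)
  -- Completing the square spends half of the Gaussian exponent on the linear term.
  have : 0 ≤ (‖u‖ - 4 * c * s) ^ 2 / (8 * s) := by positivity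
  have h2 : (‖u‖ - 4 * c * s) ^ 2 / (8 * s)
      = 2 * c ^ 2 * s + -(1 / (8 * s)) * ‖u‖ ^ 2 - (c * ‖u‖ + -(1 / (4 * s)) * ‖u‖ ^ 2) := by
    field_simp; ring
  linarith

lemma integrable_exp_mul_heatKernel {s : ℝ} (hs : 0 < s) (c : ℝ) :
    Integrable fun u : EuclideanSpace ℝ (Fin n) => Real.exp (c * ‖u‖) * heatKernel s u := by
  refine Integrable.mono' ((integrable_exp_neg_mul_sq_norm (n := n) (a := 1 / (8 * s))
    (by positivity)).const_mul ((4 * Real.pi * s) ^ (-((n : ℝ) / 2)) * Real.exp (2 * c ^ 2 * s)))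
    ((by fun_prop : Continuous fun u : EuclideanSpace ℝ (Fin n) => Real.exp (c * ‖u‖)).mul
      (continuous_heatKernel s)).aestronglyMeasurable (.of_forall fun u => ?_)
  rw [Real.norm_of_nonneg (mul_nonneg (Real.exp_nonneg _) (heatKernel_pos hs u).le)]
  exact exp_mul_heatKernel_le hs u

lemma integrable_sq_norm_mul_heatKernel {s : ℝ} (hs : 0 < s) :
    Integrable fun u : EuclideanSpace ℝ (Fin n) => ‖u‖ ^ 2 * heatKernel s u := by
  refine Integrable.mono' ((integrable_exp_mul_heatKernel (n := n) hs 1).const_mul 2)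
    ((by fun_prop : Continuous fun u : EuclideanSpace ℝ (Fin n) => ‖u‖ ^ 2).mul
      (continuous_heatKernel s)).aestronglyMeasurable (.of_forall fun u => ?_)
  rw [Real.norm_of_nonneg (mul_nonneg (by positivity) (heatKernel_pos hs u).le), ← mul_assoc]
  refine mul_le_mul_of_nonneg_right ?_ (heatKernel_pos hs u).le
  have := Real.quadratic_le_exp_of_nonneg (norm_nonneg u)
  rw [one_mul]
  linarith [norm_nonneg u]

lemma integrable_norm_mul_heatKernel {s : ℝ} (hs : 0 < s) :
    Integrable fun u : EuclideanSpace ℝ (Fin n) => ‖u‖ * heatKernel s u := by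
  refine Integrable.mono' ((integrable_heatKernel (n := n) hs).add
    (integrable_sq_norm_mul_heatKernel hs))
    ((by fun_prop : Continuous fun u : EuclideanSpace ℝ (Fin n) => ‖u‖).mul
      (continuous_heatKernel s)).aestronglyMeasurable (.of_forall fun u => ?_)
  rw [Real.norm_of_nonneg (mul_nonneg (by positivity) (heatKernel_pos hs u).le), Pi.add_apply]
  nlinarith [heatKernel_pos hs u, sq_nonneg (‖u‖ - 1), norm_nonneg u,
    mul_nonneg (heatKernel_pos hs u).le (sq_nonneg (‖u‖ - 1)),
    mul_nonneg (heatKernel_pos hs u).le (sq_nonneg ‖u‖)]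

lemma hasGradientAt_heatKernel {s : ℝ} (hs : 0 < s) (u : EuclideanSpace ℝ (Fin n)) :
    HasGradientAt (heatKernel s) (-(heatKernel s u / (2 * s)) • u) u := by
  rw [hasGradientAt_iff_hasFDerivAt]
  have h1 : HasFDerivAt (fun u : EuclideanSpace ℝ (Fin n) => ‖u‖ ^ 2) (2 • (innerSL ℝ u)) u :=
    (hasStrictFDerivAt_norm_sq u).hasFDerivAt
  have h2 := ((h1.const_mul (-(1 / (4 * s)))).exp).const_mul
    ((4 * Real.pi * s) ^ (-((n : ℝ) / 2)))
  refine (h2.congr_of_eventuallyEq (.of_forall fun v => heatKernel_eq_exp s v)).congr_fderiv ?_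
  ext v
  rw [heatKernel_eq_exp]
  simp only [smul_apply, smul_eq_mul, innerSL_apply_apply,
    InnerProductSpace.toDual_apply_apply, inner_smul_left, map_neg, nsmul_eq_mul]
  simp only [conj_trivial]
  field_simp
  push_cast
  ring

lemma hasLineDerivAt_heatKernel {s : ℝ} (hs : 0 < s) (u : EuclideanSpace ℝ (Fin n)) (i : Fin n) :
    HasLineDerivAt ℝ (heatKernel s) (-(heatKernel s u / (2 * s)) * u i) u
      (EuclideanSpace.single i 1) := by
  have := (hasGradientAt_heatKernel hs u).hasFDerivAt.hasLineDerivAt (EuclideanSpace.single i 1)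
  refine this.congr_deriv ?_
  simp [EuclideanSpace.inner_single_right]

/-- Integration by parts against the coordinate `u i`: the kernel has derivative `-u i / (2 s)`
times itself, and the derivative of `u i` leaves the total mass 1. -/
lemma integral_coord_sq_mul_heatKernel {s : ℝ} (hs : 0 < s) (i : Fin n) :
    ∫ u : EuclideanSpace ℝ (Fin n), u i ^ 2 * heatKernel s u = 2 * s := by
  have hi (u : EuclideanSpace ℝ (Fin n)) : |u i| ≤ ‖u‖ := PiLp.norm_apply_le u i
  have h1 : Integrable fun u : EuclideanSpace ℝ (Fin n) => u i * heatKernel s u := by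
    refine (integrable_norm_mul_heatKernel hs).mono
      (((by fun_prop : Continuous fun u : EuclideanSpace ℝ (Fin n) => u i).mul
      (continuous_heatKernel s)).aestronglyMeasurable) (.of_forall fun u => ?_)
    rw [norm_mul, norm_mul, norm_norm]
    exact mul_le_mul_of_nonneg_right (hi u) (norm_nonneg _)
  have h2 : Integrable fun u : EuclideanSpace ℝ (Fin n) => u i ^ 2 * heatKernel s u := by
    refine (integrable_sq_norm_mul_heatKernel hs).mono
      (((by fun_prop : Continuous fun u : EuclideanSpace ℝ (Fin n) => u i ^ 2).mul
      (continuous_heatKernel s)).aestronglyMeasurable) (.of_forall fun u => ?_)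
    rw [norm_mul, norm_mul, norm_pow, norm_pow, norm_norm]
    exact mul_le_mul_of_nonneg_right (pow_le_pow_left₀ (abs_nonneg _) (hi u) 2) (norm_nonneg _)
  have h3 : Integrable fun u : EuclideanSpace ℝ (Fin n) =>
      u i * (-(heatKernel s u / (2 * s)) * u i) := by
    refine (h2.const_mul (-(1 / (2 * s)))).congr (.of_forall fun u => ?_)
    simp only
    ring
  have key := integral_bilinear_hasLineDerivAt_right_eq_neg_left_of_integrable
    (μ := (volume : Measure (EuclideanSpace ℝ (Fin n))))
    (f := fun u => u i) (f' := fun _ => (1 : ℝ)) (g := heatKernel s)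
    (g' := fun u => -(heatKernel s u / (2 * s)) * u i) (v := EuclideanSpace.single i 1)
    (B := ContinuousLinearMap.mul ℝ ℝ) (by simpa using integrable_heatKernel hs) (by simpa using h3)
    (by simpa using h1)
    (fun u _ => by
      have := ((EuclideanSpace.proj (𝕜 := ℝ) i).hasFDerivAt (x := u)).hasLineDerivAt
        (EuclideanSpace.single i 1)
      simpa using this)
    (fun u _ => hasLineDerivAt_heatKernel hs u i)
  simp only [ContinuousLinearMap.mul_apply', one_mul, integral_heatKernel hs] at key
  have h4 : ∫ u : EuclideanSpace ℝ (Fin n), u i * (-(heatKernel s u / (2 * s)) * u i)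
      = -(1 / (2 * s)) * ∫ u : EuclideanSpace ℝ (Fin n), u i ^ 2 * heatKernel s u := by
    rw [← integral_const_mul]
    congr 1; ext u; ring
  rw [h4] at key
  field_simp at key
  linarith

lemma integrable_coord_sq_mul_heatKernel {s : ℝ} (hs : 0 < s) (i : Fin n) :
    Integrable fun u : EuclideanSpace ℝ (Fin n) => u i ^ 2 * heatKernel s u := by
  by_contra h
  have := integral_coord_sq_mul_heatKernel hs i
  rw [integral_undef h] at this
  linarith

lemma integral_sq_norm_mul_heatKernel {s : ℝ} (hs : 0 < s) :
    ∫ u : EuclideanSpace ℝ (Fin n), ‖u‖ ^ 2 * heatKernel s u = 2 * n * s := by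
  have : ∀ u : EuclideanSpace ℝ (Fin n),
      ‖u‖ ^ 2 * heatKernel s u = ∑ i, u i ^ 2 * heatKernel s u := by
    intro u
    rw [EuclideanSpace.norm_sq_eq, Finset.sum_mul]
    simp
  simp_rw [this]
  rw [integral_finsetSum _ fun i _ => integrable_coord_sq_mul_heatKernel hs i]
  simp_rw [integral_coord_sq_mul_heatKernel hs]
  simp
  ring

/-- The heat kernel is centred. -/
lemma integral_inner_mul_heatKernel (s : ℝ) (v : EuclideanSpace ℝ (Fin n)) :
    ∫ u : EuclideanSpace ℝ (Fin n), inner ℝ v u * heatKernel s u = 0 := by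
  have h := integral_neg_eq_self (fun u : EuclideanSpace ℝ (Fin n) =>
    inner ℝ v u * heatKernel s u) volume
  have h2 : ∀ u : EuclideanSpace ℝ (Fin n), inner ℝ v (-u) * heatKernel s (-u)
      = -(inner ℝ v u * heatKernel s u) := by
    intro u; simp [heatKernel]
  simp_rw [h2, integral_neg] at h
  linarith

lemma heatKernel_smul {s : ℝ} (hs : 0 < s) (v : EuclideanSpace ℝ (Fin n)) :
    heatKernel s (√s • v) = (√s ^ n)⁻¹ * heatKernel 1 v := by
  unfold heatKernel
  rw [norm_smul, mul_pow, Real.norm_of_nonneg (Real.sqrt_nonneg s), Real.sq_sqrt hs.le,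
    show s * ‖v‖ ^ 2 / (4 * s) = ‖v‖ ^ 2 / (4 * 1) by field_simp,
    Real.mul_rpow (by positivity) hs.le, mul_one]
  have : (s : ℝ) ^ (-((n : ℝ) / 2)) = (√s ^ n)⁻¹ := by
    rw [Real.rpow_neg hs.le, Real.sqrt_eq_rpow, ← Real.rpow_natCast, ← Real.rpow_mul hs.le]
    congr 2; ring
  rw [this]; ring_nf

/-- Rescaling by `√s` moves the time from the kernel into the exponent, so that the limit `s → 0`
can be taken under a fixed Gaussian. -/
lemma integral_exp_mul_heatKernel {s : ℝ} (hs : 0 < s) (c : ℝ) :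
    ∫ u : EuclideanSpace ℝ (Fin n), Real.exp (c * ‖u‖) * heatKernel s u
      = ∫ v : EuclideanSpace ℝ (Fin n), Real.exp (c * √s * ‖v‖) * heatKernel 1 v := by
  have hs' : 0 < √s := Real.sqrt_pos.2 hs
  have h := Measure.integral_comp_smul (volume : Measure (EuclideanSpace ℝ (Fin n)))
    (fun u => Real.exp (c * ‖u‖) * heatKernel s u) √s
  simp_rw [heatKernel_smul hs, norm_smul, Real.norm_of_nonneg hs'.le,
    finrank_euclideanSpace_fin] at h
  rw [abs_of_pos (by positivity), smul_eq_mul] at h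
  have h2 : ∀ v : EuclideanSpace ℝ (Fin n),
      Real.exp (c * (√s * ‖v‖)) * ((√s ^ n)⁻¹ * heatKernel 1 v)
        = (√s ^ n)⁻¹ * (Real.exp (c * √s * ‖v‖) * heatKernel 1 v) := by
    intro v; rw [← mul_assoc c]; ring
  simp_rw [h2, integral_const_mul] at h
  exact (mul_left_cancel₀ (by positivity) h).symm

/-- The integral is the factor by which a short step can enlarge the posterior density; its limit 1
makes the entropy cost of starting at a positive time vanish. -/
lemma tendsto_integral_exp_mul_heatKernel (c : ℝ) :
    Filter.Tendsto (fun s : ℝ => ∫ u : EuclideanSpace ℝ (Fin n),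
      Real.exp (c * ‖u‖) * heatKernel s u) (nhdsWithin 0 (Set.Ioi 0)) (nhds 1) := by
  have h1 : Filter.Tendsto (fun s : ℝ => ∫ v : EuclideanSpace ℝ (Fin n),
      Real.exp (c * √s * ‖v‖) * heatKernel 1 v) (nhdsWithin 0 (Set.Ioi 0))
      (nhds (∫ v : EuclideanSpace ℝ (Fin n), heatKernel 1 v)) := by
    refine tendsto_integral_filter_of_dominated_convergence
      (fun v => Real.exp (|c| * ‖v‖) * heatKernel 1 v) ?_ ?_
      (integrable_exp_mul_heatKernel one_pos |c|) ?_
    · refine .of_forall fun s => ?_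
      exact ((by fun_prop : Continuous fun u : EuclideanSpace ℝ (Fin n) =>
        Real.exp (c * √s * ‖u‖)).mul (continuous_heatKernel 1)).aestronglyMeasurable
    · filter_upwards [Ioo_mem_nhdsGT (zero_lt_one' ℝ)] with s hs
      refine .of_forall fun v => ?_
      rw [Real.norm_of_nonneg (mul_nonneg (Real.exp_nonneg _) (heatKernel_pos one_pos v).le)]
      refine mul_le_mul_of_nonneg_right ?_ (heatKernel_pos one_pos v).le
      gcongr
      calc c * √s ≤ |c| * 1 := by
            refine mul_le_mul (le_abs_self c) ?_ (Real.sqrt_nonneg _) (abs_nonneg c)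
            exact Real.sqrt_le_one.2 hs.2.le
        _ = |c| := mul_one _
    · refine .of_forall fun v => ?_
      have hc : Continuous fun s : ℝ => Real.exp (c * √s * ‖v‖) * heatKernel 1 v := by fun_prop
      have := hc.tendsto 0
      simp only [Real.sqrt_zero, mul_zero, zero_mul, Real.exp_zero, one_mul] at this
      exact this.mono_left nhdsWithin_le_nhds
  rw [integral_heatKernel one_pos] at h1
  refine h1.congr' ?_
  filter_upwards [self_mem_nhdsWithin] with s hs
  exact (integral_exp_mul_heatKernel hs c).symm

end HeatKernel

end

/-! ### The density of one Euler step and its derivatives -/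

noncomputable section

/-- The noise increment that carries an explicit Euler step of length `s` along the drift `b`,
started at `y`, to `x`. -/
def stepNoise {n : ℕ} (b : EuclideanSpace ℝ (Fin n) → EuclideanSpace ℝ (Fin n)) (s : ℝ)
    (x y : EuclideanSpace ℝ (Fin n)) : EuclideanSpace ℝ (Fin n) :=
  x - (y + s • b y)

/-- The density at `x` of a noisy Euler step of length `s` along the drift `b`, started at `y`. -/
def stepKernel {n : ℕ} (b : EuclideanSpace ℝ (Fin n) → EuclideanSpace ℝ (Fin n)) (s : ℝ)
    (x y : EuclideanSpace ℝ (Fin n)) : ℝ :=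
  heatKernel s (stepNoise b s x y)

/-- The time derivative of `stepKernel`. -/
def stepKernelDt {n : ℕ} (b : EuclideanSpace ℝ (Fin n) → EuclideanSpace ℝ (Fin n)) (s : ℝ)
    (x y : EuclideanSpace ℝ (Fin n)) : ℝ :=
  stepKernel b s x y * (‖stepNoise b s x y‖ ^ 2 / (4 * s ^ 2) - n / (2 * s)
    + inner ℝ (stepNoise b s x y) (b y) / (2 * s))

/-- The density of a noisy Euler step of length `s` along the drift `b`, started from `ν`. -/
def stepDensity {n : ℕ} (b : EuclideanSpace ℝ (Fin n) → EuclideanSpace ℝ (Fin n))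
    (ν : Measure (EuclideanSpace ℝ (Fin n))) (s : ℝ) (x : EuclideanSpace ℝ (Fin n)) : ℝ :=
  ∫ y, stepKernel b s x y ∂ν

/-- The gradient of `stepDensity`. -/
def stepDensityGrad {n : ℕ} (b : EuclideanSpace ℝ (Fin n) → EuclideanSpace ℝ (Fin n))
    (ν : Measure (EuclideanSpace ℝ (Fin n))) (s : ℝ) (x : EuclideanSpace ℝ (Fin n)) :
    EuclideanSpace ℝ (Fin n) :=
  ∫ y, -(stepKernel b s x y / (2 * s)) • stepNoise b s x y ∂ν

/-- The time derivative of `stepDensity`. -/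
def stepDensityDt {n : ℕ} (b : EuclideanSpace ℝ (Fin n) → EuclideanSpace ℝ (Fin n))
    (ν : Measure (EuclideanSpace ℝ (Fin n))) (s : ℝ) (x : EuclideanSpace ℝ (Fin n)) : ℝ :=
  ∫ y, stepKernelDt b s x y ∂ν

section StepDensity

variable {n : ℕ} {b : EuclideanSpace ℝ (Fin n) → EuclideanSpace ℝ (Fin n)}

lemma stepKernel_pos {s : ℝ} (hs : 0 < s) (x y : EuclideanSpace ℝ (Fin n)) :
    0 < stepKernel b s x y :=
  heatKernel_pos hs _

lemma measurable_stepNoise (hb : Measurable b) :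
    Measurable fun z : ℝ × EuclideanSpace ℝ (Fin n) × EuclideanSpace ℝ (Fin n) =>
      stepNoise b z.1 z.2.1 z.2.2 := by
  unfold stepNoise
  fun_prop

lemma measurable_stepKernel (hb : Measurable b) :
    Measurable fun z : ℝ × EuclideanSpace ℝ (Fin n) × EuclideanSpace ℝ (Fin n) =>
      stepKernel b z.1 z.2.1 z.2.2 :=
  measurable_heatKernel_uncurry.comp (measurable_fst.prodMk (measurable_stepNoise hb))

lemma measurable_stepKernelDt (hb : Measurable b) :
    Measurable fun z : ℝ × EuclideanSpace ℝ (Fin n) × EuclideanSpace ℝ (Fin n) =>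
      stepKernelDt b z.1 z.2.1 z.2.2 := by
  have h1 := measurable_stepNoise hb
  have h2 := measurable_stepKernel hb
  unfold stepKernelDt
  refine h2.mul (((h1.norm.pow_const 2).div (by fun_prop)).sub (by fun_prop) |>.add
    ((h1.inner (hb.comp (by fun_prop))).div (by fun_prop)))

lemma measurable_stepDensity (hb : Measurable b) (ν : Measure (EuclideanSpace ℝ (Fin n)))
    [SFinite ν] :
    Measurable fun z : ℝ × EuclideanSpace ℝ (Fin n) => stepDensity b ν z.1 z.2 := by
  have h : StronglyMeasurable (Function.uncurry
      fun (z : ℝ × EuclideanSpace ℝ (Fin n)) (y : EuclideanSpace ℝ (Fin n)) =>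
        stepKernel b z.1 z.2 y) :=
    ((measurable_stepKernel hb).comp (by fun_prop : Measurable fun w :
      (ℝ × EuclideanSpace ℝ (Fin n)) × EuclideanSpace ℝ (Fin n) =>
        (w.1.1, w.1.2, w.2))).stronglyMeasurable
  exact h.integral_prod_right.measurable

lemma measurable_stepDensityDt (hb : Measurable b) (ν : Measure (EuclideanSpace ℝ (Fin n)))
    [SFinite ν] :
    Measurable fun z : ℝ × EuclideanSpace ℝ (Fin n) => stepDensityDt b ν z.1 z.2 := by
  have h : StronglyMeasurable (Function.uncurry
      fun (z : ℝ × EuclideanSpace ℝ (Fin n)) (y : EuclideanSpace ℝ (Fin n)) =>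
        stepKernelDt b z.1 z.2 y) :=
    ((measurable_stepKernelDt hb).comp (by fun_prop : Measurable fun w :
      (ℝ × EuclideanSpace ℝ (Fin n)) × EuclideanSpace ℝ (Fin n) =>
        (w.1.1, w.1.2, w.2))).stronglyMeasurable
  exact h.integral_prod_right.measurable

lemma measurable_stepDensityGrad (hb : Measurable b) (ν : Measure (EuclideanSpace ℝ (Fin n)))
    [SFinite ν] :
    Measurable fun z : ℝ × EuclideanSpace ℝ (Fin n) => stepDensityGrad b ν z.1 z.2 := by
  have h : StronglyMeasurable (Function.uncurry
      fun (z : ℝ × EuclideanSpace ℝ (Fin n)) (y : EuclideanSpace ℝ (Fin n)) =>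
        -(stepKernel b z.1 z.2 y / (2 * z.1)) • stepNoise b z.1 z.2 y) := by
    have h1 := (measurable_stepKernel hb).comp (by fun_prop : Measurable fun w :
      (ℝ × EuclideanSpace ℝ (Fin n)) × EuclideanSpace ℝ (Fin n) => (w.1.1, w.1.2, w.2))
    have h2 := (measurable_stepNoise hb).comp (by fun_prop : Measurable fun w :
      (ℝ × EuclideanSpace ℝ (Fin n)) × EuclideanSpace ℝ (Fin n) => (w.1.1, w.1.2, w.2))
    exact ((h1.div (by fun_prop)).neg.smul h2).stronglyMeasurable
  exact h.integral_prod_right.measurable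

lemma heatKernel_le {a s : ℝ} (ha : 0 < a) (has : a ≤ s) (u : EuclideanSpace ℝ (Fin n)) :
    heatKernel s u ≤ (4 * Real.pi * a) ^ (-((n : ℝ) / 2)) := by
  have hs : 0 < s := ha.trans_le has
  unfold heatKernel
  calc _ ≤ (4 * Real.pi * s) ^ (-((n : ℝ) / 2)) * 1 := by
        refine mul_le_mul_of_nonneg_left (Real.exp_le_one_iff.2 ?_) (by positivity)
        exact neg_nonpos.2 (by positivity)
    _ ≤ _ := by
        rw [mul_one]
        refine Real.rpow_le_rpow_of_nonpos (by positivity) (by gcongr) ?_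
        exact neg_nonpos.2 (by positivity)

/-- With `r = ‖u‖² / (4 s)` this is `r exp (-r) ≤ 1`. Such pointwise bounds allow differentiation
under `∫ dν` with constant dominating functions, so the initial law needs no moments. -/
lemma sq_norm_mul_heatKernel_le {a s : ℝ} (ha : 0 < a) (has : a ≤ s)
    (u : EuclideanSpace ℝ (Fin n)) :
    ‖u‖ ^ 2 * heatKernel s u ≤ 4 * s * (4 * Real.pi * a) ^ (-((n : ℝ) / 2)) := by
  have hs : 0 < s := ha.trans_le has
  have h1 : ‖u‖ ^ 2 / (4 * s) * Real.exp (-(‖u‖ ^ 2 / (4 * s))) ≤ 1 := by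
    rw [Real.exp_neg, ← div_eq_mul_inv, div_le_one (Real.exp_pos _)]
    linarith [Real.add_one_le_exp (‖u‖ ^ 2 / (4 * s))]
  have h2 : (4 * Real.pi * s) ^ (-((n : ℝ) / 2)) ≤ (4 * Real.pi * a) ^ (-((n : ℝ) / 2)) := by
    refine Real.rpow_le_rpow_of_nonpos (by positivity) (by gcongr) ?_
    exact neg_nonpos.2 (by positivity)
  calc ‖u‖ ^ 2 * heatKernel s u = 4 * s * (4 * Real.pi * s) ^ (-((n : ℝ) / 2))
        * (‖u‖ ^ 2 / (4 * s) * Real.exp (-(‖u‖ ^ 2 / (4 * s)))) := by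
        unfold heatKernel; field_simp
    _ ≤ 4 * s * (4 * Real.pi * s) ^ (-((n : ℝ) / 2)) * 1 := by gcongr
    _ ≤ _ := by rw [mul_one]; gcongr

/-- A function of the noise that grows at most quadratically is bounded after multiplication by
the kernel, locally uniformly in time. -/
lemma stepKernel_mul_le {a c s A : ℝ} (ha : 0 < a) (has : a ≤ s) (hsc : s ≤ c) (hA : 0 ≤ A)
    (x y : EuclideanSpace ℝ (Fin n)) {g : ℝ} (hg : |g| ≤ A * (1 + ‖stepNoise b s x y‖ ^ 2)) :
    |stepKernel b s x y * g| ≤ A * (1 + 4 * c) * (4 * Real.pi * a) ^ (-((n : ℝ) / 2)) := by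
  have hs : 0 < s := ha.trans_le has
  have h1 := heatKernel_le ha has (stepNoise b s x y)
  have h2 := sq_norm_mul_heatKernel_le ha has (stepNoise b s x y)
  have h3 := stepKernel_pos (b := b) hs x y
  rw [abs_mul, abs_of_pos h3]
  calc _ ≤ stepKernel b s x y * (A * (1 + ‖stepNoise b s x y‖ ^ 2)) := by gcongr
    _ = A * (heatKernel s (stepNoise b s x y)
        + ‖stepNoise b s x y‖ ^ 2 * heatKernel s (stepNoise b s x y)) := by
        unfold stepKernel; ring
    _ ≤ A * ((4 * Real.pi * a) ^ (-((n : ℝ) / 2))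
        + 4 * c * (4 * Real.pi * a) ^ (-((n : ℝ) / 2))) := by
        refine mul_le_mul_of_nonneg_left (add_le_add h1 (h2.trans ?_)) hA
        gcongr
    _ = _ := by ring

lemma norm_le_one_add_sq (u : EuclideanSpace ℝ (Fin n)) : ‖u‖ ≤ 1 + ‖u‖ ^ 2 := by
  nlinarith [sq_nonneg (‖u‖ - 1), norm_nonneg u]

variable (ν : Measure (EuclideanSpace ℝ (Fin n))) [IsProbabilityMeasure ν]

lemma integrable_stepKernel (hb : Measurable b) {s : ℝ} (hs : 0 < s)
    (x : EuclideanSpace ℝ (Fin n)) : Integrable (fun y => stepKernel b s x y) ν := by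
  refine Integrable.of_bound (C := (4 * Real.pi * s) ^ (-((n : ℝ) / 2)))
    ((measurable_stepKernel hb).comp (by fun_prop : Measurable fun y :
      EuclideanSpace ℝ (Fin n) => (s, x, y))).aestronglyMeasurable (.of_forall fun y => ?_)
  change ‖stepKernel b s x y‖ ≤ _
  rw [Real.norm_of_nonneg (stepKernel_pos hs x y).le]
  exact heatKernel_le hs le_rfl _

lemma stepDensity_pos (hb : Measurable b) {s : ℝ} (hs : 0 < s) (x : EuclideanSpace ℝ (Fin n)) :
    0 < stepDensity b ν s x := by
  unfold stepDensity
  rw [integral_pos_iff_support_of_nonneg (fun y => (stepKernel_pos hs x y).le)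
    (integrable_stepKernel ν hb hs x)]
  have : Function.support (fun y => stepKernel b s x y) = Set.univ := by
    ext y; simp [(stepKernel_pos hs x y).ne']
  rw [this]; simp

lemma norm_stepKernel_smul_stepNoise_le {s : ℝ} (hs : 0 < s) (x y : EuclideanSpace ℝ (Fin n)) :
    ‖-(stepKernel b s x y / (2 * s)) • stepNoise b s x y‖
      ≤ (1 / (2 * s)) * (1 + 4 * s) * (4 * Real.pi * s) ^ (-((n : ℝ) / 2)) := by
  have h := stepKernel_mul_le (b := b) (A := 1 / (2 * s)) (g := 1 / (2 * s) * ‖stepNoise b s x y‖)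
    hs le_rfl le_rfl (by positivity) x y (by
      rw [abs_of_nonneg (by positivity)]
      gcongr
      exact norm_le_one_add_sq _)
  rw [abs_of_nonneg (mul_nonneg (stepKernel_pos hs x y).le (by positivity))] at h
  refine le_trans (le_of_eq ?_) h
  rw [norm_smul, norm_neg, Real.norm_of_nonneg (div_nonneg (stepKernel_pos hs x y).le
    (by positivity))]
  ring

lemma integrable_stepKernel_smul_stepNoise (hb : Measurable b) {s : ℝ} (hs : 0 < s)
    (x : EuclideanSpace ℝ (Fin n)) :
    Integrable (fun y => -(stepKernel b s x y / (2 * s)) • stepNoise b s x y) ν := by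
  have h1 := (measurable_stepKernel hb).comp (by fun_prop : Measurable fun y :
      EuclideanSpace ℝ (Fin n) => (s, x, y))
  have h2 := (measurable_stepNoise hb).comp (by fun_prop : Measurable fun y :
      EuclideanSpace ℝ (Fin n) => (s, x, y))
  exact Integrable.of_bound ((h1.div_const _).neg.smul h2).aestronglyMeasurable
    _ (.of_forall fun y => norm_stepKernel_smul_stepNoise_le hs x y)

lemma hasGradientAt_stepKernel {s : ℝ} (hs : 0 < s) (x y : EuclideanSpace ℝ (Fin n)) :
    HasGradientAt (fun x => stepKernel b s x y)
      (-(stepKernel b s x y / (2 * s)) • stepNoise b s x y) x := by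
  have h := (hasGradientAt_heatKernel hs (stepNoise b s x y)).hasFDerivAt
  rw [hasGradientAt_iff_hasFDerivAt]
  have h2 : HasFDerivAt (fun x => stepNoise b s x y)
      (ContinuousLinearMap.id ℝ (EuclideanSpace ℝ (Fin n))) x := (hasFDerivAt_id x).sub_const _
  have := h.comp x h2
  rwa [ContinuousLinearMap.comp_id] at this

/-- The gradient of the kernel is bounded uniformly in both points, and `ν` is a probability
measure, so a constant dominates. -/
lemma hasGradientAt_stepDensity (hb : Measurable b) {s : ℝ} (hs : 0 < s)
    (x : EuclideanSpace ℝ (Fin n)) :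
    HasGradientAt (stepDensity b ν s) (stepDensityGrad b ν s x) x := by
  rw [hasGradientAt_iff_hasFDerivAt]
  have key := hasFDerivAt_integral_of_dominated_of_fderiv_le (𝕜 := ℝ) (μ := ν)
    (F := fun x y => stepKernel b s x y) (x₀ := x) (s := Set.univ)
    (F' := fun x y => InnerProductSpace.toDual ℝ (EuclideanSpace ℝ (Fin n))
      (-(stepKernel b s x y / (2 * s)) • stepNoise b s x y))
    (bound := fun _ => (1 / (2 * s)) * (1 + 4 * s) * (4 * Real.pi * s) ^ (-((n : ℝ) / 2)))
    Filter.univ_mem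
    (.of_forall fun x => (integrable_stepKernel ν hb hs x).aestronglyMeasurable)
    (integrable_stepKernel ν hb hs x)
    ((InnerProductSpace.toDual ℝ (EuclideanSpace ℝ (Fin n))).continuous.comp_aestronglyMeasurable
      (integrable_stepKernel_smul_stepNoise ν hb hs x).aestronglyMeasurable)
    (.of_forall fun y x _ => by
      rw [LinearIsometryEquiv.norm_map]
      exact norm_stepKernel_smul_stepNoise_le hs x y)
    (integrable_const _)
    (.of_forall fun y x _ => (hasGradientAt_stepKernel hs x y).hasFDerivAt)
  refine key.congr_fderiv ?_
  ext v
  rw [ContinuousLinearMap.integral_apply, InnerProductSpace.toDual_apply_apply, stepDensityGrad]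
  · simp_rw [InnerProductSpace.toDual_apply_apply]
    rw [real_inner_comm, ← integral_inner (integrable_stepKernel_smul_stepNoise ν hb hs x)]
    simp_rw [real_inner_comm v]
  · exact (integrable_const ((1 / (2 * s)) * (1 + 4 * s) * (4 * Real.pi * s) ^
      (-((n : ℝ) / 2)))).mono'
      ((InnerProductSpace.toDual ℝ (EuclideanSpace ℝ (Fin n))).continuous.comp_aestronglyMeasurable
      (integrable_stepKernel_smul_stepNoise ν hb hs x).aestronglyMeasurable)
      (.of_forall fun y => by
        simp only [LinearIsometryEquiv.norm_map]
        exact norm_stepKernel_smul_stepNoise_le hs x y)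

/-- Time enters through the width of the Gaussian, its normalization and its moving centre; these
are the three summands of `stepKernelDt`. -/
lemma hasDerivAt_stepKernel {s : ℝ} (hs : 0 < s) (x y : EuclideanSpace ℝ (Fin n)) :
    HasDerivAt (fun s => stepKernel b s x y) (stepKernelDt b s x y) s := by
  have h1 : HasDerivAt (fun s => stepNoise b s x y) (-(b y)) s := by
    have := (((hasDerivAt_id s).smul_const (b y)).const_add y).const_sub x
    simpa [stepNoise] using this
  have h2 := h1.norm_sq
  have h3 : HasDerivAt (fun s : ℝ => 4 * s) 4 s := by simpa using (hasDerivAt_id s).const_mul 4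
  have h4 := (h2.div h3 (by positivity)).neg.exp
  have h5 : HasDerivAt (fun s : ℝ => 4 * Real.pi * s) (4 * Real.pi) s := by
    simpa using (hasDerivAt_id s).const_mul (4 * Real.pi)
  have h6 := h5.rpow_const (p := -((n : ℝ) / 2)) (Or.inl (by positivity))
  refine (h6.mul h4).congr_deriv ?_
  rw [Real.rpow_sub_one (by positivity)]
  simp only [stepKernelDt, stepKernel, heatKernel, inner_neg_right, Pi.neg_apply, Pi.div_apply]
  field_simp
  ring

lemma abs_stepKernelDt_factor_le {a s M : ℝ} (ha : 0 < a) (has : a ≤ s)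
    (hM : ∀ y, ‖b y‖ ≤ M) (x y : EuclideanSpace ℝ (Fin n)) :
    |‖stepNoise b s x y‖ ^ 2 / (4 * s ^ 2) - n / (2 * s)
      + inner ℝ (stepNoise b s x y) (b y) / (2 * s)|
      ≤ (1 / (4 * a ^ 2) + n / (2 * a) + M / (2 * a)) * (1 + ‖stepNoise b s x y‖ ^ 2) := by
  have hs : 0 < s := ha.trans_le has
  set u := stepNoise b s x y
  have hM0 : 0 ≤ M := (norm_nonneg _).trans (hM y)
  have h1 : |inner ℝ u (b y)| ≤ (1 + ‖u‖ ^ 2) * M :=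
    (abs_real_inner_le_norm _ _).trans
      (mul_le_mul (norm_le_one_add_sq u) (hM y) (norm_nonneg _) (by positivity))
  calc _ ≤ |‖u‖ ^ 2 / (4 * s ^ 2)| + |(n : ℝ) / (2 * s)| + |inner ℝ u (b y) / (2 * s)| :=
        (abs_add_le _ _).trans (add_le_add (abs_sub _ _) le_rfl)
    _ = ‖u‖ ^ 2 / (4 * s ^ 2) + n / (2 * s) + |inner ℝ u (b y)| / (2 * s) := by
        rw [abs_of_nonneg (by positivity), abs_of_nonneg (by positivity), abs_div,
          abs_of_pos (by positivity : 0 < 2 * s)]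
    _ ≤ (1 + ‖u‖ ^ 2) / (4 * a ^ 2) + n * (1 + ‖u‖ ^ 2) / (2 * a)
        + (1 + ‖u‖ ^ 2) * M / (2 * a) := by
        gcongr
        · linarith
        · nlinarith [sq_nonneg ‖u‖, (Nat.cast_nonneg n : (0 : ℝ) ≤ n)]
    _ = _ := by ring

lemma abs_stepKernelDt_le {a c s M : ℝ} (ha : 0 < a) (has : a ≤ s) (hsc : s ≤ c)
    (hM : ∀ y, ‖b y‖ ≤ M) (x y : EuclideanSpace ℝ (Fin n)) :
    |stepKernelDt b s x y| ≤ (1 / (4 * a ^ 2) + n / (2 * a) + M / (2 * a)) * (1 + 4 * c)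
      * (4 * Real.pi * a) ^ (-((n : ℝ) / 2)) := by
  have hM0 : 0 ≤ M := (norm_nonneg _).trans (hM y)
  exact stepKernel_mul_le ha has hsc (by positivity) x y (abs_stepKernelDt_factor_le ha has hM x y)

lemma hasDerivAt_stepDensity (hb : Measurable b) {M : ℝ} (hM : ∀ y, ‖b y‖ ≤ M) {s : ℝ}
    (hs : 0 < s) (x : EuclideanSpace ℝ (Fin n)) :
    HasDerivAt (fun s => stepDensity b ν s x) (stepDensityDt b ν s x) s := by
  -- The neighbourhood `(s/2, 2s)` keeps time away from 0, where the bound on the time derivative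
  -- degenerates.
  refine (hasDerivAt_integral_of_dominated_loc_of_deriv_le (μ := ν)
    (F := fun s y => stepKernel b s x y) (F' := fun s y => stepKernelDt b s x y)
    (s := Set.Ioo (s / 2) (2 * s))
    (bound := fun _ => (1 / (4 * (s / 2) ^ 2) + n / (2 * (s / 2)) + M / (2 * (s / 2)))
      * (1 + 4 * (2 * s)) * (4 * Real.pi * (s / 2)) ^ (-((n : ℝ) / 2)))
    (Ioo_mem_nhds (by linarith) (by linarith)) ?_ (integrable_stepKernel ν hb hs x) ?_ ?_
    (integrable_const _) ?_).2
  · filter_upwards [lt_mem_nhds hs] with r hr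
    exact (integrable_stepKernel ν hb hr x).aestronglyMeasurable
  · exact ((measurable_stepKernelDt hb).comp (by fun_prop : Measurable fun y :
      EuclideanSpace ℝ (Fin n) => (s, x, y))).aestronglyMeasurable
  · refine .of_forall fun y r hr => ?_
    exact abs_stepKernelDt_le (by positivity) hr.1.le hr.2.le hM x y
  · refine .of_forall fun y r hr => ?_
    exact hasDerivAt_stepKernel ((by positivity : (0 : ℝ) < s / 2).trans hr.1) x y

lemma abs_stepDensityDt_le {a c s M : ℝ} (ha : 0 < a) (has : a ≤ s) (hsc : s ≤ c)
    (hM : ∀ y, ‖b y‖ ≤ M) (x : EuclideanSpace ℝ (Fin n)) :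
    |stepDensityDt b ν s x| ≤ (1 / (4 * a ^ 2) + n / (2 * a) + M / (2 * a)) * (1 + 4 * c)
      * (4 * Real.pi * a) ^ (-((n : ℝ) / 2)) := by
  have := norm_integral_le_of_norm_le_const (μ := ν)
    (f := fun y => stepKernelDt b s x y)
    (.of_forall fun y => (Real.norm_eq_abs _).trans_le (abs_stepKernelDt_le ha has hsc hM x y))
  simpa [stepDensityDt] using this

end StepDensity

end

/-! ### The joint law of start and end, and the weak Fokker-Planck equation -/

noncomputable section

section StepKernelIntegrals

variable {n : ℕ} {b : EuclideanSpace ℝ (Fin n) → EuclideanSpace ℝ (Fin n)}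

lemma integral_comp_stepNoise (s : ℝ) (y : EuclideanSpace ℝ (Fin n))
    (G : EuclideanSpace ℝ (Fin n) → ℝ) :
    ∫ x, G (stepNoise b s x y) = ∫ u, G u :=
  integral_sub_right_eq_self G (y + s • b y)

lemma integrable_comp_stepNoise (s : ℝ) (y : EuclideanSpace ℝ (Fin n))
    {G : EuclideanSpace ℝ (Fin n) → ℝ} (hG : Integrable G) :
    Integrable fun x => G (stepNoise b s x y) :=
  hG.comp_sub_right (y + s • b y)

lemma integral_stepKernel {s : ℝ} (hs : 0 < s) (y : EuclideanSpace ℝ (Fin n)) :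
    ∫ x, stepKernel b s x y = 1 :=
  (integral_comp_stepNoise (b := b) s y (heatKernel s)).trans (integral_heatKernel hs)

lemma integral_stepKernel_mul_sq_norm {s : ℝ} (hs : 0 < s) (y : EuclideanSpace ℝ (Fin n)) :
    ∫ x, stepKernel b s x y * ‖stepNoise b s x y‖ ^ 2 = 2 * n * s := by
  refine (integral_comp_stepNoise (b := b) s y fun u => heatKernel s u * ‖u‖ ^ 2).trans ?_
  simp_rw [mul_comm _ (‖_‖ ^ 2)]
  exact integral_sq_norm_mul_heatKernel hs

lemma integrable_stepKernel_left {s : ℝ} (hs : 0 < s) (y : EuclideanSpace ℝ (Fin n)) :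
    Integrable fun x => stepKernel b s x y :=
  integrable_comp_stepNoise (b := b) s y (integrable_heatKernel hs)

lemma integrable_stepKernel_mul_sq_norm_left {s : ℝ} (hs : 0 < s)
    (y : EuclideanSpace ℝ (Fin n)) :
    Integrable fun x => stepKernel b s x y * ‖stepNoise b s x y‖ ^ 2 := by
  have := integrable_comp_stepNoise (b := b) s y (integrable_sq_norm_mul_heatKernel hs)
  simpa only [stepKernel, mul_comm] using this

lemma measurable_stepNoise_prod (hb : Measurable b) (s : ℝ) :
    Measurable fun z : EuclideanSpace ℝ (Fin n) × EuclideanSpace ℝ (Fin n) =>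
      stepNoise b s z.2 z.1 :=
  (measurable_stepNoise hb).comp (by fun_prop : Measurable fun z :
    EuclideanSpace ℝ (Fin n) × EuclideanSpace ℝ (Fin n) => (s, z.2, z.1))

lemma measurable_stepKernel_prod (hb : Measurable b) (s : ℝ) :
    Measurable fun z : EuclideanSpace ℝ (Fin n) × EuclideanSpace ℝ (Fin n) =>
      stepKernel b s z.2 z.1 :=
  (measurable_stepKernel hb).comp (by fun_prop : Measurable fun z :
    EuclideanSpace ℝ (Fin n) × EuclideanSpace ℝ (Fin n) => (s, z.2, z.1))

lemma measurable_stepDensity_right (hb : Measurable b) (ν : Measure (EuclideanSpace ℝ (Fin n)))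
    [SFinite ν] (s : ℝ) : Measurable (stepDensity b ν s) :=
  (measurable_stepDensity hb ν : Measurable (Function.uncurry (stepDensity b ν))).of_uncurry_left

variable (ν : Measure (EuclideanSpace ℝ (Fin n))) [IsProbabilityMeasure ν]

/-- In the product the first coordinate is the start and the second the end of the step;
`stepKernel` is the density of their joint law. -/
lemma integrable_prod_stepKernel (hb : Measurable b) {s : ℝ} (hs : 0 < s) :
    Integrable (fun z : EuclideanSpace ℝ (Fin n) × EuclideanSpace ℝ (Fin n) =>
      stepKernel b s z.2 z.1) (ν.prod volume) := by
  rw [integrable_prod_iff (measurable_stepKernel_prod hb s).aestronglyMeasurable]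
  refine ⟨.of_forall fun y => integrable_stepKernel_left hs y, ?_⟩
  simp_rw [Real.norm_of_nonneg (stepKernel_pos hs _ _).le, integral_stepKernel hs]
  exact integrable_const _

lemma integrable_prod_stepKernel_mul_sq_norm (hb : Measurable b) {s : ℝ} (hs : 0 < s) :
    Integrable (fun z : EuclideanSpace ℝ (Fin n) × EuclideanSpace ℝ (Fin n) =>
      stepKernel b s z.2 z.1 * ‖stepNoise b s z.2 z.1‖ ^ 2) (ν.prod volume) := by
  have hm : Measurable fun z : EuclideanSpace ℝ (Fin n) × EuclideanSpace ℝ (Fin n) =>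
      stepKernel b s z.2 z.1 * ‖stepNoise b s z.2 z.1‖ ^ 2 :=
    (measurable_stepKernel_prod hb s).mul ((measurable_stepNoise_prod hb s).norm.pow_const 2)
  rw [integrable_prod_iff hm.aestronglyMeasurable]
  refine ⟨.of_forall fun y => integrable_stepKernel_mul_sq_norm_left hs y, ?_⟩
  simp_rw [Real.norm_of_nonneg (mul_nonneg (stepKernel_pos hs _ _).le (sq_nonneg _)),
    integral_stepKernel_mul_sq_norm hs]
  exact integrable_const _

lemma integral_prod_stepKernel (hb : Measurable b) {s : ℝ} (hs : 0 < s) :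
    ∫ z, stepKernel b s z.2 z.1 ∂(ν.prod volume) = 1 := by
  rw [integral_prod _ (integrable_prod_stepKernel ν hb hs)]
  simp_rw [integral_stepKernel hs]
  simp

lemma integral_prod_stepKernel_mul_sq_norm (hb : Measurable b) {s : ℝ} (hs : 0 < s) :
    ∫ z, stepKernel b s z.2 z.1 * ‖stepNoise b s z.2 z.1‖ ^ 2 ∂(ν.prod volume) = 2 * n * s := by
  rw [integral_prod _ (integrable_prod_stepKernel_mul_sq_norm ν hb hs)]
  simp_rw [integral_stepKernel_mul_sq_norm hs]
  simp

lemma integrable_prod_stepKernel_mul (hb : Measurable b) {s : ℝ} (hs : 0 < s)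
    {g : EuclideanSpace ℝ (Fin n) × EuclideanSpace ℝ (Fin n) → ℝ} (hg : Measurable g) {A : ℝ}
    (hA : ∀ z, |g z| ≤ A * (1 + ‖stepNoise b s z.2 z.1‖ ^ 2)) :
    Integrable (fun z => stepKernel b s z.2 z.1 * g z) (ν.prod volume) := by
  refine (((integrable_prod_stepKernel ν hb hs).add
    (integrable_prod_stepKernel_mul_sq_norm ν hb hs)).const_mul A).mono'
    ((measurable_stepKernel_prod hb s).mul hg).aestronglyMeasurable (.of_forall fun z => ?_)
  have hk := stepKernel_pos (b := b) hs z.2 z.1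
  rw [norm_mul, Real.norm_of_nonneg hk.le, Pi.add_apply]
  calc _ ≤ stepKernel b s z.2 z.1 * (A * (1 + ‖stepNoise b s z.2 z.1‖ ^ 2)) :=
        mul_le_mul_of_nonneg_left (hA z) hk.le
    _ = _ := by ring

lemma integrable_stepDensity (hb : Measurable b) {s : ℝ} (hs : 0 < s) :
    Integrable (stepDensity b ν s) :=
  (integrable_prod_stepKernel ν hb hs).integral_prod_right

lemma integral_stepDensity (hb : Measurable b) {s : ℝ} (hs : 0 < s) :
    ∫ x, stepDensity b ν s x = 1 := by
  rw [← integral_prod_stepKernel ν hb hs, integral_prod_symm _ (integrable_prod_stepKernel ν hb hs)]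
  rfl

/-- A function of the endpoint alone is averaged against the marginal density `stepDensity`. -/
lemma integrable_prod_stepKernel_mul_of_right (hb : Measurable b) {s : ℝ} (hs : 0 < s)
    {φ : EuclideanSpace ℝ (Fin n) → ℝ} (hφ : Measurable φ) (hφ0 : ∀ x, 0 ≤ φ x)
    (h : Integrable fun x => stepDensity b ν s x * φ x) :
    Integrable (fun z : EuclideanSpace ℝ (Fin n) × EuclideanSpace ℝ (Fin n) =>
      stepKernel b s z.2 z.1 * φ z.2) (ν.prod volume) := by
  have hm : Measurable fun z : EuclideanSpace ℝ (Fin n) × EuclideanSpace ℝ (Fin n) =>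
      stepKernel b s z.2 z.1 * φ z.2 :=
    (measurable_stepKernel_prod hb s).mul (hφ.comp measurable_snd)
  rw [integrable_prod_iff' hm.aestronglyMeasurable]
  refine ⟨.of_forall fun x => (integrable_stepKernel ν hb hs x).mul_const (φ x), ?_⟩
  simp_rw [Real.norm_of_nonneg (mul_nonneg (stepKernel_pos hs _ _).le (hφ0 _)),
    integral_mul_const]
  exact h

lemma integral_prod_stepKernel_mul_of_right {s : ℝ}
    {φ : EuclideanSpace ℝ (Fin n) → ℝ}
    (h : Integrable (fun z : EuclideanSpace ℝ (Fin n) × EuclideanSpace ℝ (Fin n) =>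
      stepKernel b s z.2 z.1 * φ z.2) (ν.prod volume)) :
    ∫ z, stepKernel b s z.2 z.1 * φ z.2 ∂(ν.prod volume) = ∫ x, stepDensity b ν s x * φ x := by
  rw [integral_prod_symm _ h]
  simp_rw [integral_mul_const]
  rfl

lemma integrable_prod_stepKernelDt (hb : Measurable b) {M : ℝ} (hM : ∀ y, ‖b y‖ ≤ M) {s : ℝ}
    (hs : 0 < s) : Integrable (fun z : EuclideanSpace ℝ (Fin n) × EuclideanSpace ℝ (Fin n) =>
      stepKernelDt b s z.2 z.1) (ν.prod volume) := by
  have h := measurable_stepNoise_prod hb s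
  exact integrable_prod_stepKernel_mul ν hb hs
    (g := fun z => ‖stepNoise b s z.2 z.1‖ ^ 2 / (4 * s ^ 2) - n / (2 * s)
      + inner ℝ (stepNoise b s z.2 z.1) (b z.1) / (2 * s))
    ((((h.norm.pow_const 2).div_const _).sub_const _).add
      ((h.inner (hb.comp measurable_fst)).div_const _))
    (fun z => abs_stepKernelDt_factor_le hs le_rfl hM z.2 z.1)

/-- The bound is locally uniform in positive time, which is what Fubini in time and space needs
later. -/
lemma integral_abs_stepDensityDt_le (hb : Measurable b) {a M : ℝ} (ha : 0 < a)
    (hM : ∀ y, ‖b y‖ ≤ M) {s : ℝ} (has : a ≤ s) :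
    ∫ x, |stepDensityDt b ν s x|
      ≤ (1 / (4 * a ^ 2) + n / (2 * a) + M / (2 * a)) * (1 + 2 * n * s) := by
  have hs : 0 < s := ha.trans_le has
  have h1 := integrable_prod_stepKernelDt ν hb hM hs
  have h2 := integrable_prod_stepKernel ν hb hs
  have h3 := integrable_prod_stepKernel_mul_sq_norm ν hb hs
  calc ∫ x, |stepDensityDt b ν s x|
      ≤ ∫ x, ∫ y, |stepKernelDt b s x y| ∂ν := by
        refine integral_mono_of_nonneg (.of_forall fun x => abs_nonneg _)
          h1.norm.integral_prod_right (.of_forall fun x => ?_)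
        exact abs_integral_le_integral_abs
    _ = ∫ z, |stepKernelDt b s z.2 z.1| ∂(ν.prod volume) :=
        (integral_prod_symm _ h1.norm).symm
    _ ≤ ∫ z, (1 / (4 * a ^ 2) + n / (2 * a) + M / (2 * a)) * (stepKernel b s z.2 z.1
          + stepKernel b s z.2 z.1 * ‖stepNoise b s z.2 z.1‖ ^ 2) ∂(ν.prod volume) := by
        refine integral_mono h1.norm ((h2.add h3).const_mul _) fun z => ?_
        have hk := stepKernel_pos (b := b) hs z.2 z.1
        simp only [stepKernelDt, abs_mul, abs_of_pos hk]
        calc _ ≤ stepKernel b s z.2 z.1 * _ :=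
              mul_le_mul_of_nonneg_left (abs_stepKernelDt_factor_le ha has hM z.2 z.1) hk.le
          _ = _ := by ring
    _ = _ := by
        rw [integral_const_mul, integral_add h2 h3, integral_prod_stepKernel ν hb hs,
          integral_prod_stepKernel_mul_sq_norm ν hb hs]

lemma hasLineDerivAt_stepKernel_mul {s : ℝ} (hs : 0 < s) (x y : EuclideanSpace ℝ (Fin n))
    (i : Fin n) :
    HasLineDerivAt ℝ (fun x => stepKernel b s x y * (stepNoise b s x y i / (2 * s) + b y i))
      (stepKernel b s x y * (1 / (2 * s) - stepNoise b s x y i / (2 * s)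
        * (stepNoise b s x y i / (2 * s) + b y i))) x (EuclideanSpace.single i 1) := by
  have h1 := (hasGradientAt_stepKernel (b := b) hs x y).hasFDerivAt
  have h2 : HasFDerivAt (fun x : EuclideanSpace ℝ (Fin n) =>
      stepNoise b s x y i / (2 * s) + b y i)
      ((2 * s)⁻¹ • EuclideanSpace.proj (𝕜 := ℝ) i) x := by
    have := ((((EuclideanSpace.proj (𝕜 := ℝ) i).hasFDerivAt (x := x)).sub_const
      ((y + s • b y) i)).const_mul (2 * s)⁻¹).add_const (b y i)
    refine this.congr_of_eventuallyEq (.of_forall fun v => ?_)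
    simp [stepNoise, div_eq_inv_mul]
  have h3 := (h1.mul h2).hasLineDerivAt (EuclideanSpace.single i 1)
  convert! h3 using 1
  simp [EuclideanSpace.inner_single_right]
  ring

/-- For a fixed start the kernel solves `∂ₛ k = Δk - b(y)·∇k = -div (k (u / (2s) + b(y)))`, where
`u` is the noise and all space derivatives are in `x`. Integration by parts, one coordinate at a
time, moves the divergence onto `f`. No boundary terms occur since `f` is bounded and its gradient
is square integrable against `k`. -/
lemma integral_mul_stepKernelDt_left {M : ℝ} (hM : ∀ y, ‖b y‖ ≤ M) {s : ℝ}
    (hs : 0 < s) {f : EuclideanSpace ℝ (Fin n) → ℝ}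
    {f' : EuclideanSpace ℝ (Fin n) → EuclideanSpace ℝ (Fin n)}
    (hf : ∀ x, HasGradientAt f (f' x) x) (hf' : Measurable f') {A : ℝ} (hA : ∀ x, |f x| ≤ A)
    (y : EuclideanSpace ℝ (Fin n)) (hfy : Integrable fun x => stepKernel b s x y * ‖f' x‖ ^ 2) :
    ∫ x, f x * stepKernelDt b s x y = ∫ x, stepKernel b s x y *
      inner ℝ (f' x) ((1 / (2 * s)) • stepNoise b s x y + b y) := by
  have hM0 : 0 ≤ M := (norm_nonneg _).trans (hM y)
  have hA0 : 0 ≤ A := (abs_nonneg _).trans (hA 0)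
  have hkc : Continuous fun x => stepKernel b s x y := by
    unfold stepKernel stepNoise
    exact (continuous_heatKernel s).comp (by fun_prop)
  have huc : Continuous fun x => stepNoise b s x y := by unfold stepNoise; fun_prop
  have hfm : Measurable f :=
    (continuous_iff_continuousAt.2 fun x => (hf x).continuousAt).measurable
  have hk1 := integrable_stepKernel_left (b := b) hs y
  have hk2 := integrable_stepKernel_mul_sq_norm_left (b := b) hs y
  have hcoord : ∀ (v : EuclideanSpace ℝ (Fin n)) (i : Fin n), |v i| ≤ ‖v‖ :=
    fun v i => PiLp.norm_apply_le v i
  have huc' (i : Fin n) : Continuous fun x => stepNoise b s x y i :=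
    (EuclideanSpace.proj (𝕜 := ℝ) i).continuous.comp huc
  -- integrability of the three families of products
  have int_of {g : EuclideanSpace ℝ (Fin n) → ℝ} (hg : Measurable g) {C : ℝ}
      (hC : ∀ x, |g x| ≤ C * (1 + ‖stepNoise b s x y‖ ^ 2) + C * ‖f' x‖ ^ 2) :
      Integrable fun x => stepKernel b s x y * g x := by
    refine (((hk1.add hk2).const_mul C).add (hfy.const_mul C)).mono'
      (hkc.measurable.mul hg).aestronglyMeasurable (.of_forall fun x => ?_)
    have hk := stepKernel_pos (b := b) hs x y
    rw [norm_mul, Real.norm_of_nonneg hk.le]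
    calc _ ≤ stepKernel b s x y * (C * (1 + ‖stepNoise b s x y‖ ^ 2) + C * ‖f' x‖ ^ 2) :=
          mul_le_mul_of_nonneg_left (hC x) hk.le
      _ = _ := by simp only [Pi.add_apply]; ring
  have hlin (x) (i : Fin n) : |stepNoise b s x y i / (2 * s) + b y i|
      ≤ (1 / (2 * s) + M) * (1 + ‖stepNoise b s x y‖) := by
    have h1 := hcoord (stepNoise b s x y) i
    have h2 := (hcoord (b y) i).trans (hM y)
    calc _ ≤ |stepNoise b s x y i| / (2 * s) + |b y i| := by
          refine (abs_add_le _ _).trans ?_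
          rw [abs_div, abs_of_pos (by positivity : 0 < 2 * s)]
      _ ≤ ‖stepNoise b s x y‖ / (2 * s) + M := by gcongr
      _ ≤ _ := by
          have h3 : 0 ≤ M * ‖stepNoise b s x y‖ := by positivity
          have h4 : 0 ≤ 1 / (2 * s) := by positivity
          have : (1 / (2 * s) + M) * (1 + ‖stepNoise b s x y‖) = ‖stepNoise b s x y‖ / (2 * s)
            + M + (1 / (2 * s) + M * ‖stepNoise b s x y‖) := by ring
          linarith
  set C₀ := 1 / (2 * s) + M with hC₀
  have hC₀0 : 0 ≤ C₀ := by positivity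
  have hsq (x) : (1 + ‖stepNoise b s x y‖) ≤ 2 * (1 + ‖stepNoise b s x y‖ ^ 2) := by
    have := norm_le_one_add_sq (stepNoise b s x y)
    nlinarith [sq_nonneg ‖stepNoise b s x y‖]
  have i1 (i : Fin n) : Integrable fun x => stepKernel b s x y *
      (f' x i * (stepNoise b s x y i / (2 * s) + b y i)) := by
    refine int_of (C := 2 * C₀ ^ 2 + 1)
      (((EuclideanSpace.proj (𝕜 := ℝ) i).continuous.measurable.comp hf').mul
        (((huc' i).measurable.div_const _).add_const _)) fun x => ?_
    rw [abs_mul]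
    have h1 := hcoord (f' x) i
    have h2 := hlin x i
    have h3 : |f' x i| * |stepNoise b s x y i / (2 * s) + b y i|
        ≤ ‖f' x‖ * (C₀ * (1 + ‖stepNoise b s x y‖)) := by gcongr
    have h4 : 0 ≤ C₀ ^ 2 * (1 - ‖stepNoise b s x y‖) ^ 2 := by positivity
    nlinarith [sq_nonneg (‖f' x‖ - C₀ * (1 + ‖stepNoise b s x y‖)), sq_nonneg ‖f' x‖,
      sq_nonneg ‖stepNoise b s x y‖, mul_nonneg (sq_nonneg C₀) (sq_nonneg ‖f' x‖)]
  have i2 (i : Fin n) : Integrable fun x => stepKernel b s x y *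
      (f x * (1 / (2 * s) - stepNoise b s x y i / (2 * s)
        * (stepNoise b s x y i / (2 * s) + b y i))) := by
    refine int_of (C := A * (1 / (2 * s) + 1 / (2 * s) * C₀ * 2))
      (hfm.mul (measurable_const.sub (((huc' i).measurable.div_const _).mul
        (((huc' i).measurable.div_const _).add_const _)))) fun x => ?_
    rw [abs_mul]
    have h0 : 0 ≤ ‖stepNoise b s x y‖ := norm_nonneg _
    have h1 := hcoord (stepNoise b s x y) i
    have h2 := hlin x i
    have h3 : |1 / (2 * s) - stepNoise b s x y i / (2 * s)
        * (stepNoise b s x y i / (2 * s) + b y i)|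
        ≤ 1 / (2 * s) + ‖stepNoise b s x y‖ / (2 * s) * (C₀ * (1 + ‖stepNoise b s x y‖)) := by
      refine (abs_sub _ _).trans ?_
      rw [abs_mul, abs_of_nonneg (by positivity : 0 ≤ 1 / (2 * s)), abs_div,
        abs_of_pos (by positivity : 0 < 2 * s)]
      gcongr
    have h5 : ‖stepNoise b s x y‖ / (2 * s) * (C₀ * (1 + ‖stepNoise b s x y‖))
        ≤ 1 / (2 * s) * C₀ * 2 * (1 + ‖stepNoise b s x y‖ ^ 2) := by
      have : ‖stepNoise b s x y‖ / (2 * s) * (C₀ * (1 + ‖stepNoise b s x y‖))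
          = 1 / (2 * s) * C₀ * (‖stepNoise b s x y‖ * (1 + ‖stepNoise b s x y‖)) := by ring
      rw [this, mul_assoc (1 / (2 * s) * C₀)]
      refine mul_le_mul_of_nonneg_left ?_ (by positivity)
      nlinarith [sq_nonneg (1 - ‖stepNoise b s x y‖)]
    have h6 : 1 / (2 * s) ≤ 1 / (2 * s) * (1 + ‖stepNoise b s x y‖ ^ 2) :=
      le_mul_of_one_le_right (by positivity) (by nlinarith)
    calc _ ≤ A * (1 / (2 * s) * (1 + ‖stepNoise b s x y‖ ^ 2)
          + 1 / (2 * s) * C₀ * 2 * (1 + ‖stepNoise b s x y‖ ^ 2)) :=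
          mul_le_mul (hA x) (h3.trans (add_le_add h6 h5)) (abs_nonneg _) hA0
      _ = A * (1 / (2 * s) + 1 / (2 * s) * C₀ * 2) * (1 + ‖stepNoise b s x y‖ ^ 2) := by ring
      _ ≤ _ := le_add_of_nonneg_right (by positivity)
  have i3 (i : Fin n) : Integrable fun x => stepKernel b s x y *
      (f x * (stepNoise b s x y i / (2 * s) + b y i)) := by
    refine int_of (C := A * C₀ * 2)
      (hfm.mul (((huc' i).measurable.div_const _).add_const _)) fun x => ?_
    rw [abs_mul]
    calc _ ≤ A * (C₀ * (2 * (1 + ‖stepNoise b s x y‖ ^ 2))) :=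
          mul_le_mul (hA x) ((hlin x i).trans (by gcongr; exact hsq x)) (abs_nonneg _) hA0
      _ = A * C₀ * 2 * (1 + ‖stepNoise b s x y‖ ^ 2) := by ring
      _ ≤ _ := le_add_of_nonneg_right (by positivity)
  have parts (i : Fin n) : ∫ x, stepKernel b s x y *
      (f x * (1 / (2 * s) - stepNoise b s x y i / (2 * s)
        * (stepNoise b s x y i / (2 * s) + b y i)))
      = -∫ x, stepKernel b s x y * (f' x i * (stepNoise b s x y i / (2 * s) + b y i)) := by
    have key := integral_bilinear_hasLineDerivAt_right_eq_neg_left_of_integrable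
      (μ := (volume : Measure (EuclideanSpace ℝ (Fin n))))
      (f := f) (f' := fun x => f' x i)
      (g := fun x => stepKernel b s x y * (stepNoise b s x y i / (2 * s) + b y i))
      (g' := fun x => stepKernel b s x y * (1 / (2 * s) - stepNoise b s x y i / (2 * s)
        * (stepNoise b s x y i / (2 * s) + b y i))) (v := EuclideanSpace.single i 1)
      (B := ContinuousLinearMap.mul ℝ ℝ)
      (by simpa only [ContinuousLinearMap.mul_apply', mul_left_comm] using i1 i)
      (by simpa only [ContinuousLinearMap.mul_apply', mul_left_comm] using i2 i)
      (by simpa only [ContinuousLinearMap.mul_apply', mul_left_comm] using i3 i)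
      (fun x _ => by
        have := (hf x).hasFDerivAt.hasLineDerivAt (EuclideanSpace.single i 1)
        simpa [EuclideanSpace.inner_single_right] using this)
      (fun x _ => hasLineDerivAt_stepKernel_mul hs x y i)
    simp only [ContinuousLinearMap.mul_apply'] at key
    simp_rw [mul_left_comm (stepKernel b s _ y)]
    exact key
  -- The time derivative is minus the divergence, written as a sum over coordinates.
  have e1 (x) : f x * stepKernelDt b s x y = -∑ i, stepKernel b s x y *
      (f x * (1 / (2 * s) - stepNoise b s x y i / (2 * s)
        * (stepNoise b s x y i / (2 * s) + b y i))) := by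
    rw [← Finset.mul_sum, ← Finset.mul_sum, Finset.sum_sub_distrib]
    simp only [stepKernelDt, EuclideanSpace.norm_sq_eq, PiLp.inner_apply, Real.norm_eq_abs, sq_abs,
      RCLike.inner_apply, conj_trivial, mul_add, Finset.sum_add_distrib, Finset.sum_const,
      Finset.card_univ, Fintype.card_fin, nsmul_eq_mul]
    have s1 : ∑ i, stepNoise b s x y i / (2 * s) * (stepNoise b s x y i / (2 * s))
        = (∑ i, stepNoise b s x y i ^ 2) / (4 * s ^ 2) := by
      rw [Finset.sum_div]; refine Finset.sum_congr rfl fun i _ => ?_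
      field_simp; ring
    have s2 : ∑ i, stepNoise b s x y i / (2 * s) * b y i
        = (∑ i, b y i * stepNoise b s x y i) / (2 * s) := by
      rw [Finset.sum_div]; refine Finset.sum_congr rfl fun i _ => ?_
      ring
    rw [s1, s2]
    ring
  have e2 (x) : stepKernel b s x y * inner ℝ (f' x) ((1 / (2 * s)) • stepNoise b s x y + b y)
      = ∑ i, stepKernel b s x y * (f' x i * (stepNoise b s x y i / (2 * s) + b y i)) := by
    rw [← Finset.mul_sum]
    congr 1
    simp only [PiLp.inner_apply, RCLike.inner_apply, conj_trivial, PiLp.add_apply,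
      PiLp.smul_apply, smul_eq_mul]
    refine Finset.sum_congr rfl fun i _ => ?_
    ring
  simp_rw [e1, e2]
  rw [integral_neg, integral_finsetSum _ fun i _ => i2 i, integral_finsetSum _ fun i _ => i1 i,
    ← Finset.sum_neg_distrib]
  exact Finset.sum_congr rfl fun i _ => by rw [parts i, neg_neg]

/-- The Fokker-Planck equation of a noisy Euler step, in weak form. -/
lemma integral_mul_stepDensityDt (hb : Measurable b) {M : ℝ} (hM : ∀ y, ‖b y‖ ≤ M) {s : ℝ}
    (hs : 0 < s) {f : EuclideanSpace ℝ (Fin n) → ℝ}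
    {f' : EuclideanSpace ℝ (Fin n) → EuclideanSpace ℝ (Fin n)}
    (hf : ∀ x, HasGradientAt f (f' x) x) (hf' : Measurable f') {A : ℝ} (hA : ∀ x, |f x| ≤ A)
    (hfint : Integrable fun x => stepDensity b ν s x * ‖f' x‖ ^ 2) :
    Integrable (fun z : EuclideanSpace ℝ (Fin n) × EuclideanSpace ℝ (Fin n) =>
      stepKernel b s z.2 z.1 * inner ℝ (f' z.2) ((1 / (2 * s)) • stepNoise b s z.2 z.1 + b z.1))
      (ν.prod volume) ∧
    ∫ x, f x * stepDensityDt b ν s x = ∫ z, stepKernel b s z.2 z.1 *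
      inner ℝ (f' z.2) ((1 / (2 * s)) • stepNoise b s z.2 z.1 + b z.1) ∂(ν.prod volume) := by
  have hM0 : 0 ≤ M := (norm_nonneg _).trans (hM 0)
  have hfm : Measurable f :=
    (continuous_iff_continuousAt.2 fun x => (hf x).continuousAt).measurable
  have h1 := integrable_prod_stepKernel_mul_of_right ν hb hs (hf'.norm.pow_const 2)
    (fun x => sq_nonneg _) hfint
  have hu := measurable_stepNoise_prod hb s
  have h2 : Integrable (fun z : EuclideanSpace ℝ (Fin n) × EuclideanSpace ℝ (Fin n) =>
      stepKernel b s z.2 z.1 * inner ℝ (f' z.2) ((1 / (2 * s)) • stepNoise b s z.2 z.1 + b z.1))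
      (ν.prod volume) := by
    have h3 := (integrable_prod_stepKernel ν hb hs).const_mul (2 * M ^ 2)
    have h4 := (integrable_prod_stepKernel_mul_sq_norm ν hb hs).const_mul (2 * (1 / (2 * s)) ^ 2)
    have hf2 : Measurable fun z : EuclideanSpace ℝ (Fin n) × EuclideanSpace ℝ (Fin n) =>
      f' z.2 := hf'.comp measurable_snd
    have hb1 : Measurable fun z : EuclideanSpace ℝ (Fin n) × EuclideanSpace ℝ (Fin n) =>
      b z.1 := hb.comp measurable_fst
    have hm : Measurable fun z : EuclideanSpace ℝ (Fin n) × EuclideanSpace ℝ (Fin n) =>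
      stepKernel b s z.2 z.1 *
        inner ℝ (f' z.2) ((1 / (2 * s)) • stepNoise b s z.2 z.1 + b z.1) :=
      (measurable_stepKernel_prod hb s).mul
        (hf2.inner ((hu.const_smul (1 / (2 * s))).add hb1))
    refine (h1.add (h3.add h4)).mono' hm.aestronglyMeasurable (.of_forall fun z => ?_)
    have hk := stepKernel_pos (b := b) hs z.2 z.1
    rw [norm_mul, Real.norm_of_nonneg hk.le, Real.norm_eq_abs]
    simp only [Pi.add_apply]
    have h5 : |inner ℝ (f' z.2) ((1 / (2 * s)) • stepNoise b s z.2 z.1 + b z.1)|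
        ≤ ‖f' z.2‖ ^ 2 + (2 * M ^ 2 + 2 * (1 / (2 * s)) ^ 2 * ‖stepNoise b s z.2 z.1‖ ^ 2) := by
      have h6 : ‖(1 / (2 * s)) • stepNoise b s z.2 z.1 + b z.1‖
          ≤ 1 / (2 * s) * ‖stepNoise b s z.2 z.1‖ + M := by
        refine (norm_add_le _ _).trans (add_le_add ?_ (hM _))
        rw [norm_smul, Real.norm_of_nonneg (by positivity)]
      have h7 := abs_real_inner_le_norm (f' z.2)
        ((1 / (2 * s)) • stepNoise b s z.2 z.1 + b z.1)
      have h8 : ‖f' z.2‖ * ‖(1 / (2 * s)) • stepNoise b s z.2 z.1 + b z.1‖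
          ≤ ‖f' z.2‖ * (1 / (2 * s) * ‖stepNoise b s z.2 z.1‖ + M) := by gcongr
      nlinarith [sq_nonneg (‖f' z.2‖ - (1 / (2 * s) * ‖stepNoise b s z.2 z.1‖ + M)),
        sq_nonneg (1 / (2 * s) * ‖stepNoise b s z.2 z.1‖ - M), sq_nonneg ‖f' z.2‖,
        sq_nonneg (1 / (2 * s) * ‖stepNoise b s z.2 z.1‖ + M)]
    calc _ ≤ stepKernel b s z.2 z.1 * _ := mul_le_mul_of_nonneg_left h5 hk.le
      _ = _ := by ring
  refine ⟨h2, ?_⟩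
  have h6 : Integrable (fun z : EuclideanSpace ℝ (Fin n) × EuclideanSpace ℝ (Fin n) =>
      f z.2 * stepKernelDt b s z.2 z.1) (ν.prod volume) :=
    (integrable_prod_stepKernelDt ν hb hM hs).bdd_mul
      (hfm.comp measurable_snd).aestronglyMeasurable (.of_forall fun z => hA z.2)
  calc ∫ x, f x * stepDensityDt b ν s x
      = ∫ x, ∫ y, f x * stepKernelDt b s x y ∂ν := by
        simp_rw [integral_const_mul]; rfl
    _ = ∫ z, f z.2 * stepKernelDt b s z.2 z.1 ∂(ν.prod volume) :=
        (integral_prod_symm _ h6).symm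
    _ = ∫ y, (∫ x, f x * stepKernelDt b s x y) ∂ν := integral_prod _ h6
    _ = ∫ y, (∫ x, stepKernel b s x y *
        inner ℝ (f' x) ((1 / (2 * s)) • stepNoise b s x y + b y)) ∂ν := by
        -- Integrability over the product yields square integrability of the gradient only for
        -- almost every start.
        refine integral_congr_ae ?_
        filter_upwards [h1.prod_right_ae] with y hy
        exact integral_mul_stepKernelDt_left hM hs hf hf' hA y hy
    _ = _ := (integral_prod _ h2).symm

end StepKernelIntegrals

end

/-! ### Relative Fisher information and the dissipation inequality -/

noncomputable section

/-- The score of a noisy Euler step relative to a target distribution with score `F`. -/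
def relScore {n : ℕ} (b : EuclideanSpace ℝ (Fin n) → EuclideanSpace ℝ (Fin n))
    (ν : Measure (EuclideanSpace ℝ (Fin n)))
    (F : EuclideanSpace ℝ (Fin n) → EuclideanSpace ℝ (Fin n)) (s : ℝ)
    (x : EuclideanSpace ℝ (Fin n)) : EuclideanSpace ℝ (Fin n) :=
  (stepDensity b ν s x)⁻¹ • stepDensityGrad b ν s x - F x

/-- The Fisher information of a noisy Euler step relative to a target with score `F`. -/
def stepFisher {n : ℕ} (b : EuclideanSpace ℝ (Fin n) → EuclideanSpace ℝ (Fin n))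
    (ν : Measure (EuclideanSpace ℝ (Fin n)))
    (F : EuclideanSpace ℝ (Fin n) → EuclideanSpace ℝ (Fin n)) (s : ℝ) : ℝ :=
  ∫ x, stepDensity b ν s x * ‖relScore b ν F s x‖ ^ 2

/-- The mean square distance between the drift at the start of a noisy Euler step and the score
`F` of the target at its end. -/
def driftError {n : ℕ} (b : EuclideanSpace ℝ (Fin n) → EuclideanSpace ℝ (Fin n))
    (ν : Measure (EuclideanSpace ℝ (Fin n)))
    (F : EuclideanSpace ℝ (Fin n) → EuclideanSpace ℝ (Fin n)) (s : ℝ) : ℝ :=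
  ∫ z, stepKernel b s z.2 z.1 * ‖b z.1 - F z.2‖ ^ 2 ∂(ν.prod volume)

section Dissipation

variable {n : ℕ} {b F : EuclideanSpace ℝ (Fin n) → EuclideanSpace ℝ (Fin n)}
  (ν : Measure (EuclideanSpace ℝ (Fin n))) [IsProbabilityMeasure ν]

lemma measurable_relScore (hb : Measurable b) (hF : Measurable F) :
    Measurable (Function.uncurry (relScore b ν F)) := by
  have h1 := measurable_stepDensity hb ν
  have h2 := measurable_stepDensityGrad hb ν
  exact (h1.inv.smul h2).sub (hF.comp measurable_snd)

lemma integrable_stepKernel_mul_sq_norm_right (hb : Measurable b) {s : ℝ} (hs : 0 < s)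
    (x : EuclideanSpace ℝ (Fin n)) :
    Integrable (fun y => stepKernel b s x y * ‖stepNoise b s x y‖ ^ 2) ν := by
  have hm : Measurable fun y => stepKernel b s x y * ‖stepNoise b s x y‖ ^ 2 :=
    ((measurable_stepKernel hb).comp (by fun_prop : Measurable fun y :
      EuclideanSpace ℝ (Fin n) => (s, x, y))).mul
      (((measurable_stepNoise hb).comp (by fun_prop : Measurable fun y :
      EuclideanSpace ℝ (Fin n) => (s, x, y))).norm.pow_const 2)
  refine Integrable.of_bound hm.aestronglyMeasurable
    (4 * s * (4 * Real.pi * s) ^ (-((n : ℝ) / 2))) (.of_forall fun y => ?_)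
  rw [Real.norm_of_nonneg (mul_nonneg (stepKernel_pos hs x y).le (sq_nonneg _)), mul_comm]
  exact sq_norm_mul_heatKernel_le hs le_rfl _

/-- Jensen's inequality for the score, which is the conditional mean of `-u / (2s)` given the
endpoint, in a form free of conditional laws: pair the gradient of the density with `v = ∇ log ρ`,
apply Young's inequality under the integral and absorb `ρ ‖v‖² / 2`. -/
lemma stepDensity_mul_sq_norm_logGrad_le (hb : Measurable b) {s : ℝ} (hs : 0 < s)
    (x : EuclideanSpace ℝ (Fin n)) :
    stepDensity b ν s x * ‖(stepDensity b ν s x)⁻¹ • stepDensityGrad b ν s x‖ ^ 2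
      ≤ 1 / (4 * s ^ 2) * ∫ y, stepKernel b s x y * ‖stepNoise b s x y‖ ^ 2 ∂ν := by
  have hρ := stepDensity_pos ν hb hs x
  set v := (stepDensity b ν s x)⁻¹ • stepDensityGrad b ν s x with hv
  have h1 : stepDensityGrad b ν s x = stepDensity b ν s x • v := by
    rw [hv, smul_inv_smul₀ hρ.ne']
  have h2 : stepDensity b ν s x * ‖v‖ ^ 2 = inner ℝ v (stepDensityGrad b ν s x) := by
    rw [h1, inner_smul_right, real_inner_self_eq_norm_sq]
  have i1 := integrable_stepKernel_smul_stepNoise ν hb hs x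
  have i2 := (integrable_stepKernel ν hb hs x).const_mul (1 / 2 * ‖v‖ ^ 2)
  have i3 := (integrable_stepKernel_mul_sq_norm_right ν hb hs x).const_mul (1 / 2 * (1 / (4 * s ^ 2)))
  have h3 : inner ℝ v (stepDensityGrad b ν s x) ≤ 1 / 2 * ‖v‖ ^ 2 * stepDensity b ν s x
      + 1 / 2 * (1 / (4 * s ^ 2)) * ∫ y, stepKernel b s x y * ‖stepNoise b s x y‖ ^ 2 ∂ν := by
    rw [stepDensityGrad, ← integral_inner i1, stepDensity, ← integral_const_mul,
      ← integral_const_mul, ← integral_add i2 i3]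
    refine integral_mono (i1.const_inner v) (i2.add i3) fun y => ?_
    have hk := stepKernel_pos (b := b) hs x y
    have h4 : inner ℝ v (-(stepKernel b s x y / (2 * s)) • stepNoise b s x y)
        = stepKernel b s x y * inner ℝ v (-(1 / (2 * s)) • stepNoise b s x y) := by
      rw [inner_smul_right, inner_smul_right]; ring
    have h5 : inner ℝ v (-(1 / (2 * s)) • stepNoise b s x y)
        ≤ 1 / 2 * ‖v‖ ^ 2 + 1 / 2 * (1 / (4 * s ^ 2)) * ‖stepNoise b s x y‖ ^ 2 := by
      have h6 := real_inner_le_norm v (-(1 / (2 * s)) • stepNoise b s x y)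
      have h7 : ‖-(1 / (2 * s)) • stepNoise b s x y‖ ^ 2
          = 1 / (4 * s ^ 2) * ‖stepNoise b s x y‖ ^ 2 := by
        rw [norm_smul, mul_pow, norm_neg, Real.norm_eq_abs, sq_abs]; ring
      nlinarith [sq_nonneg (‖v‖ - ‖-(1 / (2 * s)) • stepNoise b s x y‖)]
    simp only [h4]
    calc _ ≤ stepKernel b s x y * _ := mul_le_mul_of_nonneg_left h5 hk.le
      _ = _ := by ring
  linarith

variable {M : ℝ}

lemma sq_norm_relScore_le (hb : Measurable b) (hFM : ∀ x, ‖F x‖ ≤ M) {s : ℝ} (hs : 0 < s)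
    (x : EuclideanSpace ℝ (Fin n)) :
    stepDensity b ν s x * ‖relScore b ν F s x‖ ^ 2
      ≤ 1 / (2 * s ^ 2) * (∫ y, stepKernel b s x y * ‖stepNoise b s x y‖ ^ 2 ∂ν)
        + 2 * M ^ 2 * stepDensity b ν s x := by
  have hρ := stepDensity_pos ν hb hs x
  have h1 := stepDensity_mul_sq_norm_logGrad_le ν hb hs x
  have h2 : ‖relScore b ν F s x‖ ^ 2
      ≤ 2 * ‖(stepDensity b ν s x)⁻¹ • stepDensityGrad b ν s x‖ ^ 2 + 2 * M ^ 2 := by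
    have h3 := norm_sub_le ((stepDensity b ν s x)⁻¹ • stepDensityGrad b ν s x) (F x)
    have h4 : ‖relScore b ν F s x‖
        ≤ ‖(stepDensity b ν s x)⁻¹ • stepDensityGrad b ν s x‖ + M :=
      h3.trans (add_le_add le_rfl (hFM x))
    nlinarith [norm_nonneg (relScore b ν F s x), (norm_nonneg _).trans (hFM x),
      norm_nonneg ((stepDensity b ν s x)⁻¹ • stepDensityGrad b ν s x),
      sq_nonneg (‖(stepDensity b ν s x)⁻¹ • stepDensityGrad b ν s x‖ - M)]
  have h5 := mul_le_mul_of_nonneg_left h2 hρ.le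
  have h6 : 1 / (2 * s ^ 2) = 2 * (1 / (4 * s ^ 2)) := by ring
  rw [h6]
  linarith

lemma integrable_stepFisher (hb : Measurable b) (hF : Measurable F) (hFM : ∀ x, ‖F x‖ ≤ M)
    {s : ℝ} (hs : 0 < s) :
    Integrable fun x => stepDensity b ν s x * ‖relScore b ν F s x‖ ^ 2 := by
  have hm : Measurable fun x => stepDensity b ν s x * ‖relScore b ν F s x‖ ^ 2 :=
    (measurable_stepDensity_right hb ν s).mul
      (((measurable_relScore ν hb hF).of_uncurry_left).norm.pow_const 2)
  refine (((integrable_prod_stepKernel_mul_sq_norm ν hb hs).integral_prod_right.const_mul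
    (1 / (2 * s ^ 2))).add ((integrable_stepDensity ν hb hs).const_mul (2 * M ^ 2))).mono'
    hm.aestronglyMeasurable (.of_forall fun x => ?_)
  rw [Real.norm_of_nonneg (mul_nonneg (stepDensity_pos ν hb hs x).le (sq_nonneg _))]
  exact sq_norm_relScore_le ν hb hFM hs x

lemma stepFisher_nonneg (hb : Measurable b) {s : ℝ} (hs : 0 < s) : 0 ≤ stepFisher b ν F s :=
  integral_nonneg fun x => mul_nonneg (stepDensity_pos ν hb hs x).le (sq_nonneg _)

/-- Finite at each positive time. The bound `n / s` is not integrable at 0 when `n > 0`, which is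
one reason for starting at `a > 0`. -/
lemma stepFisher_le (hb : Measurable b) (hF : Measurable F) (hFM : ∀ x, ‖F x‖ ≤ M)
    {s : ℝ} (hs : 0 < s) : stepFisher b ν F s ≤ n / s + 2 * M ^ 2 := by
  have i1 := (integrable_prod_stepKernel_mul_sq_norm ν hb hs)
  have i2 := i1.integral_prod_right.const_mul (1 / (2 * s ^ 2))
  have i3 := (integrable_stepDensity ν hb hs).const_mul (2 * M ^ 2)
  calc stepFisher b ν F s ≤ _ := integral_mono (integrable_stepFisher ν hb hF hFM hs) (i2.add i3)
        fun x => sq_norm_relScore_le ν hb hFM hs x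
    _ = 1 / (2 * s ^ 2) * (2 * n * s) + 2 * M ^ 2 * 1 := by
        simp only [Pi.add_apply]
        rw [integral_add i2 i3, integral_const_mul, integral_const_mul,
          integral_stepDensity ν hb hs, ← integral_prod_symm _ i1,
          integral_prod_stepKernel_mul_sq_norm ν hb hs]
    _ = _ := by field_simp

lemma integrable_driftError (hb : Measurable b) (hF : Measurable F) (hbM : ∀ x, ‖b x‖ ≤ M)
    (hFM : ∀ x, ‖F x‖ ≤ M) {s : ℝ} (hs : 0 < s) :
    Integrable (fun z : EuclideanSpace ℝ (Fin n) × EuclideanSpace ℝ (Fin n) =>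
      stepKernel b s z.2 z.1 * ‖b z.1 - F z.2‖ ^ 2) (ν.prod volume) := by
  have hm : Measurable fun z : EuclideanSpace ℝ (Fin n) × EuclideanSpace ℝ (Fin n) =>
      ‖b z.1 - F z.2‖ ^ 2 :=
    ((hb.comp measurable_fst).sub (hF.comp measurable_snd)).norm.pow_const 2
  refine integrable_prod_stepKernel_mul ν hb hs hm (A := (2 * M) ^ 2) fun z => ?_
  have h1 : ‖b z.1 - F z.2‖ ≤ 2 * M := by
    refine (norm_sub_le _ _).trans ?_
    linarith [hbM z.1, hFM z.2]
  rw [abs_of_nonneg (sq_nonneg _)]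
  calc _ ≤ (2 * M) ^ 2 := pow_le_pow_left₀ (norm_nonneg _) h1 2
    _ ≤ _ := le_mul_of_one_le_right (sq_nonneg _) (by nlinarith [sq_nonneg ‖stepNoise b s z.2 z.1‖])

lemma hasGradientAt_log_ratio (hb : Measurable b) {q : EuclideanSpace ℝ (Fin n) → ℝ}
    (hq : ∀ x, 0 < q x) (hF : ∀ x, HasGradientAt (fun x => Real.log (q x)) (F x) x)
    {s : ℝ} (hs : 0 < s) (x : EuclideanSpace ℝ (Fin n)) :
    HasGradientAt (fun x => Real.log (stepDensity b ν s x / q x)) (relScore b ν F s x) x := by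
  have hρ := stepDensity_pos ν hb hs
  rw [hasGradientAt_iff_hasFDerivAt]
  have h1 := ((hasGradientAt_stepDensity ν hb hs x).hasFDerivAt.log (hρ x).ne').sub (hF x).hasFDerivAt
  refine (h1.congr_of_eventuallyEq (.of_forall fun v => ?_)).congr_fderiv ?_
  · exact Real.log_div (hρ v).ne' (hq v).ne'
  · rw [relScore, map_sub]
    congr 1
    ext v
    simp

/-- Dissipation of a truncated relative entropy along a noisy Euler step. -/
lemma integral_mul_stepDensityDt_le (hb : Measurable b) (hF : Measurable F)
    (hbM : ∀ x, ‖b x‖ ≤ M) (hFM : ∀ x, ‖F x‖ ≤ M) {q : EuclideanSpace ℝ (Fin n) → ℝ}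
    (hq : ∀ x, 0 < q x) (hqF : ∀ x, HasGradientAt (fun x => Real.log (q x)) (F x) x)
    {ψ ψ' : ℝ → ℝ} (hψ : ∀ r, HasDerivAt ψ (ψ' r) r) (hψ' : Measurable ψ')
    (hψ0 : ∀ r, 0 ≤ ψ' r) (hψ1 : ∀ r, ψ' r ≤ 1) {A : ℝ} (hA : ∀ r, |ψ r| ≤ A)
    {s : ℝ} (hs : 0 < s) :
    ∫ x, ψ (Real.log (stepDensity b ν s x / q x)) * stepDensityDt b ν s x
      ≤ -(3 / 4) * (∫ x, ψ' (Real.log (stepDensity b ν s x / q x))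
        * (stepDensity b ν s x * ‖relScore b ν F s x‖ ^ 2)) + driftError b ν F s := by
  set w := fun x => Real.log (stepDensity b ν s x / q x) with hw
  set W := relScore b ν F s with hW
  have hwg : ∀ x, HasGradientAt w (W x) x := hasGradientAt_log_ratio ν hb hq hqF hs
  have hwm : Measurable w :=
    (continuous_iff_continuousAt.2 fun x => (hwg x).continuousAt).measurable
  have hWm : Measurable W := (measurable_relScore ν hb hF).of_uncurry_left
  have hfg : ∀ x, HasGradientAt (fun x => ψ (w x)) (ψ' (w x) • W x) x := by
    intro x
    rw [hasGradientAt_iff_hasFDerivAt]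
    refine ((hψ (w x)).comp_hasFDerivAt x (hwg x).hasFDerivAt).congr_fderiv ?_
    ext v; simp
  have iI := integrable_stepFisher ν hb hF hFM hs
  have hρ := stepDensity_pos ν hb hs
  have iI' : Integrable fun x => ψ' (w x) * (stepDensity b ν s x * ‖W x‖ ^ 2) :=
    iI.bdd_mul (hψ'.comp hwm).aestronglyMeasurable (c := 1) (.of_forall fun x => by
      change ‖ψ' (w x)‖ ≤ 1
      rw [Real.norm_of_nonneg (hψ0 _)]; exact hψ1 _)
  have hm' : Measurable fun x => ψ' (w x) • W x := (hψ'.comp hwm).smul hWm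
  have iI2 : Integrable fun x => stepDensity b ν s x * ‖ψ' (w x) • W x‖ ^ 2 := by
    refine iI.mono' ((measurable_stepDensity_right hb ν s).mul
      (hm'.norm.pow_const 2)).aestronglyMeasurable (.of_forall fun x => ?_)
    rw [Real.norm_of_nonneg (mul_nonneg (hρ x).le (sq_nonneg _))]
    refine mul_le_mul_of_nonneg_left (pow_le_pow_left₀ (norm_nonneg _) ?_ 2) (hρ x).le
    rw [norm_smul, Real.norm_of_nonneg (hψ0 _)]
    exact mul_le_of_le_one_left (norm_nonneg _) (hψ1 _)
  obtain ⟨h1, h2⟩ := integral_mul_stepDensityDt ν hb hbM hs hfg hm' (fun x => hA _) iI2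
  have iD := integrable_driftError ν hb hF hbM hFM hs
  rw [h2, driftError, integral_prod_symm _ h1, integral_prod_symm _ iD, ← integral_const_mul,
    ← integral_add (iI'.const_mul _) iD.integral_prod_right]
  refine integral_mono h1.integral_prod_right ((iI'.const_mul _).add iD.integral_prod_right)
    fun x => ?_
  have hgrad : stepDensityGrad b ν s x = stepDensity b ν s x • (W x + F x) := by
    rw [hW, relScore, sub_add_cancel, smul_inv_smul₀ (hρ x).ne']
  have j1 := (integrable_stepKernel_smul_stepNoise ν hb hs x).const_inner (𝕜 := ℝ)
    (ψ' (w x) • W x)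
  have j2 := integrable_stepKernel ν hb hs x
  have j3 : Integrable (fun y => stepKernel b s x y * ‖b y - F x‖ ^ 2) ν := by
    have hm : Measurable fun y => ‖b y - F x‖ ^ 2 := (hb.sub_const _).norm.pow_const 2
    refine j2.mul_bdd (c := (2 * M) ^ 2) hm.aestronglyMeasurable (.of_forall fun y => ?_)
    rw [Real.norm_of_nonneg (sq_nonneg _)]
    refine pow_le_pow_left₀ (norm_nonneg _) ((norm_sub_le _ _).trans ?_) 2
    linarith [hbM y, hFM x]
  set a := ψ' (w x) with ha
  have hcomp : ∀ y, stepKernel b s x y *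
      inner ℝ (a • W x) ((1 / (2 * s)) • stepNoise b s x y + b y)
      ≤ -inner ℝ (a • W x) (-(stepKernel b s x y / (2 * s)) • stepNoise b s x y)
        + (stepKernel b s x y * (a * inner ℝ (W x) (F x) + a / 4 * ‖W x‖ ^ 2)
          + stepKernel b s x y * ‖b y - F x‖ ^ 2) := by
    intro y
    have hk := stepKernel_pos (b := b) hs x y
    -- The noise part integrates over the starts to `-∇ρ = -ρ (W + F)`. Adding and subtracting `F`
    -- in the drift part cancels the `F` term and leaves `-a ρ ‖W‖²` plus the pairing of `W` with
    -- `b(y) - F(x)`.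
    have e1 : stepKernel b s x y * inner ℝ (a • W x) ((1 / (2 * s)) • stepNoise b s x y + b y)
        = -inner ℝ (a • W x) (-(stepKernel b s x y / (2 * s)) • stepNoise b s x y)
          + stepKernel b s x y * (a * inner ℝ (W x) (F x) + a * inner ℝ (W x) (b y - F x)) := by
      simp only [inner_smul_left, inner_smul_right, inner_add_right, inner_sub_right,
        conj_trivial]
      ring
    rw [e1]
    -- Young's inequality with weight `1/4` is the source of the factor `3/4`. The slope `a ≤ 1` is
    -- kept on `‖W‖²` and dropped from the error.
    have e2 : a * inner ℝ (W x) (b y - F x) ≤ a / 4 * ‖W x‖ ^ 2 + ‖b y - F x‖ ^ 2 := by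
      have e3 := real_inner_le_norm (W x) (b y - F x)
      have e4 : inner ℝ (W x) (b y - F x) ≤ 1 / 4 * ‖W x‖ ^ 2 + ‖b y - F x‖ ^ 2 := by
        nlinarith [sq_nonneg (1 / 2 * ‖W x‖ - ‖b y - F x‖)]
      have e5 := mul_le_mul_of_nonneg_left e4 (hψ0 (w x))
      have e6 : a * ‖b y - F x‖ ^ 2 ≤ ‖b y - F x‖ ^ 2 :=
        mul_le_of_le_one_left (sq_nonneg _) (hψ1 _)
      rw [← ha] at e5
      linarith
    have e7 := mul_le_mul_of_nonneg_left e2 hk.le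
    linarith
  have j4 := j2.mul_const (a * inner ℝ (W x) (F x) + a / 4 * ‖W x‖ ^ 2)
  have jl : Integrable (fun y => stepKernel b s x y *
      inner ℝ (a • W x) ((1 / (2 * s)) • stepNoise b s x y + b y)) ν := by
    have j5 : Integrable (fun y => stepKernel b s x y * inner ℝ (a • W x) (b y)) ν := by
      refine j2.mul_bdd (c := ‖a • W x‖ * M)
        (Measurable.inner measurable_const hb).aestronglyMeasurable (.of_forall fun y => ?_)
      exact (abs_real_inner_le_norm _ _).trans
        (mul_le_mul_of_nonneg_left (hbM y) (norm_nonneg _))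
    refine (j1.neg.add j5).congr (.of_forall fun y => ?_)
    simp only [Pi.add_apply, Pi.neg_apply, inner_smul_right, inner_add_right]
    ring
  calc _ ≤ ∫ y, (-inner ℝ (a • W x) (-(stepKernel b s x y / (2 * s)) • stepNoise b s x y)
        + (stepKernel b s x y * (a * inner ℝ (W x) (F x) + a / 4 * ‖W x‖ ^ 2)
          + stepKernel b s x y * ‖b y - F x‖ ^ 2)) ∂ν :=
        integral_mono jl (j1.neg.add (j4.add j3)) hcomp
    _ = -inner ℝ (a • W x) (stepDensityGrad b ν s x) + (stepDensity b ν s x *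
          (a * inner ℝ (W x) (F x) + a / 4 * ‖W x‖ ^ 2)
          + ∫ y, stepKernel b s x y * ‖b y - F x‖ ^ 2 ∂ν) := by
        have j1' : Integrable (fun y => -inner ℝ (a • W x)
            (-(stepKernel b s x y / (2 * s)) • stepNoise b s x y)) ν := j1.neg
        have j6 : Integrable (fun y => stepKernel b s x y * (a * inner ℝ (W x) (F x)
            + a / 4 * ‖W x‖ ^ 2) + stepKernel b s x y * ‖b y - F x‖ ^ 2) ν := j4.add j3
        rw [integral_add j1' j6, integral_add j4 j3, integral_neg,
          integral_inner (integrable_stepKernel_smul_stepNoise ν hb hs x), integral_mul_const]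
        rfl
    _ = _ := by
        rw [hgrad]
        simp only [inner_smul_left, inner_smul_right, inner_add_right, conj_trivial,
          real_inner_self_eq_norm_sq]
        ring

end Dissipation

end

/-! ### Control of the drift error by the Fisher information -/

noncomputable section

section DriftError

variable {n : ℕ} {b F : EuclideanSpace ℝ (Fin n) → EuclideanSpace ℝ (Fin n)}
  (ν : Measure (EuclideanSpace ℝ (Fin n))) [IsProbabilityMeasure ν] {M L : ℝ}

lemma integral_stepKernel_mul_inner (s : ℝ) (v y : EuclideanSpace ℝ (Fin n)) :
    ∫ x, stepKernel b s x y * inner ℝ v (stepNoise b s x y) = 0 := by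
  refine (integral_comp_stepNoise (b := b) s y fun u => heatKernel s u * inner ℝ v u).trans ?_
  simp_rw [mul_comm (heatKernel s _)]
  exact integral_inner_mul_heatKernel s v

lemma integrable_stepKernel_mul_inner {s : ℝ} (hs : 0 < s) (hF : Measurable F)
    (hFM : ∀ x, ‖F x‖ ≤ M) (y : EuclideanSpace ℝ (Fin n)) :
    Integrable fun x => stepKernel b s x y * inner ℝ (F x) (stepNoise b s x y) := by
  have huc : Continuous fun x => stepNoise b s x y := by unfold stepNoise; fun_prop
  have hkc : Continuous fun x => stepKernel b s x y := (continuous_heatKernel s).comp huc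
  have hM0 : 0 ≤ M := (norm_nonneg _).trans (hFM y)
  refine (((integrable_stepKernel_left (b := b) hs y).add
    (integrable_stepKernel_mul_sq_norm_left (b := b) hs y)).const_mul M).mono'
    (hkc.measurable.mul (hF.inner huc.measurable)).aestronglyMeasurable (.of_forall fun x => ?_)
  have hk := stepKernel_pos (b := b) hs x y
  rw [norm_mul, Real.norm_of_nonneg hk.le]
  calc _ ≤ stepKernel b s x y * (M * (1 + ‖stepNoise b s x y‖ ^ 2)) := by
        refine mul_le_mul_of_nonneg_left ((abs_real_inner_le_norm _ _).trans ?_) hk.le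
        exact mul_le_mul (hFM x) (norm_le_one_add_sq _) (norm_nonneg _) hM0
    _ = _ := by simp only [Pi.add_apply]; ring

/-- This stands in for `-∫ ρ div F ≤ n L` without differentiating `F`. The gradient of the kernel is
`-k u / (2s)`; since the noise is centred, `F` may be replaced by its difference from the value at
the mean of the step, which is at most `L ‖u‖`, and the second moment of `u` is `2 n s`. -/
lemma integral_inner_stepDensityGrad_le (hb : Measurable b) (hF : Measurable F)
    (hFM : ∀ x, ‖F x‖ ≤ M) (hFL : ∀ x y, ‖F x - F y‖ ≤ L * ‖x - y‖) {s : ℝ} (hs : 0 < s) :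
    Integrable (fun x => inner ℝ (F x) (stepDensityGrad b ν s x)) ∧
      ∫ x, inner ℝ (F x) (stepDensityGrad b ν s x) ≤ n * L := by
  have hu := measurable_stepNoise_prod hb s
  have hF2 : Measurable fun z : EuclideanSpace ℝ (Fin n) × EuclideanSpace ℝ (Fin n) => F z.2 :=
    hF.comp measurable_snd
  have hM0 : 0 ≤ M := (norm_nonneg _).trans (hFM 0)
  have h1 : Integrable (fun z : EuclideanSpace ℝ (Fin n) × EuclideanSpace ℝ (Fin n) =>
      stepKernel b s z.2 z.1 * (-(1 / (2 * s)) * inner ℝ (F z.2) (stepNoise b s z.2 z.1)))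
      (ν.prod volume) := by
    refine integrable_prod_stepKernel_mul ν hb hs ((hF2.inner hu).const_mul _)
      (A := 1 / (2 * s) * M) fun z => ?_
    rw [abs_mul, abs_neg, abs_of_nonneg (by positivity : 0 ≤ 1 / (2 * s)), mul_assoc]
    refine mul_le_mul_of_nonneg_left ((abs_real_inner_le_norm _ _).trans ?_) (by positivity)
    exact mul_le_mul (hFM _) (norm_le_one_add_sq _) (norm_nonneg _) hM0
  have h2 : ∀ x, ∫ y, stepKernel b s x y * (-(1 / (2 * s)) * inner ℝ (F x) (stepNoise b s x y)) ∂ν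
      = inner ℝ (F x) (stepDensityGrad b ν s x) := by
    intro x
    rw [stepDensityGrad, ← integral_inner (integrable_stepKernel_smul_stepNoise ν hb hs x)]
    congr 1; ext y
    rw [inner_smul_right]; ring
  refine ⟨h1.integral_prod_right.congr (.of_forall h2), ?_⟩
  simp_rw [← h2]
  rw [← integral_prod_symm (fun z : EuclideanSpace ℝ (Fin n) × EuclideanSpace ℝ (Fin n) =>
    stepKernel b s z.2 z.1 * (-(1 / (2 * s)) * inner ℝ (F z.2) (stepNoise b s z.2 z.1))) h1,
    integral_prod _ h1]
  have h3 : ∀ y, ∫ x, stepKernel b s x y *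
      (-(1 / (2 * s)) * inner ℝ (F x) (stepNoise b s x y)) ≤ n * L := by
    intro y
    -- The value of `F` at the noiseless endpoint; pairing this constant with the centred noise
    -- contributes nothing.
    set c := F (y + s • b y) with hc
    have i1 := integrable_stepKernel_mul_inner (b := b) hs hF hFM y
    have i2 := integrable_stepKernel_mul_inner (b := b) hs (F := fun _ => c) measurable_const
      (fun _ => le_rfl) y
    have i3 := integrable_stepKernel_mul_sq_norm_left (b := b) hs y
    calc _ = -(1 / (2 * s)) * ((∫ x, stepKernel b s x y * inner ℝ (F x) (stepNoise b s x y))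
            - ∫ x, stepKernel b s x y * inner ℝ c (stepNoise b s x y)) := by
          rw [integral_stepKernel_mul_inner, sub_zero, ← integral_const_mul]
          congr 1; ext x; ring
      _ = ∫ x, -(1 / (2 * s)) * (stepKernel b s x y * inner ℝ (F x) (stepNoise b s x y)
            - stepKernel b s x y * inner ℝ c (stepNoise b s x y)) := by
          rw [← integral_sub i1 i2, integral_const_mul]
      _ ≤ ∫ x, L / (2 * s) * (stepKernel b s x y * ‖stepNoise b s x y‖ ^ 2) := by
          refine integral_mono ((i1.sub i2).const_mul _) (i3.const_mul _) fun x => ?_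
          have hk := stepKernel_pos (b := b) hs x y
          have h4 : -inner ℝ (F x - c) (stepNoise b s x y) ≤ L * ‖stepNoise b s x y‖ ^ 2 := by
            have h5 := neg_le_of_abs_le (abs_real_inner_le_norm (F x - c) (stepNoise b s x y))
            have h6 : ‖F x - c‖ ≤ L * ‖stepNoise b s x y‖ := hFL x (y + s • b y)
            nlinarith [norm_nonneg (stepNoise b s x y)]
          rw [inner_sub_left] at h4
          have h7 : 0 ≤ stepKernel b s x y / (2 * s) := by positivity
          have h8 := mul_le_mul_of_nonneg_left h4 h7
          calc _ = stepKernel b s x y / (2 * s) * -(inner ℝ (F x) (stepNoise b s x y)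
                - inner ℝ c (stepNoise b s x y)) := by
                ring
            _ ≤ _ := h8
            _ = _ := by ring
      _ = _ := by
          rw [integral_const_mul, integral_stepKernel_mul_sq_norm hs]
          field_simp
  calc _ ≤ ∫ _, (n * L : ℝ) ∂ν := integral_mono h1.integral_prod_left (integrable_const _) h3
    _ = _ := by simp

/-- The second moment of a Lipschitz score is controlled by the relative Fisher information. -/
lemma integral_stepDensity_mul_sq_norm_le (hb : Measurable b) (hF : Measurable F)
    (hFM : ∀ x, ‖F x‖ ≤ M) (hFL : ∀ x y, ‖F x - F y‖ ≤ L * ‖x - y‖) {s : ℝ} (hs : 0 < s) :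
    Integrable (fun x => stepDensity b ν s x * ‖F x‖ ^ 2) ∧
      ∫ x, stepDensity b ν s x * ‖F x‖ ^ 2 ≤ stepFisher b ν F s + 2 * n * L := by
  have hρ := stepDensity_pos ν hb hs
  obtain ⟨i1, h1⟩ := integral_inner_stepDensityGrad_le ν hb hF hFM hFL hs
  have i2 := integrable_stepFisher ν hb hF hFM hs
  have i3 : Integrable (fun x => stepDensity b ν s x * ‖F x‖ ^ 2) := by
    refine (integrable_stepDensity ν hb hs).mul_bdd (c := M ^ 2)
      (hF.norm.pow_const 2).aestronglyMeasurable (.of_forall fun x => ?_)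
    rw [Real.norm_of_nonneg (sq_nonneg _)]
    exact pow_le_pow_left₀ (norm_nonneg _) (hFM x) 2
  refine ⟨i3, ?_⟩
  have h2 : ∫ x, stepDensity b ν s x * ‖F x‖ ^ 2 ≤ ∫ x, (2 * inner ℝ (F x) (stepDensityGrad b ν s x)
      + stepDensity b ν s x * ‖relScore b ν F s x‖ ^ 2) := by
    refine integral_mono i3 ((i1.const_mul 2).add i2) fun x => ?_
    have hgrad : stepDensityGrad b ν s x
        = stepDensity b ν s x • (relScore b ν F s x + F x) := by
      rw [relScore, sub_add_cancel, smul_inv_smul₀ (hρ x).ne']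
    -- The right side exceeds the left by exactly `‖W + F‖² ≥ 0`, where `W + F` is the score of the
    -- density itself.
    have h3 : ‖F x‖ ^ 2 ≤ 2 * inner ℝ (F x) (relScore b ν F s x + F x)
        + ‖relScore b ν F s x‖ ^ 2 := by
      have h4 := norm_add_sq_real (F x) (relScore b ν F s x)
      rw [inner_add_right, real_inner_self_eq_norm_sq]
      nlinarith [sq_nonneg ‖F x + relScore b ν F s x‖]
    simp only [hgrad, inner_smul_right]
    nlinarith [mul_le_mul_of_nonneg_left h3 (hρ x).le]
  rw [integral_add (i1.const_mul 2) i2, integral_const_mul] at h2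
  change _ ≤ (∫ x, stepDensity b ν s x * ‖relScore b ν F s x‖ ^ 2) + _
  linarith

/-- The drift error of a short Euler step is controlled by the relative Fisher information. -/
lemma driftError_le (hb : Measurable b) (hF : Measurable F) (hbM : ∀ x, ‖b x‖ ≤ M)
    (hFM : ∀ x, ‖F x‖ ≤ M) (hFL : ∀ x y, ‖F x - F y‖ ≤ L * ‖x - y‖)
    (hbL : ∀ x y, ‖b x - b y‖ ≤ L * ‖x - y‖) {e : ℝ} (he : ∀ x, ‖b x - F x‖ ≤ e)
    {s : ℝ} (hs : 0 < s) (hsL : s ^ 2 * L ^ 2 ≤ 1 / 32) :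
    driftError b ν F s
      ≤ 1 / 3 * stepFisher b ν F s + 44 / 3 * n * L ^ 2 * s + 8 / 3 * e ^ 2 := by
  have iD := integrable_driftError ν hb hF hbM hFM hs
  obtain ⟨iF, hFI⟩ := integral_stepDensity_mul_sq_norm_le ν hb hF hFM hFL hs
  have iF2 := integrable_prod_stepKernel_mul_of_right ν hb hs (hF.norm.pow_const 2)
    (fun x => sq_nonneg _) iF
  have iu := integrable_prod_stepKernel_mul_sq_norm ν hb hs
  have ik := integrable_prod_stepKernel ν hb hs
  have key : driftError b ν F s ≤ ∫ z, (16 / 3 * L ^ 2 * (stepKernel b s z.2 z.1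
      * ‖stepNoise b s z.2 z.1‖ ^ 2) + (32 / 3 * (s ^ 2 * L ^ 2) * (stepKernel b s z.2 z.1
      * ‖F z.2‖ ^ 2) + 8 / 3 * e ^ 2 * stepKernel b s z.2 z.1)) ∂(ν.prod volume) := by
    refine integral_mono iD ((iu.const_mul _).add ((iF2.const_mul _).add (ik.const_mul _)))
      fun z => ?_
    have hk := stepKernel_pos (b := b) hs z.2 z.1
    set y := z.1
    set x := z.2
    set u := stepNoise b s x y with hu
    have h0 : ‖x - y‖ ≤ ‖u‖ + s * ‖b y‖ := by
      have : x - y = u + s • b y := by rw [hu, stepNoise]; abel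
      rw [this]
      refine (norm_add_le _ _).trans ?_
      rw [norm_smul, Real.norm_of_nonneg hs.le]
    have h1 : ‖b y‖ ≤ ‖b y - F x‖ + ‖F x‖ := by
      simpa using norm_add_le (b y - F x) (F x)
    have h2 : ‖b y - F x‖ ≤ L * ‖x - y‖ + e := by
      have h3 := norm_add_le (b y - b x) (b x - F x)
      rw [sub_add_sub_cancel] at h3
      have h4 := hbL y x
      rw [norm_sub_rev y x] at h4
      linarith [he x]
    -- Write `D = ‖b y - F x‖`. Chaining three applications of `(α + β)² ≤ 2 α² + 2 β²` returns `8
    -- s² L² D² ≤ D² / 4` on the right. Absorbing it and multiplying by `4/3` turns the coefficients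
    -- 4, 8, 2 into `16/3`, `32/3`, `8/3`.
    have h3 : ‖b y - F x‖ ^ 2 ≤ 16 / 3 * L ^ 2 * ‖u‖ ^ 2
        + 32 / 3 * (s ^ 2 * L ^ 2) * ‖F x‖ ^ 2 + 8 / 3 * e ^ 2 := by
      have a1 : ‖b y - F x‖ ^ 2 ≤ 2 * (L * ‖x - y‖) ^ 2 + 2 * e ^ 2 :=
        (pow_le_pow_left₀ (norm_nonneg _) h2 2).trans (by
          nlinarith [sq_nonneg (L * ‖x - y‖ - e)])
      have a2 : ‖x - y‖ ^ 2 ≤ 2 * ‖u‖ ^ 2 + 2 * (s * ‖b y‖) ^ 2 :=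
        (pow_le_pow_left₀ (norm_nonneg _) h0 2).trans (by
          nlinarith [sq_nonneg (‖u‖ - s * ‖b y‖)])
      have a3 : ‖b y‖ ^ 2 ≤ 2 * ‖b y - F x‖ ^ 2 + 2 * ‖F x‖ ^ 2 :=
        (pow_le_pow_left₀ (norm_nonneg _) h1 2).trans (by
          nlinarith [sq_nonneg (‖b y - F x‖ - ‖F x‖)])
      have b2 := mul_le_mul_of_nonneg_left a2 (sq_nonneg L)
      have b3 := mul_le_mul_of_nonneg_left a3 (by positivity : 0 ≤ s ^ 2 * L ^ 2)
      have b4 := mul_le_mul_of_nonneg_right hsL (sq_nonneg ‖b y - F x‖)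
      have e1 : (L * ‖x - y‖) ^ 2 = L ^ 2 * ‖x - y‖ ^ 2 := by ring
      have e2 : L ^ 2 * (2 * ‖u‖ ^ 2 + 2 * (s * ‖b y‖) ^ 2)
        = 2 * (L ^ 2 * ‖u‖ ^ 2) + 2 * (s ^ 2 * L ^ 2 * ‖b y‖ ^ 2) := by ring
      rw [e1] at a1
      rw [e2] at b2
      linarith
    calc _ ≤ stepKernel b s x y * _ := mul_le_mul_of_nonneg_left h3 hk.le
      _ = _ := by ring
  rw [integral_add (iu.const_mul _) (by exact (iF2.const_mul _).add (ik.const_mul _)),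
    integral_add (iF2.const_mul _) (ik.const_mul _),
    integral_const_mul, integral_const_mul, integral_const_mul,
    integral_prod_stepKernel_mul_sq_norm ν hb hs, integral_prod_stepKernel ν hb hs,
    integral_prod_stepKernel_mul_of_right ν (φ := fun x => ‖F x‖ ^ 2) iF2] at key
  have hI := stepFisher_nonneg ν (F := F) hb hs
  -- `3/16` is a rational upper bound for `1/√32`. With it the dimension terms add up to `32/3 +
  -- 64/3 · 3/16 = 44/3`.
  have hsL' : s * L ≤ 3 / 16 := by
    refine le_of_sq_le_sq ?_ (by norm_num)
    rw [mul_pow]; linarith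
  have c1 := mul_le_mul_of_nonneg_left hFI (by positivity : 0 ≤ 32 / 3 * (s ^ 2 * L ^ 2))
  have c2 := mul_le_mul_of_nonneg_right hsL hI
  have c3 := mul_le_mul_of_nonneg_right hsL'
    (by positivity : 0 ≤ 64 / 3 * n * L ^ 2 * s)
  have c4 : 32 / 3 * (s ^ 2 * L ^ 2) * (stepFisher b ν F s + 2 * n * L)
    = 32 / 3 * (s ^ 2 * L ^ 2 * stepFisher b ν F s) + s * L * (64 / 3 * n * L ^ 2 * s) := by ring
  rw [c4] at c1
  linarith

end DriftError

end

/-! ### Truncated entropy functions and divergences of laws with densities -/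

noncomputable section

/-- A bounded smooth truncation of the identity. -/
def truncId (m w : ℝ) : ℝ := m * Real.arctan (w / m)

/-- The truncation of `InformationTheory.klFun` with derivative `truncId m ∘ log`. -/
def truncKlFun (m r : ℝ) : ℝ := ∫ t in (1 : ℝ)..r, truncId m (Real.log t)

section Truncation

variable {m : ℝ}

lemma hasDerivAt_truncId (hm : 0 < m) (w : ℝ) :
    HasDerivAt (truncId m) (1 / (1 + (w / m) ^ 2)) w := by
  have h := (((hasDerivAt_id w).div_const m).arctan).const_mul m
  refine h.congr_deriv ?_
  simp only [id]
  field_simp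

lemma continuous_truncId (m : ℝ) : Continuous (truncId m) := by
  unfold truncId; fun_prop

lemma abs_truncId_le (hm : 0 < m) (w : ℝ) : |truncId m w| ≤ m * (Real.pi / 2) := by
  rw [truncId, abs_mul, abs_of_pos hm]
  refine mul_le_mul_of_nonneg_left (abs_le.2 ⟨?_, ?_⟩) hm.le
  · exact (Real.neg_pi_div_two_lt_arctan _).le
  · exact (Real.arctan_lt_pi_div_two _).le

lemma arctan_le_self_of_nonneg {x : ℝ} (hx : 0 ≤ x) : Real.arctan x ≤ x := by
  have h : Monotone fun x => x - Real.arctan x := by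
    refine monotone_of_deriv_nonneg
      (differentiable_id.sub Real.differentiable_arctan) fun x => ?_
    have : HasDerivAt (fun x => x - Real.arctan x) (1 - 1 / (1 + x ^ 2)) x :=
      (hasDerivAt_id x).sub (Real.hasDerivAt_arctan x)
    rw [this.deriv, sub_nonneg, div_le_one (by positivity)]
    nlinarith [sq_nonneg x]
  have := h hx
  simp only [Real.arctan_zero, sub_zero] at this
  linarith

lemma truncId_nonneg (hm : 0 < m) {w : ℝ} (hw : 0 ≤ w) : 0 ≤ truncId m w :=
  mul_nonneg hm.le (Real.arctan_nonneg.2 (by positivity))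

lemma truncId_le_self (hm : 0 < m) {w : ℝ} (hw : 0 ≤ w) : truncId m w ≤ w := by
  calc truncId m w ≤ m * (w / m) :=
        mul_le_mul_of_nonneg_left (arctan_le_self_of_nonneg (by positivity)) hm.le
    _ = w := by field_simp

lemma truncId_neg (m w : ℝ) : truncId m (-w) = -truncId m w := by
  simp [truncId, neg_div, Real.arctan_neg]

lemma abs_truncId_le_abs (hm : 0 < m) (w : ℝ) : |truncId m w| ≤ |w| := by
  rcases le_total 0 w with h | h
  · rw [abs_of_nonneg h, abs_of_nonneg (truncId_nonneg hm h)]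
    exact truncId_le_self hm h
  · rw [← abs_neg, ← truncId_neg, ← abs_neg w]
    have h' : 0 ≤ -w := by linarith
    rw [abs_of_nonneg h', abs_of_nonneg (truncId_nonneg hm h')]
    exact truncId_le_self hm h'

/-- For `w ≠ 0` this is the slope of `arctan` at 0, multiplied by `w`. -/
lemma tendsto_truncId (w : ℝ) :
    Filter.Tendsto (fun m => truncId m w) Filter.atTop (nhds w) := by
  rcases eq_or_ne w 0 with rfl | hw
  · simp [truncId]
  have h1 : Filter.Tendsto (fun m : ℝ => w / m) Filter.atTop (nhdsWithin 0 {0}ᶜ) := by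
    refine tendsto_nhdsWithin_iff.2 ⟨tendsto_const_nhds.div_atTop Filter.tendsto_id, ?_⟩
    filter_upwards [Filter.eventually_gt_atTop 0] with m hm
    exact div_ne_zero hw hm.ne'
  have h2 := (hasDerivAt_iff_tendsto_slope.1 (Real.hasDerivAt_arctan 0)).comp h1
  have h3 := h2.const_mul w
  simp only [ne_eq, OfNat.ofNat_ne_zero, not_false_eq_true, zero_pow, add_zero, div_one,
    mul_one] at h3
  refine h3.congr' ?_
  filter_upwards [Filter.eventually_gt_atTop 0] with m hm
  simp only [Function.comp, slope_def_field, Real.arctan_zero, sub_zero, truncId]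
  field_simp

lemma measurable_truncId_log (m : ℝ) : Measurable fun t => truncId m (Real.log t) :=
  (continuous_truncId m).measurable.comp Real.measurable_log

lemma intervalIntegrable_truncId_log (hm : 0 < m) (a c : ℝ) :
    IntervalIntegrable (fun t => truncId m (Real.log t)) volume a c := by
  refine (intervalIntegrable_const (c := m * (Real.pi / 2))).mono_fun
    (measurable_truncId_log m).aestronglyMeasurable (.of_forall fun t => ?_)
  exact (abs_truncId_le hm _).trans (le_abs_self _)

lemma hasDerivAt_truncKlFun (hm : 0 < m) {r : ℝ} (hr : 0 < r) :
    HasDerivAt (truncKlFun m) (truncId m (Real.log r)) r :=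
  intervalIntegral.integral_hasDerivAt_right (intervalIntegrable_truncId_log hm 1 r)
    (measurable_truncId_log m).stronglyMeasurable.stronglyMeasurableAtFilter
    ((continuous_truncId m).continuousAt.comp (Real.continuousAt_log hr.ne'))

/-- Linear growth, because the derivative is bounded; hence the truncated entropy is finite for
every pair of probability densities. -/
lemma abs_truncKlFun_le (hm : 0 < m) (r : ℝ) :
    |truncKlFun m r| ≤ m * (Real.pi / 2) * |r - 1| := by
  rw [← Real.norm_eq_abs]
  exact intervalIntegral.norm_integral_le_of_norm_le_const
    fun t _ => (Real.norm_eq_abs _).trans_le (abs_truncId_le hm (Real.log t))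

lemma measurable_truncKlFun (hm : 0 < m) : Measurable (truncKlFun m) :=
  (intervalIntegral.continuous_primitive (intervalIntegrable_truncId_log hm) 1).measurable

lemma klFun_eq_integral {r : ℝ} (hr : 0 < r) :
    InformationTheory.klFun r = ∫ t in (1 : ℝ)..r, Real.log t := by
  rw [intervalIntegral.integral_eq_sub_of_hasDerivAt (f := InformationTheory.klFun)
    (fun t ht => InformationTheory.hasDerivAt_klFun ?_) intervalIntegral.intervalIntegrable_log',
    InformationTheory.klFun_one, sub_zero]
  rintro rfl
  rw [Set.mem_uIcc] at ht
  rcases ht with h | h <;> linarith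

lemma truncKlFun_nonneg (hm : 0 < m) {r : ℝ} (hr : 0 < r) : 0 ≤ truncKlFun m r := by
  unfold truncKlFun
  rcases le_total 1 r with h | h
  · exact intervalIntegral.integral_nonneg h fun t ht => truncId_nonneg hm (Real.log_nonneg ht.1)
  · rw [intervalIntegral.integral_symm, ← intervalIntegral.integral_neg]
    refine intervalIntegral.integral_nonneg h fun t ht => ?_
    rw [← truncId_neg]
    exact truncId_nonneg hm (neg_nonneg.2 (Real.log_nonpos (hr.le.trans ht.1) ht.2))

/-- Both functions are primitives from 1, and truncation shrinks the logarithm towards 0. On `r ≤ 1`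
the sign of the logarithm and the orientation of the integral both change. -/
lemma truncKlFun_le (hm : 0 < m) {r : ℝ} (hr : 0 < r) :
    truncKlFun m r ≤ InformationTheory.klFun r := by
  rw [klFun_eq_integral hr]
  unfold truncKlFun
  rcases le_total 1 r with h | h
  · exact intervalIntegral.integral_mono_on h (intervalIntegrable_truncId_log hm _ _)
      intervalIntegral.intervalIntegrable_log'
      fun t ht => truncId_le_self hm (Real.log_nonneg ht.1)
  · rw [intervalIntegral.integral_symm, intervalIntegral.integral_symm r 1, neg_le_neg_iff]
    refine intervalIntegral.integral_mono_on h intervalIntegral.intervalIntegrable_log'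
      (intervalIntegrable_truncId_log hm _ _) fun t ht => ?_
    have := truncId_le_self hm (neg_nonneg.2 (Real.log_nonpos (hr.le.trans ht.1) ht.2))
    rw [truncId_neg] at this
    linarith

lemma tendsto_truncKlFun {r : ℝ} (hr : 0 < r) :
    Filter.Tendsto (fun m => truncKlFun m r) Filter.atTop
      (nhds (InformationTheory.klFun r)) := by
  rw [klFun_eq_integral hr]
  refine intervalIntegral.tendsto_integral_filter_of_dominated_convergence
    (fun t => |Real.log t|)
    (.of_forall fun m => (measurable_truncId_log m).aestronglyMeasurable) ?_
    intervalIntegral.intervalIntegrable_log'.abs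
    (.of_forall fun t _ => tendsto_truncId _)
  filter_upwards [Filter.eventually_gt_atTop 0] with m hm
  exact .of_forall fun t _ => abs_truncId_le_abs hm _

end Truncation

/-- Identifies the quotient of the densities as a version of the Radon-Nikodym derivative. It serves
the divergence and also supplies the positive differentiable ratio that `fisherInfo` asks for. -/
lemma withDensity_ofReal_div {α : Type*} [MeasurableSpace α] {μ : Measure α} {ρ q : α → ℝ}
    (hρm : Measurable ρ) (hqm : Measurable q) (hq : ∀ x, 0 < q x) :
    (μ.withDensity fun x => ENNReal.ofReal (q x)).withDensity
      (fun x => ENNReal.ofReal (ρ x / q x)) = μ.withDensity fun x => ENNReal.ofReal (ρ x) := by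
  rw [← withDensity_mul _ (by fun_prop) (by fun_prop)]
  congr 1
  ext x
  rw [Pi.mul_apply, ← ENNReal.ofReal_mul (hq x).le, mul_div_cancel₀ _ (hq x).ne']

lemma isProbabilityMeasure_withDensity_ofReal {α : Type*} [MeasurableSpace α] {μ : Measure α}
    {ρ : α → ℝ} (hρ : ∀ x, 0 ≤ ρ x) (hi : Integrable ρ μ) (h1 : ∫ x, ρ x ∂μ = 1) :
    IsProbabilityMeasure (μ.withDensity fun x => ENNReal.ofReal (ρ x)) := by
  refine ⟨?_⟩
  rw [withDensity_apply _ MeasurableSet.univ, Measure.restrict_univ, ← ofReal_integral_eq_lintegral_ofReal hi (.of_forall hρ), h1, ENNReal.ofReal_one]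

/-- The Kullback-Leibler divergence of two laws with densities. -/
lemma klDiv_withDensity_ofReal {α : Type*} [MeasurableSpace α] {μ : Measure α} [SigmaFinite μ]
    {ρ q : α → ℝ} (hρm : Measurable ρ) (hqm : Measurable q) (hρ : ∀ x, 0 ≤ ρ x)
    (hq : ∀ x, 0 < q x) [IsFiniteMeasure (μ.withDensity fun x => ENNReal.ofReal (ρ x))]
    [IsFiniteMeasure (μ.withDensity fun x => ENNReal.ofReal (q x))] :
    InformationTheory.klDiv (μ.withDensity fun x => ENNReal.ofReal (ρ x))
      (μ.withDensity fun x => ENNReal.ofReal (q x))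
      = ∫⁻ x, ENNReal.ofReal (q x * InformationTheory.klFun (ρ x / q x)) ∂μ := by
  have h := withDensity_ofReal_div (μ := μ) hρm hqm hq
  set π := μ.withDensity fun x => ENNReal.ofReal (q x) with hπ
  have hac : μ.withDensity (fun x => ENNReal.ofReal (ρ x)) ≪ π := by
    rw [← h]; exact withDensity_absolutelyContinuous _ _
  rw [InformationTheory.klDiv_eq_lintegral_klFun_of_ac hac]
  have hd : (μ.withDensity fun x => ENNReal.ofReal (ρ x)).rnDeriv π
      =ᵐ[π] fun x => ENNReal.ofReal (ρ x / q x) := by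
    rw [← h]
    exact Measure.rnDeriv_withDensity _ (by fun_prop)
  have h2 : ∫⁻ x, ENNReal.ofReal (InformationTheory.klFun
      (((μ.withDensity fun x => ENNReal.ofReal (ρ x)).rnDeriv π x).toReal)) ∂π
      = ∫⁻ x, ENNReal.ofReal (InformationTheory.klFun (ρ x / q x)) ∂π := by
    refine lintegral_congr_ae ?_
    filter_upwards [hd] with x hx
    rw [hx, ENNReal.toReal_ofReal (div_nonneg (hρ x) (hq x).le)]
  have hm : Measurable fun x => ENNReal.ofReal (InformationTheory.klFun (ρ x / q x)) :=
    (InformationTheory.measurable_klFun.comp (hρm.div hqm)).ennreal_ofReal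
  rw [h2, hπ, lintegral_withDensity_eq_lintegral_mul _ (by fun_prop) hm]
  refine lintegral_congr fun x => ?_
  rw [Pi.mul_apply, ← ENNReal.ofReal_mul (hq x).le]

end

/-! ### Time evolution of the truncated entropy -/

noncomputable section

/-- The truncated relative entropy of a noisy Euler step with respect to a density `q`. -/
def truncEntropy {n : ℕ} (b : EuclideanSpace ℝ (Fin n) → EuclideanSpace ℝ (Fin n))
    (ν : Measure (EuclideanSpace ℝ (Fin n))) (q : EuclideanSpace ℝ (Fin n) → ℝ) (m s : ℝ) : ℝ :=
  ∫ x, q x * truncKlFun m (stepDensity b ν s x / q x)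

/-- The truncated relative Fisher information of a noisy Euler step. -/
def truncFisher {n : ℕ} (b : EuclideanSpace ℝ (Fin n) → EuclideanSpace ℝ (Fin n))
    (ν : Measure (EuclideanSpace ℝ (Fin n))) (q : EuclideanSpace ℝ (Fin n) → ℝ)
    (F : EuclideanSpace ℝ (Fin n) → EuclideanSpace ℝ (Fin n)) (m s : ℝ) : ℝ :=
  ∫ x, 1 / (1 + (Real.log (stepDensity b ν s x / q x) / m) ^ 2)
    * (stepDensity b ν s x * ‖relScore b ν F s x‖ ^ 2)

section Entropy

variable {n : ℕ} {b F : EuclideanSpace ℝ (Fin n) → EuclideanSpace ℝ (Fin n)}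
  (ν : Measure (EuclideanSpace ℝ (Fin n))) [IsProbabilityMeasure ν] {M : ℝ}
  {q : EuclideanSpace ℝ (Fin n) → ℝ}

lemma integrable_truncEntropy (hb : Measurable b) (hqm : Measurable q) (hqi : Integrable q)
    (hq : ∀ x, 0 < q x) {m s : ℝ} (hm : 0 < m) (hs : 0 < s) :
    Integrable fun x => q x * truncKlFun m (stepDensity b ν s x / q x) := by
  have hρm := measurable_stepDensity_right hb ν s
  have hmeas : Measurable fun x => q x * truncKlFun m (stepDensity b ν s x / q x) :=
    hqm.mul ((measurable_truncKlFun hm).comp (hρm.div hqm))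
  refine (((integrable_stepDensity ν hb hs).sub hqi).norm.const_mul (m * (Real.pi / 2))).mono'
    hmeas.aestronglyMeasurable (.of_forall fun x => ?_)
  rw [norm_mul, Real.norm_of_nonneg (hq x).le, Pi.sub_apply, Real.norm_eq_abs, Real.norm_eq_abs]
  calc q x * |truncKlFun m (stepDensity b ν s x / q x)|
      ≤ q x * (m * (Real.pi / 2) * |stepDensity b ν s x / q x - 1|) :=
        mul_le_mul_of_nonneg_left (abs_truncKlFun_le hm _) (hq x).le
    _ = m * (Real.pi / 2) * |q x * (stepDensity b ν s x / q x - 1)| := by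
        rw [abs_mul, abs_of_pos (hq x)]; ring
    _ = _ := by
        rw [mul_sub, mul_div_cancel₀ _ (hq x).ne', mul_one]

/-- The weight `q` cancels the `1 / q` of the chain rule, leaving a bounded factor times the time
derivative of the density. -/
lemma hasDerivAt_truncKlFun_stepDensity (hb : Measurable b) (hbM : ∀ x, ‖b x‖ ≤ M)
    (hq : ∀ x, 0 < q x) {m s : ℝ} (hm : 0 < m) (hs : 0 < s) (x : EuclideanSpace ℝ (Fin n)) :
    HasDerivAt (fun s => q x * truncKlFun m (stepDensity b ν s x / q x))
      (truncId m (Real.log (stepDensity b ν s x / q x)) * stepDensityDt b ν s x) s := by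
  have h1 := (hasDerivAt_stepDensity ν hb hbM hs x).div_const (q x)
  have h2 := hasDerivAt_truncKlFun hm (div_pos (stepDensity_pos ν hb hs x) (hq x))
  refine ((h2.comp s h1).const_mul (q x)).congr_deriv ?_
  have := (hq x).ne'
  field_simp

lemma measurable_log_ratio (hb : Measurable b) (hqm : Measurable q) :
    Measurable fun z : ℝ × EuclideanSpace ℝ (Fin n) =>
      Real.log (stepDensity b ν z.1 z.2 / q z.2) :=
  Real.measurable_log.comp ((measurable_stepDensity hb ν).div (hqm.comp measurable_snd))

lemma measurable_truncId_mul_stepDensityDt (hb : Measurable b) (hqm : Measurable q) (m : ℝ) :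
    Measurable (Function.uncurry fun s x =>
      truncId m (Real.log (stepDensity b ν s x / q x)) * stepDensityDt b ν s x) :=
  ((continuous_truncId m).measurable.comp (measurable_log_ratio ν hb hqm)).mul
    (measurable_stepDensityDt hb ν)

lemma integrable_prod_truncId_mul_stepDensityDt (hb : Measurable b) (hbM : ∀ x, ‖b x‖ ≤ M)
    (hqm : Measurable q) {m a c : ℝ} (hm : 0 < m) (ha : 0 < a) :
    Integrable (fun z : ℝ × EuclideanSpace ℝ (Fin n) =>
      truncId m (Real.log (stepDensity b ν z.1 z.2 / q z.2)) * stepDensityDt b ν z.1 z.2)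
      ((volume.restrict (Set.Ioc a c)).prod volume) := by
  have hM0 : 0 ≤ M := (norm_nonneg _).trans (hbM 0)
  have h1 : Integrable (fun z : ℝ × EuclideanSpace ℝ (Fin n) => stepDensityDt b ν z.1 z.2)
      ((volume.restrict (Set.Ioc a c)).prod volume) := by
    rw [integrable_prod_iff (measurable_stepDensityDt hb ν).aestronglyMeasurable]
    constructor
    · filter_upwards [ae_restrict_mem measurableSet_Ioc] with s hs
      exact (integrable_prod_stepKernelDt ν hb hbM (ha.trans hs.1)).integral_prod_right
    · refine Measure.integrableOn_of_bounded (M := (1 / (4 * a ^ 2) + n / (2 * a)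
        + M / (2 * a)) * (1 + 2 * n * c)) (by simp)
        (measurable_stepDensityDt hb ν).norm.stronglyMeasurable.integral_prod_right'.aestronglyMeasurable
        ?_
      filter_upwards [ae_restrict_mem measurableSet_Ioc] with s hs
      rw [Real.norm_of_nonneg (integral_nonneg fun x => norm_nonneg _)]
      refine (integral_abs_stepDensityDt_le ν hb ha hbM hs.1.le).trans ?_
      gcongr
      exact hs.2
  refine h1.bdd_mul (c := m * (Real.pi / 2)) ?_ (.of_forall fun z => abs_truncId_le hm _)
  exact ((continuous_truncId m).measurable.comp
    (measurable_log_ratio ν hb hqm)).aestronglyMeasurable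

/-- The fundamental theorem of calculus in time at each point, followed by Fubini; the truncation
makes the integrand absolutely integrable over time and space. -/
lemma truncEntropy_sub (hb : Measurable b) (hbM : ∀ x, ‖b x‖ ≤ M) (hqm : Measurable q)
    (hqi : Integrable q) (hq : ∀ x, 0 < q x) {m a c : ℝ} (hm : 0 < m) (ha : 0 < a)
    (hac : a ≤ c) :
    truncEntropy b ν q m c - truncEntropy b ν q m a = ∫ s in Set.Ioc a c,
      ∫ x, truncId m (Real.log (stepDensity b ν s x / q x)) * stepDensityDt b ν s x := by
  have hint := integrable_prod_truncId_mul_stepDensityDt (c := c) ν hb hbM hqm hm ha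
  rw [integral_integral_swap hint, truncEntropy, truncEntropy,
    ← integral_sub (integrable_truncEntropy ν hb hqm hqi hq hm (ha.trans_le hac))
    (integrable_truncEntropy ν hb hqm hqi hq hm ha)]
  refine integral_congr_ae (.of_forall fun x => ?_)
  simp only
  rw [← intervalIntegral.integral_of_le hac]
  refine (intervalIntegral.integral_eq_sub_of_hasDerivAt
    (f := fun s => q x * truncKlFun m (stepDensity b ν s x / q x))
    (f' := fun s => truncId m (Real.log (stepDensity b ν s x / q x)) * stepDensityDt b ν s x)
    (fun s hs => ?_) ?_).symm
  · rw [Set.uIcc_of_le hac] at hs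
    exact hasDerivAt_truncKlFun_stepDensity ν hb hbM hq hm (ha.trans_le hs.1) x
  · rw [intervalIntegrable_iff_integrableOn_Ioc_of_le hac]
    have hmeas : Measurable fun s =>
        truncId m (Real.log (stepDensity b ν s x / q x)) * stepDensityDt b ν s x :=
      (measurable_truncId_mul_stepDensityDt ν hb hqm m).of_uncurry_right
    refine Measure.integrableOn_of_bounded (M := m * (Real.pi / 2) *
      ((1 / (4 * a ^ 2) + n / (2 * a) + M / (2 * a)) * (1 + 4 * c)
      * (4 * Real.pi * a) ^ (-((n : ℝ) / 2)))) (by simp) hmeas.aestronglyMeasurable ?_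
    filter_upwards [ae_restrict_mem measurableSet_Ioc] with s hs
    rw [norm_mul]
    exact mul_le_mul (abs_truncId_le hm _) (abs_stepDensityDt_le ν ha hs.1.le hs.2 hbM x)
      (norm_nonneg _) (by positivity)

lemma measurable_fisherIntegrand (hb : Measurable b) (hF : Measurable F) :
    Measurable fun z : ℝ × EuclideanSpace ℝ (Fin n) =>
      stepDensity b ν z.1 z.2 * ‖relScore b ν F z.1 z.2‖ ^ 2 :=
  (measurable_stepDensity hb ν).mul ((measurable_relScore ν hb hF).norm.pow_const 2)

lemma measurable_stepFisher (hb : Measurable b) (hF : Measurable F) :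
    Measurable (stepFisher b ν F) :=
  (measurable_fisherIntegrand ν hb hF).stronglyMeasurable.integral_prod_right'.measurable

lemma measurable_truncFisherIntegrand (hb : Measurable b) (hF : Measurable F)
    (hqm : Measurable q) (m : ℝ) :
    Measurable fun z : ℝ × EuclideanSpace ℝ (Fin n) =>
      1 / (1 + (Real.log (stepDensity b ν z.1 z.2 / q z.2) / m) ^ 2)
        * (stepDensity b ν z.1 z.2 * ‖relScore b ν F z.1 z.2‖ ^ 2) :=
  (measurable_const.div ((((measurable_log_ratio ν hb hqm).div_const m).pow_const 2).const_add
    1)).mul (measurable_fisherIntegrand ν hb hF)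

lemma measurable_truncFisher (hb : Measurable b) (hF : Measurable F) (hqm : Measurable q)
    (m : ℝ) : Measurable (truncFisher b ν q F m) :=
  (measurable_truncFisherIntegrand ν hb hF hqm
    m).stronglyMeasurable.integral_prod_right'.measurable

lemma measurable_driftError (hb : Measurable b) (hF : Measurable F) :
    Measurable (driftError b ν F) := by
  have h1 : Measurable fun w : ℝ × EuclideanSpace ℝ (Fin n) × EuclideanSpace ℝ (Fin n) =>
      stepKernel b w.1 w.2.2 w.2.1 := (measurable_stepKernel hb).comp
    (by fun_prop : Measurable fun w : ℝ × EuclideanSpace ℝ (Fin n) × EuclideanSpace ℝ (Fin n) =>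
      (w.1, w.2.2, w.2.1))
  have h2 : Measurable fun w : ℝ × EuclideanSpace ℝ (Fin n) × EuclideanSpace ℝ (Fin n) =>
      ‖b w.2.1 - F w.2.2‖ ^ 2 := ((hb.comp (measurable_fst.comp measurable_snd)).sub
    (hF.comp (measurable_snd.comp measurable_snd))).norm.pow_const 2
  exact (h1.mul h2).stronglyMeasurable.integral_prod_right'.measurable

lemma inv_one_add_sq_le_one (r : ℝ) : 1 / (1 + r ^ 2) ≤ 1 := by
  rw [div_le_one (by positivity)]
  nlinarith [sq_nonneg r]

lemma norm_truncFisherIntegrand_le (hb : Measurable b) (m : ℝ) {s : ℝ} (hs : 0 < s)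
    (x : EuclideanSpace ℝ (Fin n)) :
    ‖1 / (1 + (Real.log (stepDensity b ν s x / q x) / m) ^ 2)
        * (stepDensity b ν s x * ‖relScore b ν F s x‖ ^ 2)‖
      ≤ stepDensity b ν s x * ‖relScore b ν F s x‖ ^ 2 := by
  have h : 0 ≤ stepDensity b ν s x * ‖relScore b ν F s x‖ ^ 2 :=
    mul_nonneg (stepDensity_pos ν hb hs x).le (sq_nonneg _)
  rw [Real.norm_of_nonneg (by positivity)]
  exact mul_le_of_le_one_left h (inv_one_add_sq_le_one _)

lemma norm_truncFisher_le (hb : Measurable b) (hF : Measurable F) (hFM : ∀ x, ‖F x‖ ≤ M) (m : ℝ)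
    {s : ℝ} (hs : 0 < s) : ‖truncFisher b ν q F m s‖ ≤ stepFisher b ν F s :=
  norm_integral_le_of_norm_le (integrable_stepFisher ν hb hF hFM hs)
    (.of_forall fun x => norm_truncFisherIntegrand_le ν hb m hs x)

lemma integrableOn_stepFisher (hb : Measurable b) (hF : Measurable F) (hFM : ∀ x, ‖F x‖ ≤ M)
    {a c : ℝ} (ha : 0 < a) : IntegrableOn (stepFisher b ν F) (Set.Ioc a c) := by
  refine Measure.integrableOn_of_bounded (M := n / a + 2 * M ^ 2) (by simp)
    (measurable_stepFisher ν hb hF).aestronglyMeasurable ?_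
  filter_upwards [ae_restrict_mem measurableSet_Ioc] with s hs
  have hs0 : 0 < s := ha.trans hs.1
  rw [Real.norm_of_nonneg (stepFisher_nonneg ν hb hs0)]
  refine (stepFisher_le ν hb hF hFM hs0).trans ?_
  have := hs.1.le
  gcongr

lemma integrableOn_truncFisher (hb : Measurable b) (hF : Measurable F) (hFM : ∀ x, ‖F x‖ ≤ M)
    (hqm : Measurable q) (m : ℝ) {a c : ℝ} (ha : 0 < a) :
    IntegrableOn (truncFisher b ν q F m) (Set.Ioc a c) := by
  refine (integrableOn_stepFisher (c := c) ν hb hF hFM ha).mono'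
    (measurable_truncFisher ν hb hF hqm m).aestronglyMeasurable ?_
  filter_upwards [ae_restrict_mem measurableSet_Ioc] with s hs
  exact norm_truncFisher_le ν hb hF hFM m (ha.trans hs.1)

lemma integrableOn_driftError (hb : Measurable b) (hF : Measurable F) (hbM : ∀ x, ‖b x‖ ≤ M)
    (hFM : ∀ x, ‖F x‖ ≤ M) {a c : ℝ} (ha : 0 < a) :
    IntegrableOn (driftError b ν F) (Set.Ioc a c) := by
  refine Measure.integrableOn_of_bounded (M := (2 * M) ^ 2 * 1) (by simp)
    (measurable_driftError ν hb hF).aestronglyMeasurable ?_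
  filter_upwards [ae_restrict_mem measurableSet_Ioc] with s hs
  have hs0 : 0 < s := ha.trans hs.1
  have hk : ∀ z : EuclideanSpace ℝ (Fin n) × EuclideanSpace ℝ (Fin n),
      0 ≤ stepKernel b s z.2 z.1 * ‖b z.1 - F z.2‖ ^ 2 := fun z =>
    mul_nonneg (stepKernel_pos hs0 _ _).le (sq_nonneg _)
  rw [driftError, Real.norm_of_nonneg (integral_nonneg hk), ← integral_prod_stepKernel ν hb hs0,
    ← integral_const_mul]
  refine integral_mono (integrable_driftError ν hb hF hbM hFM hs0)
    ((integrable_prod_stepKernel ν hb hs0).const_mul _) fun z => ?_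
  simp only
  rw [mul_comm ((2 * M) ^ 2)]
  refine mul_le_mul_of_nonneg_left (pow_le_pow_left₀ (norm_nonneg _) ?_ 2)
    (stepKernel_pos hs0 _ _).le
  refine (norm_sub_le _ _).trans ?_
  linarith [hbM z.1, hFM z.2]

/-- The pointwise-in-time dissipation for the test function `truncId m (log (ρ/q))`, integrated over
`(a, c]`. The derivative of `truncId` becomes the weight in `truncFisher`. -/
lemma truncEntropy_add_le (hb : Measurable b) (hF : Measurable F) (hbM : ∀ x, ‖b x‖ ≤ M)
    (hFM : ∀ x, ‖F x‖ ≤ M) (hqm : Measurable q) (hqi : Integrable q) (hq : ∀ x, 0 < q x)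
    (hqF : ∀ x, HasGradientAt (fun x => Real.log (q x)) (F x) x)
    {m a c : ℝ} (hm : 0 < m) (ha : 0 < a) (hac : a ≤ c) :
    truncEntropy b ν q m c + 3 / 4 * ∫ s in Set.Ioc a c, truncFisher b ν q F m s
      ≤ truncEntropy b ν q m a + ∫ s in Set.Ioc a c, driftError b ν F s := by
  have h1 := truncEntropy_sub ν hb hbM hqm hqi hq hm ha hac
  have i1 := integrableOn_truncFisher (c := c) ν hb hF hFM hqm m ha
  have i2 := integrableOn_driftError (c := c) ν hb hF hbM hFM ha
  have i3 := (integrable_prod_truncId_mul_stepDensityDt (c := c) ν hb hbM hqm hm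
    ha).integral_prod_left
  have h2 : ∫ s in Set.Ioc a c,
      ∫ x, truncId m (Real.log (stepDensity b ν s x / q x)) * stepDensityDt b ν s x
      ≤ ∫ s in Set.Ioc a c, (-(3 / 4) * truncFisher b ν q F m s + driftError b ν F s) := by
    refine setIntegral_mono_on i3 ((i1.const_mul _).add i2) measurableSet_Ioc fun s hs => ?_
    have hmψ : Measurable fun r : ℝ => 1 / (1 + (r / m) ^ 2) := by fun_prop
    exact integral_mul_stepDensityDt_le ν hb hF hbM hFM hq hqF (hasDerivAt_truncId hm)
      hmψ (fun r => by positivity) (fun r => inv_one_add_sq_le_one _)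
      (abs_truncId_le hm) (ha.trans hs.1)
  rw [integral_add (i1.const_mul _) i2, integral_const_mul, ← h1] at h2
  linarith

end Entropy

end

/-! ### Removal of the truncation -/

noncomputable section

/-- The law of a noisy Euler step of length `s` along the drift `b`, started from `ν`. -/
def stepLaw {n : ℕ} (b : EuclideanSpace ℝ (Fin n) → EuclideanSpace ℝ (Fin n))
    (ν : Measure (EuclideanSpace ℝ (Fin n))) (s : ℝ) : Measure (EuclideanSpace ℝ (Fin n)) :=
  volume.withDensity fun x => ENNReal.ofReal (stepDensity b ν s x)

section EntropyDissipation

variable {n : ℕ} {b F : EuclideanSpace ℝ (Fin n) → EuclideanSpace ℝ (Fin n)}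
  (ν : Measure (EuclideanSpace ℝ (Fin n))) [IsProbabilityMeasure ν] {M L e : ℝ}
  {q : EuclideanSpace ℝ (Fin n) → ℝ}

lemma isProbabilityMeasure_stepLaw (hb : Measurable b) {s : ℝ} (hs : 0 < s) :
    IsProbabilityMeasure (stepLaw b ν s) :=
  isProbabilityMeasure_withDensity_ofReal (fun x => (stepDensity_pos ν hb hs x).le)
    (integrable_stepDensity ν hb hs) (integral_stepDensity ν hb hs)

lemma klDiv_stepLaw (hb : Measurable b) (hqm : Measurable q) (hqi : Integrable q)
    (hq1 : ∫ x, q x = 1) (hq : ∀ x, 0 < q x) {s : ℝ} (hs : 0 < s) :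
    InformationTheory.klDiv (stepLaw b ν s) (volume.withDensity fun x => ENNReal.ofReal (q x))
      = ∫⁻ x, ENNReal.ofReal (q x * InformationTheory.klFun (stepDensity b ν s x / q x)) := by
  have h1 : IsProbabilityMeasure (volume.withDensity
      fun x => ENNReal.ofReal (stepDensity b ν s x)) := isProbabilityMeasure_stepLaw ν hb hs
  have h2 := isProbabilityMeasure_withDensity_ofReal (fun x => (hq x).le) hqi hq1
  exact klDiv_withDensity_ofReal (measurable_stepDensity_right hb ν s) hqm
    (fun x => (stepDensity_pos ν hb hs x).le) hq

lemma truncEntropy_nonneg (hb : Measurable b) (hq : ∀ x, 0 < q x) {m s : ℝ} (hm : 0 < m)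
    (hs : 0 < s) : 0 ≤ truncEntropy b ν q m s :=
  integral_nonneg fun x => mul_nonneg (hq x).le
    (truncKlFun_nonneg hm (div_pos (stepDensity_pos ν hb hs x) (hq x)))

lemma ofReal_truncEntropy (hb : Measurable b) (hqm : Measurable q) (hqi : Integrable q)
    (hq : ∀ x, 0 < q x) {m s : ℝ} (hm : 0 < m) (hs : 0 < s) :
    ENNReal.ofReal (truncEntropy b ν q m s)
      = ∫⁻ x, ENNReal.ofReal (q x * truncKlFun m (stepDensity b ν s x / q x)) :=
  ofReal_integral_eq_lintegral_ofReal (integrable_truncEntropy ν hb hqm hqi hq hm hs)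
    (.of_forall fun x => mul_nonneg (hq x).le
      (truncKlFun_nonneg hm (div_pos (stepDensity_pos ν hb hs x) (hq x))))

lemma ofReal_truncEntropy_le (hb : Measurable b) (hqm : Measurable q) (hqi : Integrable q)
    (hq1 : ∫ x, q x = 1) (hq : ∀ x, 0 < q x) {m s : ℝ} (hm : 0 < m) (hs : 0 < s) :
    ENNReal.ofReal (truncEntropy b ν q m s) ≤ InformationTheory.klDiv (stepLaw b ν s)
      (volume.withDensity fun x => ENNReal.ofReal (q x)) := by
  rw [klDiv_stepLaw ν hb hqm hqi hq1 hq hs, ofReal_truncEntropy ν hb hqm hqi hq hm hs]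
  refine lintegral_mono fun x => ENNReal.ofReal_le_ofReal ?_
  exact mul_le_mul_of_nonneg_left
    (truncKlFun_le hm (div_pos (stepDensity_pos ν hb hs x) (hq x))) (hq x).le

/-- The weights tend to 1 and never exceed 1, so the full Fisher integrand dominates. -/
lemma tendsto_truncFisher (hb : Measurable b) (hF : Measurable F) (hFM : ∀ x, ‖F x‖ ≤ M)
    (hqm : Measurable q) {s : ℝ} (hs : 0 < s) :
    Filter.Tendsto (fun m : ℕ => truncFisher b ν q F (m + 1) s) Filter.atTop
      (nhds (stepFisher b ν F s)) := by
  refine tendsto_integral_of_dominated_convergence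
    (fun x => stepDensity b ν s x * ‖relScore b ν F s x‖ ^ 2) (fun m => ?_)
    (integrable_stepFisher ν hb hF hFM hs)
    (fun m => .of_forall fun x => norm_truncFisherIntegrand_le ν hb _ hs x)
    (.of_forall fun x => ?_)
  · exact ((measurable_truncFisherIntegrand ν hb hF hqm (m + 1)).comp
      (measurable_const.prodMk measurable_id : Measurable fun x :
        EuclideanSpace ℝ (Fin n) => (s, x))).aestronglyMeasurable
  · have h1 : Filter.Tendsto (fun m : ℕ => Real.log (stepDensity b ν s x / q x) / ((m : ℝ) + 1))
        Filter.atTop (nhds 0) :=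
      tendsto_const_nhds.div_atTop (Filter.tendsto_atTop_add_const_right _ _
        tendsto_natCast_atTop_atTop)
    have h2 := ((tendsto_const_nhds (x := (1 : ℝ))).div ((h1.pow 2).const_add 1)
      (by norm_num)).mul_const (stepDensity b ν s x * ‖relScore b ν F s x‖ ^ 2)
    simpa using h2

lemma tendsto_setIntegral_truncFisher (hb : Measurable b) (hF : Measurable F)
    (hFM : ∀ x, ‖F x‖ ≤ M) (hqm : Measurable q) {a c : ℝ} (ha : 0 < a) :
    Filter.Tendsto (fun m : ℕ => ∫ s in Set.Ioc a c, truncFisher b ν q F (m + 1) s) Filter.atTop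
      (nhds (∫ s in Set.Ioc a c, stepFisher b ν F s)) := by
  refine tendsto_integral_of_dominated_convergence (stepFisher b ν F)
    (fun m => (measurable_truncFisher ν hb hF hqm _).aestronglyMeasurable)
    (integrableOn_stepFisher ν hb hF hFM ha) (fun m => ?_) ?_
  · filter_upwards [ae_restrict_mem measurableSet_Ioc] with s hs
    exact norm_truncFisher_le ν hb hF hFM _ (ha.trans hs.1)
  · filter_upwards [ae_restrict_mem measurableSet_Ioc] with s hs
    exact tendsto_truncFisher ν hb hF hFM hqm (ha.trans hs.1)

/-- Dissipation of the relative entropy along a noisy Euler step, away from its start. -/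
lemma klDiv_stepLaw_add_le (hb : Measurable b) (hF : Measurable F) (hbM : ∀ x, ‖b x‖ ≤ M)
    (hFM : ∀ x, ‖F x‖ ≤ M) (hFL : ∀ x y, ‖F x - F y‖ ≤ L * ‖x - y‖)
    (hbL : ∀ x y, ‖b x - b y‖ ≤ L * ‖x - y‖) (he : ∀ x, ‖b x - F x‖ ≤ e)
    (hqm : Measurable q) (hqi : Integrable q) (hq1 : ∫ x, q x = 1) (hq : ∀ x, 0 < q x)
    (hqF : ∀ x, HasGradientAt (fun x => Real.log (q x)) (F x) x)
    {a c : ℝ} (ha : 0 < a) (hac : a ≤ c) (hcL : c ^ 2 * L ^ 2 ≤ 1 / 32) :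
    InformationTheory.klDiv (stepLaw b ν c) (volume.withDensity fun x => ENNReal.ofReal (q x))
      + ENNReal.ofReal (5 / 12) * ∫⁻ s in Set.Ioc a c, ENNReal.ofReal (stepFisher b ν F s)
    ≤ InformationTheory.klDiv (stepLaw b ν a) (volume.withDensity fun x => ENNReal.ofReal (q x))
      + ENNReal.ofReal (22 / 3 * n * L ^ 2 * c ^ 2 + 8 / 3 * e ^ 2 * c) := by
  set π := volume.withDensity fun x => ENNReal.ofReal (q x) with hπ
  by_cases htop : InformationTheory.klDiv (stepLaw b ν a) π = ⊤
  · rw [htop, top_add]; exact le_top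
  set R := 22 / 3 * n * L ^ 2 * c ^ 2 + 8 / 3 * e ^ 2 * c with hR
  have hc : 0 < c := ha.trans_le hac
  have hR0 : 0 ≤ R := by positivity
  set Ka := (InformationTheory.klDiv (stepLaw b ν a) π).toReal with hKa
  have iI := integrableOn_stepFisher (c := c) ν hb hF hFM ha
  have iD := integrableOn_driftError (c := c) ν hb hF hbM hFM ha
  have hI0 : 0 ≤ ∫ s in Set.Ioc a c, stepFisher b ν F s :=
    setIntegral_nonneg measurableSet_Ioc fun s hs => stepFisher_nonneg ν hb (ha.trans hs.1)
  -- Integrating the term linear in `s` halves its coefficient, from `44/3` to `22/3`; the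
  -- contributions of the lower endpoint are nonnegative and are dropped.
  have hD : ∫ s in Set.Ioc a c, driftError b ν F s
      ≤ 1 / 3 * (∫ s in Set.Ioc a c, stepFisher b ν F s) + R := by
    have ilin : IntegrableOn (fun s : ℝ => 44 / 3 * n * L ^ 2 * s + 8 / 3 * e ^ 2)
        (Set.Ioc a c) := by
      have : Continuous fun s : ℝ => 44 / 3 * n * L ^ 2 * s + 8 / 3 * e ^ 2 := by fun_prop
      exact this.integrableOn_Ioc
    have h1 : ∫ s in Set.Ioc a c, driftError b ν F s ≤ ∫ s in Set.Ioc a c,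
        (1 / 3 * stepFisher b ν F s + (44 / 3 * n * L ^ 2 * s + 8 / 3 * e ^ 2)) := by
      refine setIntegral_mono_on iD ((iI.const_mul _).add ilin) measurableSet_Ioc fun s hs => ?_
      have hs0 : 0 < s := ha.trans hs.1
      have := driftError_le ν hb hF hbM hFM hFL hbL he hs0 (le_trans (by
        have := hs.2
        gcongr) hcL)
      linarith
    rw [integral_add (iI.const_mul _) ilin, integral_const_mul] at h1
    have h2 : ∫ s in Set.Ioc a c, (44 / 3 * n * L ^ 2 * s + 8 / 3 * e ^ 2) ≤ R := by
      rw [← intervalIntegral.integral_of_le hac, intervalIntegral.integral_add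
        (by exact (continuous_const.mul continuous_id).intervalIntegrable _ _)
        (by exact continuous_const.intervalIntegrable _ _),
        intervalIntegral.integral_const_mul, integral_id, intervalIntegral.integral_const, hR,
        smul_eq_mul]
      have h3 : 0 ≤ 44 / 3 * n * L ^ 2 * (a ^ 2 / 2) := by positivity
      have h4 : 0 ≤ a * (8 / 3 * e ^ 2) := by positivity
      linarith
    linarith
  -- The limit of the bounds below, with `3/4 - 1/3 = 5/12`.
  set Y := Ka + R - 5 / 12 * ∫ s in Set.Ioc a c, stepFisher b ν F s with hY
  have hm1 : ∀ m : ℕ, (0 : ℝ) < m + 1 := fun m => by positivity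
  have hbound : ∀ m : ℕ, truncEntropy b ν q (m + 1) c
      ≤ Ka + (1 / 3 * (∫ s in Set.Ioc a c, stepFisher b ν F s) + R)
        - 3 / 4 * ∫ s in Set.Ioc a c, truncFisher b ν q F (m + 1) s := by
    intro m
    have h1 := truncEntropy_add_le ν hb hF hbM hFM hqm hqi hq hqF (hm1 m) ha hac
    have h2 : truncEntropy b ν q (m + 1) a ≤ Ka :=
      (ENNReal.ofReal_le_iff_le_toReal htop).1
        (ofReal_truncEntropy_le ν hb hqm hqi hq1 hq (hm1 m) ha)
    linarith
  have hlim : Filter.Tendsto (fun m : ℕ =>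
      Ka + (1 / 3 * (∫ s in Set.Ioc a c, stepFisher b ν F s) + R)
        - 3 / 4 * ∫ s in Set.Ioc a c, truncFisher b ν q F (m + 1) s) Filter.atTop (nhds Y) := by
    have h1 := ((tendsto_setIntegral_truncFisher (c := c) ν hb hF hFM hqm ha).const_mul
      (3 / 4)).const_sub (Ka + (1 / 3 * (∫ s in Set.Ioc a c, stepFisher b ν F s) + R))
    convert h1 using 2
    rw [hY]; ring
  -- Nonnegativity is needed so that `ENNReal.ofReal Y` does not truncate; it is inherited from the
  -- truncated entropies.
  have hY0 : 0 ≤ Y := ge_of_tendsto' hlim fun m =>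
    (truncEntropy_nonneg ν hb hq (hm1 m) hc).trans (hbound m)
  -- Fatou's lemma in `m`. It also shows that the divergence at time `c` is finite.
  have hKL : InformationTheory.klDiv (stepLaw b ν c) π ≤ ENNReal.ofReal Y := by
    rw [klDiv_stepLaw ν hb hqm hqi hq1 hq hc]
    have hpt : ∀ x, Filter.Tendsto (fun m : ℕ => ENNReal.ofReal (q x * truncKlFun (m + 1)
        (stepDensity b ν c x / q x))) Filter.atTop (nhds (ENNReal.ofReal
          (q x * InformationTheory.klFun (stepDensity b ν c x / q x)))) := fun x =>
      (ENNReal.continuous_ofReal.tendsto _).comp (((tendsto_truncKlFun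
        (div_pos (stepDensity_pos ν hb hc x) (hq x))).comp
        (Filter.tendsto_atTop_add_const_right _ 1 tendsto_natCast_atTop_atTop)).const_mul _)
    have hmeas : ∀ m : ℕ, Measurable fun x => ENNReal.ofReal (q x * truncKlFun (m + 1)
        (stepDensity b ν c x / q x)) := fun m =>
      (hqm.mul ((measurable_truncKlFun (hm1 m)).comp
        ((measurable_stepDensity_right hb ν c).div hqm))).ennreal_ofReal
    calc _ = ∫⁻ x, Filter.liminf (fun m : ℕ => ENNReal.ofReal (q x * truncKlFun (m + 1)
            (stepDensity b ν c x / q x))) Filter.atTop :=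
          lintegral_congr fun x => (hpt x).liminf_eq.symm
      _ ≤ Filter.liminf (fun m : ℕ => ∫⁻ x, ENNReal.ofReal (q x * truncKlFun (m + 1)
            (stepDensity b ν c x / q x))) Filter.atTop := lintegral_liminf_le hmeas
      _ ≤ Filter.liminf (fun m : ℕ => ENNReal.ofReal
            (Ka + (1 / 3 * (∫ s in Set.Ioc a c, stepFisher b ν F s) + R)
              - 3 / 4 * ∫ s in Set.Ioc a c, truncFisher b ν q F (m + 1) s)) Filter.atTop := by
          refine Filter.liminf_le_liminf (.of_forall fun m => ?_)
          rw [← ofReal_truncEntropy ν hb hqm hqi hq (hm1 m) hc]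
          exact ENNReal.ofReal_le_ofReal (hbound m)
      _ = _ := ((ENNReal.continuous_ofReal.tendsto _).comp hlim).liminf_eq
  have hfis : ∫⁻ s in Set.Ioc a c, ENNReal.ofReal (stepFisher b ν F s)
      = ENNReal.ofReal (∫ s in Set.Ioc a c, stepFisher b ν F s) := by
    refine (ofReal_integral_eq_lintegral_ofReal iI ?_).symm
    filter_upwards [ae_restrict_mem measurableSet_Ioc] with s hs
    exact stepFisher_nonneg ν hb (ha.trans hs.1)
  calc _ ≤ ENNReal.ofReal Y
        + ENNReal.ofReal (5 / 12 * ∫ s in Set.Ioc a c, stepFisher b ν F s) := by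
        rw [hfis, ← ENNReal.ofReal_mul (by norm_num)]
        exact add_le_add_left hKL _
    _ = ENNReal.ofReal Ka + ENNReal.ofReal R := by
        rw [← ENNReal.ofReal_add hY0 (by positivity), ← ENNReal.ofReal_add
          ENNReal.toReal_nonneg hR0, hY]
        congr 1; ring
    _ = _ := by rw [hKa, ENNReal.ofReal_toReal htop]

end EntropyDissipation

end

/-! ### The start of a step: letting the initial time tend to 0 -/

noncomputable section

/-- The Markov kernel of a noisy Euler step of length `s` along the drift `b`. -/
def stepTransition {n : ℕ} (b : EuclideanSpace ℝ (Fin n) → EuclideanSpace ℝ (Fin n)) (s : ℝ) :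
    Kernel (EuclideanSpace ℝ (Fin n)) (EuclideanSpace ℝ (Fin n)) :=
  Kernel.withDensity (Kernel.const _ volume) fun y x => ENNReal.ofReal (stepKernel b s x y)

section Start

variable {n : ℕ} {b F : EuclideanSpace ℝ (Fin n) → EuclideanSpace ℝ (Fin n)}
  (ν : Measure (EuclideanSpace ℝ (Fin n))) [IsProbabilityMeasure ν] {M L e : ℝ}
  {q : EuclideanSpace ℝ (Fin n) → ℝ}

lemma stepTransition_apply (hb : Measurable b) (s : ℝ) (y : EuclideanSpace ℝ (Fin n)) :
    stepTransition b s y = volume.withDensity fun x => ENNReal.ofReal (stepKernel b s x y) := by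
  rw [stepTransition, Kernel.withDensity_apply _
    (measurable_stepKernel_prod hb s).ennreal_ofReal]
  rfl

lemma isMarkovKernel_stepTransition (hb : Measurable b) {s : ℝ} (hs : 0 < s) :
    IsMarkovKernel (stepTransition b s) := by
  refine ⟨fun y => ?_⟩
  rw [stepTransition_apply hb]
  exact isProbabilityMeasure_withDensity_ofReal (fun x => (stepKernel_pos hs x y).le)
    (integrable_stepKernel_left hs y) (integral_stepKernel hs y)

/-- Writing the step as a Markov kernel gives access to the data processing inequality for the
divergence. -/
lemma stepTransition_comp (hb : Measurable b) {s : ℝ} (hs : 0 < s) :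
    stepTransition b s ∘ₘ ν = stepLaw b ν s := by
  ext A hA
  rw [Measure.bind_apply hA (stepTransition b s).aemeasurable, stepLaw, withDensity_apply _ hA]
  simp_rw [stepTransition_apply hb, withDensity_apply _ hA]
  rw [lintegral_lintegral_swap (measurable_stepKernel_prod hb s).ennreal_ofReal.aemeasurable]
  refine lintegral_congr fun x => ?_
  exact (ofReal_integral_eq_lintegral_ofReal (integrable_stepKernel ν hb hs x)
    (.of_forall fun y => (stepKernel_pos hs x y).le)).symm

/-- A bounded score makes `log q` Lipschitz with constant `M`, by the mean value inequality. -/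
lemma le_mul_exp_of_gradient_log (hFM : ∀ x, ‖F x‖ ≤ M) (hq : ∀ x, 0 < q x)
    (hqF : ∀ x, HasGradientAt (fun x => Real.log (q x)) (F x) x)
    (x y : EuclideanSpace ℝ (Fin n)) : q y ≤ q x * Real.exp (M * ‖x - y‖) := by
  have h := convex_univ.norm_image_sub_le_of_norm_hasFDerivWithin_le (𝕜 := ℝ)
    (f := fun x => Real.log (q x)) (C := M)
    (fun z _ => (hqF z).hasFDerivAt.hasFDerivWithinAt)
    (fun z _ => by rw [LinearIsometryEquiv.norm_map]; exact hFM z)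
    (Set.mem_univ x) (Set.mem_univ y)
  rw [norm_sub_rev y x] at h
  have h2 : Real.log (q y) ≤ Real.log (q x) + M * ‖x - y‖ := by
    linarith [le_abs_self (Real.log (q y) - Real.log (q x)), Real.norm_eq_abs
      (Real.log (q y) - Real.log (q x))]
  rw [← Real.exp_log (hq y)]
  calc _ ≤ Real.exp (Real.log (q x) + M * ‖x - y‖) := Real.exp_le_exp.2 h2
    _ = _ := by rw [Real.exp_add, Real.exp_log (hq x)]

/-- Expanding the square, the displacement `s b(y)` costs at most `M/2 ‖x - y‖` in the exponent,
with no factor `1/s`. -/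
lemma stepKernel_le (hbM : ∀ x, ‖b x‖ ≤ M) {s : ℝ} (hs : 0 < s)
    (x y : EuclideanSpace ℝ (Fin n)) :
    stepKernel b s x y ≤ Real.exp (M / 2 * ‖x - y‖) * heatKernel s (x - y) := by
  unfold stepKernel heatKernel stepNoise
  rw [mul_left_comm, ← Real.exp_add]
  refine mul_le_mul_of_nonneg_left (Real.exp_le_exp.2 ?_) (by positivity)
  have h1 := norm_sub_sq_real (x - y) (s • b y)
  rw [sub_sub] at h1
  have h2 : inner ℝ (x - y) (s • b y) ≤ s * (‖x - y‖ * M) := by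
    rw [inner_smul_right]
    refine mul_le_mul_of_nonneg_left ((real_inner_le_norm _ _).trans ?_) hs.le
    exact mul_le_mul_of_nonneg_left (hbM y) (norm_nonneg _)
  have h3 : ‖x - y‖ ^ 2 - 2 * (s * (‖x - y‖ * M)) ≤ ‖x - (y + s • b y)‖ ^ 2 := by
    rw [h1]; nlinarith [sq_nonneg ‖s • b y‖]
  have h4 : (‖x - y‖ ^ 2 - 2 * (s * (‖x - y‖ * M))) / (4 * s)
      ≤ ‖x - (y + s • b y)‖ ^ 2 / (4 * s) := by gcongr
  have h5 : (‖x - y‖ ^ 2 - 2 * (s * (‖x - y‖ * M))) / (4 * s)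
      = ‖x - y‖ ^ 2 / (4 * s) - M / 2 * ‖x - y‖ := by field_simp; ring
  linarith

/-- Started from the target itself, a short step enlarges the density by a factor that is uniform in
`x`. The rate `3/2 M` combines `M` from comparing `q y` with `q x` and `M/2` from the drift. -/
lemma stepDensity_withDensity_le (hb : Measurable b) (hbM : ∀ x, ‖b x‖ ≤ M)
    (hFM : ∀ x, ‖F x‖ ≤ M) (hqm : Measurable q) (hqi : Integrable q) (hq1 : ∫ x, q x = 1)
    (hq : ∀ x, 0 < q x) (hqF : ∀ x, HasGradientAt (fun x => Real.log (q x)) (F x) x)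
    {s : ℝ} (hs : 0 < s) (x : EuclideanSpace ℝ (Fin n)) :
    stepDensity b (volume.withDensity fun x => ENNReal.ofReal (q x)) s x
      ≤ (∫ u : EuclideanSpace ℝ (Fin n), Real.exp (3 / 2 * M * ‖u‖) * heatKernel s u) * q x := by
  have hπ := isProbabilityMeasure_withDensity_ofReal (fun x => (hq x).le) hqi hq1
  have hi : Integrable fun y => q y * stepKernel b s x y := by
    have h := integrable_stepKernel (volume.withDensity fun x => ENNReal.ofReal (q x)) hb hs x
    rw [integrable_withDensity_iff_integrable_smul' hqm.ennreal_ofReal (by simp)] at h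
    refine h.congr (.of_forall fun y => ?_)
    simp only [ENNReal.toReal_ofReal (hq y).le, smul_eq_mul]
  have h1 : stepDensity b (volume.withDensity fun x => ENNReal.ofReal (q x)) s x
      = ∫ y, q y * stepKernel b s x y := by
    rw [stepDensity, integral_withDensity_eq_integral_toReal_smul hqm.ennreal_ofReal (by simp)]
    refine integral_congr_ae (.of_forall fun y => ?_)
    simp only [ENNReal.toReal_ofReal (hq y).le, smul_eq_mul]
  rw [h1, mul_comm, ← integral_sub_left_eq_self (fun u : EuclideanSpace ℝ (Fin n) =>
    Real.exp (3 / 2 * M * ‖u‖) * heatKernel s u) volume x, ← integral_const_mul]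
  refine integral_mono hi (((integrable_exp_mul_heatKernel hs (3 / 2 * M)).comp_sub_left
    x).const_mul _) fun y => ?_
  calc q y * stepKernel b s x y ≤ q x * Real.exp (M * ‖x - y‖)
        * (Real.exp (M / 2 * ‖x - y‖) * heatKernel s (x - y)) :=
        mul_le_mul (le_mul_exp_of_gradient_log hFM hq hqF x y) (stepKernel_le hbM hs x y)
          (stepKernel_pos hs x y).le (mul_nonneg (hq x).le (Real.exp_nonneg _))
    _ = _ := by
        rw [show 3 / 2 * M * ‖x - y‖ = M * ‖x - y‖ + M / 2 * ‖x - y‖ by ring, Real.exp_add]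
        ring

lemma one_le_integral_exp_mul_heatKernel {c s : ℝ} (hc : 0 ≤ c) (hs : 0 < s) :
    1 ≤ ∫ u : EuclideanSpace ℝ (Fin n), Real.exp (c * ‖u‖) * heatKernel s u := by
  rw [← integral_heatKernel (n := n) hs]
  refine integral_mono (integrable_heatKernel hs) (integrable_exp_mul_heatKernel hs c)
    fun u => le_mul_of_one_le_left (heatKernel_pos hs u).le (Real.one_le_exp (by positivity))

/-- A short noisy Euler step increases the relative entropy by little. -/
lemma klDiv_stepLaw_le (hb : Measurable b) (hbM : ∀ x, ‖b x‖ ≤ M)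
    (hFM : ∀ x, ‖F x‖ ≤ M) (hqm : Measurable q) (hqi : Integrable q) (hq1 : ∫ x, q x = 1)
    (hq : ∀ x, 0 < q x) (hqF : ∀ x, HasGradientAt (fun x => Real.log (q x)) (F x) x)
    {s : ℝ} (hs : 0 < s) :
    InformationTheory.klDiv (stepLaw b ν s) (volume.withDensity fun x => ENNReal.ofReal (q x))
      ≤ InformationTheory.klDiv ν (volume.withDensity fun x => ENNReal.ofReal (q x))
        + ENNReal.ofReal (Real.log (∫ u : EuclideanSpace ℝ (Fin n),
            Real.exp (3 / 2 * M * ‖u‖) * heatKernel s u)) := by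
  have hM0 : 0 ≤ M := (norm_nonneg _).trans (hbM 0)
  have hπ := isProbabilityMeasure_withDensity_ofReal (fun x => (hq x).le) hqi hq1
  have hκ := isMarkovKernel_stepTransition hb hs
  set π := volume.withDensity fun x => ENNReal.ofReal (q x) with hπdef
  set c := ∫ u : EuclideanSpace ℝ (Fin n), Real.exp (3 / 2 * M * ‖u‖) * heatKernel s u
  have hc1 : 1 ≤ c := one_le_integral_exp_mul_heatKernel (by positivity) hs
  have h1 := InformationTheory.klDiv_comp_right_le ν π (stepTransition b s)
  rw [stepTransition_comp ν hb hs, stepTransition_comp π hb hs] at h1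
  -- Data processing bounds the divergence between the two laws after the step. It remains to
  -- replace the moved target by the target, at the cost `log c`.
  refine le_trans ?_ (add_le_add_left h1 _)
  have hρ := stepDensity_pos ν hb hs
  have hρ' := stepDensity_pos π hb hs
  have hρm := measurable_stepDensity_right hb ν s
  have hρm' := measurable_stepDensity_right hb π s
  have hle := stepDensity_withDensity_le hb hbM hFM hqm hqi hq1 hq hqF hs
  have hk : InformationTheory.klDiv (stepLaw b ν s) (stepLaw b π s)
      = ∫⁻ x, ENNReal.ofReal (stepDensity b π s x
        * InformationTheory.klFun (stepDensity b ν s x / stepDensity b π s x)) :=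
    klDiv_stepLaw ν hb hρm' (integrable_stepDensity π hb hs) (integral_stepDensity π hb hs) hρ' hs
  rw [klDiv_stepLaw ν hb hqm hqi hq1 hq hs, hk]
  have hlog : 0 ≤ Real.log c := Real.log_nonneg hc1
  have hmass {f : EuclideanSpace ℝ (Fin n) → ℝ} (hf : Integrable f) (hf0 : ∀ x, 0 < f x)
      (hf1 : ∫ x, f x = 1) : ∫⁻ x, ENNReal.ofReal (f x) = 1 := by
    rw [← ofReal_integral_eq_lintegral_ofReal hf (.of_forall fun x => (hf0 x).le), hf1,
      ENNReal.ofReal_one]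
  have m1 := hmass (integrable_stepDensity π hb hs) hρ' (integral_stepDensity π hb hs)
  have m2 := hmass (integrable_stepDensity ν hb hs) hρ (integral_stepDensity ν hb hs)
  have m3 := hmass hqi hq hq1
  -- `r klFun (ρ/r)` equals `ρ log (ρ/r) + r - ρ`. Each side carries the other's reference density
  -- so that no subtraction is needed in `ℝ≥0∞`; both densities have mass 1 and cancel after
  -- integration.
  have hpt : ∀ x, ENNReal.ofReal (q x * InformationTheory.klFun (stepDensity b ν s x / q x))
      + ENNReal.ofReal (stepDensity b π s x)
      ≤ ENNReal.ofReal (stepDensity b π s x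
        * InformationTheory.klFun (stepDensity b ν s x / stepDensity b π s x))
        + (ENNReal.ofReal (Real.log c) * ENNReal.ofReal (stepDensity b ν s x)
          + ENNReal.ofReal (q x)) := by
    intro x
    have k1 := InformationTheory.klFun_nonneg (div_nonneg (hρ x).le (hq x).le)
    have k2 := InformationTheory.klFun_nonneg (div_nonneg (hρ x).le (hρ' x).le)
    rw [← ENNReal.ofReal_mul hlog, ← ENNReal.ofReal_add (mul_nonneg (hq x).le k1) (hρ' x).le,
      ← ENNReal.ofReal_add (mul_nonneg hlog (hρ x).le) (hq x).le,
      ← ENNReal.ofReal_add (mul_nonneg (hρ' x).le k2)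
        (add_nonneg (mul_nonneg hlog (hρ x).le) (hq x).le)]
    refine ENNReal.ofReal_le_ofReal ?_
    have e1 : ∀ {r : ℝ}, 0 < r → r * InformationTheory.klFun (stepDensity b ν s x / r)
        = stepDensity b ν s x * (Real.log (stepDensity b ν s x) - Real.log r)
          + r - stepDensity b ν s x := by
      intro r hr
      rw [InformationTheory.klFun_apply, Real.log_div (hρ x).ne' hr.ne']
      field_simp
    rw [e1 (hq x), e1 (hρ' x)]
    have e2 : Real.log (stepDensity b π s x) ≤ Real.log c + Real.log (q x) := by
      rw [← Real.log_mul (by positivity) (hq x).ne']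
      exact Real.log_le_log (hρ' x) (hle x)
    nlinarith [mul_le_mul_of_nonneg_left e2 (hρ x).le]
  have hsum := lintegral_mono (μ := volume) hpt
  have hkm : Measurable fun x => ENNReal.ofReal (stepDensity b π s x
        * InformationTheory.klFun (stepDensity b ν s x / stepDensity b π s x)) :=
    (hρm'.mul (InformationTheory.measurable_klFun.comp (hρm.div hρm'))).ennreal_ofReal
  rw [lintegral_add_right _ hρm'.ennreal_ofReal, lintegral_add_left hkm,
    lintegral_add_right _ hqm.ennreal_ofReal, lintegral_const_mul _ hρm.ennreal_ofReal,
    m1, m2, m3, mul_one, ← add_assoc] at hsum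
  exact (ENNReal.add_le_add_iff_right ENNReal.one_ne_top).1 hsum

/-- Dissipation of the relative entropy along a noisy Euler step. -/
theorem klDiv_stepLaw_add_lintegral_le (hb : Measurable b) (hF : Measurable F)
    (hbM : ∀ x, ‖b x‖ ≤ M)
    (hFM : ∀ x, ‖F x‖ ≤ M) (hFL : ∀ x y, ‖F x - F y‖ ≤ L * ‖x - y‖)
    (hbL : ∀ x y, ‖b x - b y‖ ≤ L * ‖x - y‖) (he : ∀ x, ‖b x - F x‖ ≤ e)
    (hqm : Measurable q) (hqi : Integrable q) (hq1 : ∫ x, q x = 1) (hq : ∀ x, 0 < q x)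
    (hqF : ∀ x, HasGradientAt (fun x => Real.log (q x)) (F x) x)
    {c : ℝ} (hc : 0 < c) (hcL : c ^ 2 * L ^ 2 ≤ 1 / 32) :
    InformationTheory.klDiv (stepLaw b ν c) (volume.withDensity fun x => ENNReal.ofReal (q x))
      + ENNReal.ofReal (5 / 12) * ∫⁻ s in Set.Ioc 0 c, ENNReal.ofReal (stepFisher b ν F s)
    ≤ InformationTheory.klDiv ν (volume.withDensity fun x => ENNReal.ofReal (q x))
      + ENNReal.ofReal (22 / 3 * n * L ^ 2 * c ^ 2 + 8 / 3 * e ^ 2 * c) := by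
  set π := volume.withDensity fun x => ENNReal.ofReal (q x) with hπdef
  set R := 22 / 3 * n * L ^ 2 * c ^ 2 + 8 / 3 * e ^ 2 * c
  -- For fixed `a` the inequality is applied from an earlier time `s < a`, and `s → 0` removes the
  -- start-up cost while the range of integration stays `(a, c]`.
  have hfix : ∀ a, 0 < a → a ≤ c → InformationTheory.klDiv (stepLaw b ν c) π
      + ENNReal.ofReal (5 / 12) * ∫⁻ s in Set.Ioc a c, ENNReal.ofReal (stepFisher b ν F s)
      ≤ InformationTheory.klDiv ν π + ENNReal.ofReal R := by
    intro a ha hac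
    have hlim : Filter.Tendsto (fun s : ℝ => InformationTheory.klDiv ν π
        + ENNReal.ofReal (Real.log (∫ u : EuclideanSpace ℝ (Fin n),
            Real.exp (3 / 2 * M * ‖u‖) * heatKernel s u)) + ENNReal.ofReal R)
        (nhdsWithin 0 (Set.Ioi 0)) (nhds (InformationTheory.klDiv ν π + ENNReal.ofReal R)) := by
      have h1 := (ENNReal.continuous_ofReal.tendsto _).comp
        ((tendsto_integral_exp_mul_heatKernel (n := n) (3 / 2 * M)).log one_ne_zero)
      rw [Real.log_one, ENNReal.ofReal_zero] at h1
      have h2 := (h1.const_add (InformationTheory.klDiv ν π)).add_const (ENNReal.ofReal R)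
      rwa [add_zero] at h2
    refine ge_of_tendsto hlim ?_
    filter_upwards [Ioo_mem_nhdsGT ha] with s hs
    have h1 := klDiv_stepLaw_add_le ν hb hF hbM hFM hFL hbL he hqm hqi hq1 hq hqF hs.1
      (hs.2.le.trans hac) hcL
    refine le_trans ?_ (h1.trans (add_le_add_left
      (klDiv_stepLaw_le ν hb hbM hFM hqm hqi hq1 hq hqF hs.1) _))
    gcongr
    exact hs.2.le
  -- Exhausting `(0, c]` from the right, monotone convergence lets `a → 0`.
  have hU : Set.Ioc 0 c = ⋃ j : ℕ, Set.Ioc (c / (j + 1)) c := by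
    ext t
    simp only [Set.mem_Ioc, Set.mem_iUnion, exists_and_right]
    constructor
    · rintro ⟨h1, h2⟩
      obtain ⟨j, hj⟩ := exists_nat_gt (c / t)
      refine ⟨⟨j, ?_⟩, h2⟩
      rw [div_lt_iff₀ h1] at hj
      rw [div_lt_iff₀ (by positivity)]
      nlinarith
    · rintro ⟨⟨j, hj⟩, h2⟩
      exact ⟨lt_of_le_of_lt (by positivity) hj, h2⟩
  have hdir : Monotone fun j : ℕ => Set.Ioc (c / ((j : ℝ) + 1)) c := by
    intro i j hij
    refine Set.Ioc_subset_Ioc_left ?_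
    have : (i : ℝ) ≤ j := by exact_mod_cast hij
    gcongr
  rw [hU, setLIntegral_iUnion_of_directed _ hdir.directed_le, ENNReal.mul_iSup,
    ENNReal.add_iSup]
  refine iSup_le fun j => hfix _ (by positivity) ?_
  exact div_le_self hc.le (by linarith [(Nat.cast_nonneg j : (0 : ℝ) ≤ j)])

end Start

end

/-! ### Identification with `fisherInfo` -/

noncomputable section

section Fisher

variable {n : ℕ} {b F : EuclideanSpace ℝ (Fin n) → EuclideanSpace ℝ (Fin n)}
  (ν : Measure (EuclideanSpace ℝ (Fin n))) [IsProbabilityMeasure ν] {M : ℝ}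
  {q : EuclideanSpace ℝ (Fin n) → ℝ}

lemma differentiable_of_hasGradientAt_log (hq : ∀ x, 0 < q x)
    (hqF : ∀ x, HasGradientAt (fun x => Real.log (q x)) (F x) x) : Differentiable ℝ q := by
  have h : q = fun x => Real.exp (Real.log (q x)) := by
    ext x; rw [Real.exp_log (hq x)]
  rw [h]
  exact fun x => (hqF x).hasFDerivAt.differentiableAt.exp

/-- As `fisherInfo` is an infimum over versions of the density ratio, exhibiting `ρ / q` gives the
upper bound; uniqueness of the version is not needed. -/
lemma fisherInfo_stepLaw_le (hb : Measurable b) (hF : Measurable F) (hFM : ∀ x, ‖F x‖ ≤ M)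
    (hqm : Measurable q) (hq : ∀ x, 0 < q x)
    (hqF : ∀ x, HasGradientAt (fun x => Real.log (q x)) (F x) x) {s : ℝ} (hs : 0 < s) :
    fisherInfo (stepLaw b ν s) (volume.withDensity fun x => ENNReal.ofReal (q x))
      ≤ ENNReal.ofReal (stepFisher b ν F s) := by
  have hρ := stepDensity_pos ν hb hs
  have hρm := measurable_stepDensity_right hb ν s
  have hd : Differentiable ℝ fun x => stepDensity b ν s x / q x := by
    have h1 : Differentiable ℝ (stepDensity b ν s) := fun x =>
      (hasGradientAt_stepDensity ν hb hs x).hasFDerivAt.differentiableAt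
    have h2 := differentiable_of_hasGradientAt_log hq hqF
    simp_rw [div_eq_mul_inv]
    exact h1.mul (h2.inv fun x => (hq x).ne')
  refine (iInf₂_le_of_le _ hd (iInf₂_le_of_le (fun x => div_pos (hρ x) (hq x))
    (withDensity_ofReal_div hρm hqm hq).symm le_rfl)).trans ?_
  have hg : ∀ x, gradient (fun y => Real.log (stepDensity b ν s y / q y)) x
      = relScore b ν F s x := fun x => (hasGradientAt_log_ratio ν hb hq hqF hs x).gradient
  simp_rw [hg]
  have hr : Measurable (relScore b ν F s) := (measurable_relScore ν hb hF).of_uncurry_left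
  rw [stepLaw, lintegral_withDensity_eq_lintegral_mul _ hρm.ennreal_ofReal
    (by fun_prop), stepFisher, ofReal_integral_eq_lintegral_ofReal
    (integrable_stepFisher ν hb hF hFM hs)
    (.of_forall fun x => mul_nonneg (hρ x).le (sq_nonneg _))]
  refine lintegral_mono fun x => le_of_eq ?_
  rw [Pi.mul_apply, ENNReal.ofReal_mul (hρ x).le, ENNReal.ofReal_pow (norm_nonneg _),
    ofReal_norm]

end Fisher

/-! ### Brownian increments as heat kernel noise -/

section GaussianNoise

variable {n : ℕ}

lemma isProbabilityMeasure_heatKernel {s : ℝ} (hs : 0 < s) :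
    IsProbabilityMeasure (volume.withDensity fun u : EuclideanSpace ℝ (Fin n) =>
      ENNReal.ofReal (heatKernel s u)) :=
  isProbabilityMeasure_withDensity_ofReal (fun u => (heatKernel_pos hs u).le)
    (integrable_heatKernel hs) (integral_heatKernel hs)

/-- Serves to recognize the law of a vector Brownian increment, whose characteristic function
factors over the coordinates. -/
lemma charFun_heatKernel {s : ℝ} (hs : 0 < s) (t : EuclideanSpace ℝ (Fin n)) :
    charFun (volume.withDensity fun u : EuclideanSpace ℝ (Fin n) =>
      ENNReal.ofReal (heatKernel s u)) t = Complex.exp (-(s * ‖t‖ ^ 2)) := by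
  have hm : Measurable (heatKernel s : EuclideanSpace ℝ (Fin n) → ℝ) :=
    (continuous_heatKernel s).measurable
  rw [charFun_apply, integral_withDensity_eq_integral_toReal_smul hm.ennreal_ofReal (by simp)]
  have hb : 0 < ((1 / (4 * s) : ℝ) : ℂ).re := by
    rw [Complex.ofReal_re]; positivity
  have h := GaussianFourier.integral_cexp_neg_mul_sq_norm_add hb Complex.I t
  have h1 : ∀ x : EuclideanSpace ℝ (Fin n),
      (ENNReal.ofReal (heatKernel s x)).toReal • Complex.exp (inner ℝ x t * Complex.I)
      = (((4 * Real.pi * s) ^ (-((n : ℝ) / 2)) : ℝ) : ℂ)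
        * Complex.exp (-((1 / (4 * s) : ℝ) : ℂ) * ‖x‖ ^ 2 + Complex.I * inner ℝ t x) := by
    intro x
    rw [ENNReal.toReal_ofReal (heatKernel_pos hs x).le, heatKernel_eq_exp, Complex.exp_add,
      Complex.real_smul, real_inner_comm]
    push_cast
    ring_nf
  simp_rw [h1]
  rw [integral_const_mul, h, finrank_euclideanSpace_fin]
  have h2 : ((Real.pi : ℂ) / ((1 / (4 * s) : ℝ) : ℂ)) ^ ((n : ℂ) / 2)
      = (((4 * Real.pi * s) ^ ((n : ℝ) / 2) : ℝ) : ℂ) := by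
    rw [Complex.ofReal_cpow (by positivity)]
    congr 1
    · push_cast; field_simp
    · push_cast; rfl
  rw [h2, ← mul_assoc, ← Complex.ofReal_mul, ← Real.rpow_add (by positivity)]
  simp only [neg_add_cancel, Real.rpow_zero, Complex.ofReal_one, one_mul, Complex.I_sq]
  congr 1
  have hs' : (s : ℂ) ≠ 0 := by exact_mod_cast hs.ne'
  push_cast
  field_simp

variable {Ω : Type*} [MeasurableSpace Ω] {P : Measure Ω} [IsProbabilityMeasure P]

/-- The scaled increments of a Brownian motion are distributed according to the heat kernel. -/
lemma IsStandardBrownianMotion.map_increment {B : ℝ≥0 → Ω → EuclideanSpace ℝ (Fin n)}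
    (hB : IsStandardBrownianMotion B P) {a t : ℝ≥0} (hat : a < t) :
    P.map (fun ω => √2 • (B t ω - B a ω))
      = volume.withDensity fun u => ENNReal.ofReal (heatKernel ((t : ℝ) - a) u) := by
  have hs : 0 < (t : ℝ) - a := sub_pos.2 hat
  have := isProbabilityMeasure_heatKernel (n := n) hs
  have hmc : ∀ u i, Measurable fun ω => B u ω i := fun u i => by
    have := hB.measurable u
    fun_prop
  have hm : ∀ i, Measurable fun ω => √2 * (B t ω i - B a ω i) := fun i =>
    ((hmc t i).sub (hmc a i)).const_mul _
  -- The factor `√2` doubles the variance, which matches the covariance `2 s I` of the heat kernel.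
  have hlaw : ∀ i, P.map (fun ω => √2 * (B t ω i - B a ω i))
      = gaussianReal 0 (2 * Real.toNNReal (t - a)) := by
    intro i
    have h := ((hB.coord i).toIsPreBrownianReal.hasLaw_sub t a).map_eq
    have h2 := congrArg (Measure.map (√2 * ·)) h
    rw [gaussianReal_map_const_mul, Measure.map_map (by fun_prop)
      ((hmc t i).sub (hmc a i))] at h2
    refine h2.trans ?_
    rw [mul_zero]
    congr 1
    rw [← NNReal.coe_inj]
    simp only [NNReal.coe_mul, NNReal.coe_mk, Real.coe_toNNReal _ hs.le, NNReal.coe_ofNat]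
    have h3 : ((nndist (t : ℝ) a : ℝ≥0) : ℝ) = t - a := by
      rw [coe_nndist, Real.dist_eq, abs_of_pos hs]
    rw [Real.sq_sqrt (by norm_num)]
    exact congrArg (2 * ·) h3
  have hind : iIndepFun (fun (i : Fin n) ω => √2 * (B t ω i - B a ω i)) P :=
    hB.indep.comp (fun _ f => √2 * (f t - f a)) fun _ => by fun_prop
  rw [iIndepFun_iff_map_fun_eq_pi_map fun i => (hm i).aemeasurable] at hind
  simp_rw [hlaw] at hind
  have hmap : P.map (fun ω => √2 • (B t ω - B a ω))
      = (P.map fun ω i => √2 * (B t ω i - B a ω i)).map (WithLp.toLp 2) := by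
    rw [Measure.map_map (by fun_prop) (measurable_pi_iff.2 hm)]
    rfl
  have : IsProbabilityMeasure (P.map fun ω => √2 • (B t ω - B a ω)) := by
    have h1 := hB.measurable t
    have h2 := hB.measurable a
    exact Measure.isProbabilityMeasure_map (by fun_prop)
  refine Measure.ext_of_charFun (funext fun u => ?_)
  rw [charFun_heatKernel hs, hmap, hind, charFun_pi]
  simp_rw [charFun_gaussianReal]
  rw [← Complex.exp_sum]
  congr 1
  rw [← Complex.ofReal_pow, EuclideanSpace.real_norm_sq_eq]
  push_cast
  rw [Finset.mul_sum, ← Finset.sum_neg_distrib]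
  refine Finset.sum_congr rfl fun i _ => ?_
  have : ((Real.toNNReal (t - a) : ℝ≥0) : ℝ) = t - a := Real.coe_toNNReal _ hs.le
  push_cast [this]
  ring

/-- A drift step followed by independent heat kernel noise is a noisy Euler step. -/
lemma map_add_smul_add {b : EuclideanSpace ℝ (Fin n) → EuclideanSpace ℝ (Fin n)}
    (hb : Measurable b) {s : ℝ} (hs : 0 < s) {X W : Ω → EuclideanSpace ℝ (Fin n)}
    (hX : Measurable X) (hW : Measurable W) (hXW : IndepFun X W P)
    (hlaw : P.map W = volume.withDensity fun u => ENNReal.ofReal (heatKernel s u)) :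
    P.map (fun ω => X ω + s • b (X ω) + W ω) = stepLaw b (P.map X) s := by
  have := Measure.isProbabilityMeasure_map (μ := P) hX.aemeasurable
  have := Measure.isProbabilityMeasure_map (μ := P) hW.aemeasurable
  have hf : Measurable fun z : EuclideanSpace ℝ (Fin n) × EuclideanSpace ℝ (Fin n) =>
      z.1 + s • b z.1 + z.2 := by fun_prop
  have h1 : P.map (fun ω => X ω + s • b (X ω) + W ω)
      = ((P.map X).prod (P.map W)).map fun z => z.1 + s • b z.1 + z.2 := by
    rw [← hXW.map_prod_eq_prod_map_map hX.aemeasurable hW.aemeasurable,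
      Measure.map_map hf (hX.prodMk hW)]
    rfl
  rw [h1, ← stepTransition_comp (P.map X) hb hs]
  ext A hA
  rw [Measure.map_apply hf hA, Measure.prod_apply (hf hA),
    Measure.bind_apply hA (stepTransition b s).aemeasurable]
  refine lintegral_congr fun y => ?_
  have hAy : MeasurableSet {u | y + s • b y + u ∈ A} := by
    have h : Measurable fun u => y + s • b y + u := by fun_prop
    exact h hA
  change P.map W {u | y + s • b y + u ∈ A} = _
  rw [hlaw, stepTransition_apply hb, withDensity_apply _ hAy, withDensity_apply _ hA,
    ← lintegral_indicator hAy, ← lintegral_indicator hA,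
    ← lintegral_add_left_eq_self (A.indicator _) (y + s • b y)]
  refine lintegral_congr fun u => ?_
  by_cases hu : y + s • b y + u ∈ A
  · rw [Set.indicator_of_mem hu, Set.indicator_of_mem (by exact hu), stepKernel, stepNoise,
      add_sub_cancel_left]
  · rw [Set.indicator_of_notMem hu, Set.indicator_of_notMem (by exact hu)]

end GaussianNoise

/-! ### Independence of Brownian increments from the past -/

section Independence

variable {Ω : Type*} [MeasurableSpace Ω] {P : Measure Ω} [IsProbabilityMeasure P]

/-- The pairs are independent across `i` and within each pair, so their joint law is a product of
products; regrouping the factors separates the two families. -/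
lemma ProbabilityTheory.iIndepFun.indepFun_pi_prodMk {ι α β : Type*} [Fintype ι]
    [MeasurableSpace α] [MeasurableSpace β] {U : ι → Ω → α} {V : ι → Ω → β}
    (hU : ∀ i, Measurable (U i)) (hV : ∀ i, Measurable (V i))
    (h : iIndepFun (fun i ω => (U i ω, V i ω)) P) (hUV : ∀ i, IndepFun (U i) (V i) P) :
    IndepFun (fun ω i => U i ω) (fun ω i => V i ω) P := by
  have hpU i := Measure.isProbabilityMeasure_map (μ := P) (hU i).aemeasurable
  have hpV i := Measure.isProbabilityMeasure_map (μ := P) (hV i).aemeasurable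
  have hm := (iIndepFun_iff_map_fun_eq_pi_map
    fun i => ((hU i).prodMk (hV i)).aemeasurable).1 h
  have hUV' i := (hUV i).map_prod_eq_prod_map_map (hU i).aemeasurable (hV i).aemeasurable
  simp_rw [hUV'] at hm
  have hmp := measurePreserving_arrowProdEquivProdArrow α β ι (fun i => P.map (U i))
    fun i => P.map (V i)
  have hUm := measurable_pi_iff.2 hU
  have hVm := measurable_pi_iff.2 hV
  have key : P.map (fun ω => ((fun i => U i ω), fun i => V i ω))
      = (Measure.pi fun i => P.map (U i)).prod (Measure.pi fun i => P.map (V i)) := by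
    rw [← hmp.map_eq, ← hm, Measure.map_map (MeasurableEquiv.measurable _)
      (measurable_pi_iff.2 fun i => (hU i).prodMk (hV i))]
    rfl
  have hUpi : P.map (fun ω i => U i ω) = Measure.pi fun i => P.map (U i) := by
    have := congrArg (Measure.map Prod.fst) key
    rwa [Measure.map_map measurable_fst (hUm.prodMk hVm), Measure.map_fst_prod, measure_univ,
      one_smul] at this
  have hVpi : P.map (fun ω i => V i ω) = Measure.pi fun i => P.map (V i) := by
    have := congrArg (Measure.map Prod.snd) key
    rwa [Measure.map_map measurable_snd (hUm.prodMk hVm), Measure.map_snd_prod, measure_univ,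
      one_smul] at this
  rw [indepFun_iff_map_prod_eq_prod_map_map hUm.aemeasurable hVm.aemeasurable, hUpi, hVpi, key]

lemma ProbabilityTheory.IndepFun.prodMk_left {α β δ : Type*} [MeasurableSpace α]
    [MeasurableSpace β] [MeasurableSpace δ] {X : Ω → α} {U : Ω → β} {V : Ω → δ}
    (hX : Measurable X) (hU : Measurable U) (hV : Measurable V)
    (h : IndepFun X (fun ω => (U ω, V ω)) P) (hUV : IndepFun U V P) :
    IndepFun (fun ω => (X ω, U ω)) V P := by
  have := Measure.isProbabilityMeasure_map (μ := P) hX.aemeasurable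
  have := Measure.isProbabilityMeasure_map (μ := P) hU.aemeasurable
  have := Measure.isProbabilityMeasure_map (μ := P) hV.aemeasurable
  have h1 := h.map_prod_eq_prod_map_map hX.aemeasurable (hU.prodMk hV).aemeasurable
  rw [hUV.map_prod_eq_prod_map_map hU.aemeasurable hV.aemeasurable] at h1
  have h2 : IndepFun X U P := h.comp measurable_id measurable_fst
  rw [indepFun_iff_map_prod_eq_prod_map_map (hX.prodMk hU).aemeasurable hV.aemeasurable,
    h2.map_prod_eq_prod_map_map hX.aemeasurable hU.aemeasurable]
  have hmp := (measurePreserving_prodAssoc (P.map X) (P.map U) (P.map V)).symm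
  rw [← hmp.map_eq, ← h1, Measure.map_map (MeasurableEquiv.measurable _)
    (hX.prodMk (hU.prodMk hV))]
  rfl

variable {n : ℕ}

/-- The increments of a Brownian motion after time `a` are independent of an independent
initial value together with the path up to time `a`. -/
lemma IsStandardBrownianMotion.indepFun_past {B : ℝ≥0 → Ω → EuclideanSpace ℝ (Fin n)}
    (hB : IsStandardBrownianMotion B P) {x₀ : Ω → EuclideanSpace ℝ (Fin n)}
    (hx₀ : Measurable x₀) (hindep : IndepFun x₀ (fun ω t => B t ω) P) {a t : ℝ≥0} (hat : a ≤ t) :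
    IndepFun (fun ω => (x₀ ω, fun u : Set.Iic a => B u ω)) (fun ω => B t ω - B a ω) P := by
  have hBm := hB.measurable
  have hmc : ∀ u i, Measurable fun ω => B u ω i := fun u i => by
    have := hB.measurable u
    fun_prop
  refine IndepFun.prodMk_left hx₀ (measurable_pi_iff.2 fun u => hBm u)
    ((hBm t).sub (hBm a)) ?_ ?_
  · exact hindep.comp (φ := id)
      (ψ := fun f : ℝ≥0 → EuclideanSpace ℝ (Fin n) => ((fun u : Set.Iic a => f u), f t - f a))
      measurable_id (by fun_prop)
  · have h := ProbabilityTheory.iIndepFun.indepFun_pi_prodMk (P := P)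
      (U := fun i ω (u : Set.Iic a) => B u ω i) (V := fun i ω => B t ω i - B a ω i)
      (fun i => measurable_pi_iff.2 fun u => hmc u i) (fun i => (hmc t i).sub (hmc a i))
      (hB.indep.comp (fun _ f => ((fun u : Set.Iic a => f u), f t - f a)) fun _ => by fun_prop)
      (fun i => by
        have hψ : Measurable fun f : ℝ≥0 → ℝ => f (t - a) := measurable_pi_apply _
        -- The Markov property of one coordinate: the shifted process `B (a + ·) - B a` is
        -- independent of the past, and is evaluated at `t - a`.
        have h := ((hB.coord i).toIsPreBrownianReal.indepFun_shift a).symm.comp measurable_id hψ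
        simpa only [Function.comp_def, id, add_tsub_cancel_of_le hat] using h)
    have hφ : Measurable fun (f : Fin n → Set.Iic a → ℝ) (u : Set.Iic a) =>
        WithLp.toLp 2 fun i => f i u := by
      refine measurable_pi_iff.2 fun u => ?_
      have : Measurable fun (f : Fin n → Set.Iic a → ℝ) => fun i => f i u := by fun_prop
      fun_prop
    exact h.comp hφ (WithLp.measurable_toLp 2 _)

end Independence

end

/-! ### The laws of the iterates and of their interpolation -/

noncomputable section

section Iterates

variable {n : ℕ} {Ω : Type*} {ℓ : EuclideanSpace ℝ (Fin n) → ℝ}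
  {S : EuclideanSpace ℝ (Fin n) → ℝ → EuclideanSpace ℝ (Fin n)} {γ : ℝ} {α σ : ℕ → ℝ} {N : ℕ}
  {B : ℝ≥0 → Ω → EuclideanSpace ℝ (Fin n)} {x₀ : Ω → EuclideanSpace ℝ (Fin n)}

/-- The iterates are functions of the initial value and the path of the Brownian motion so far. -/
lemma exists_apmcPnP_eq_comp
    (hP : ∀ k, k < N → Measurable (pnpMap ℓ S γ (α k) (σ k))) (hγ : 0 < γ) (T : ℝ≥0) (k : ℕ)
    (hk : k ≤ N) (hkT : Real.toNNReal (k * γ) ≤ T) :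
    ∃ G : EuclideanSpace ℝ (Fin n) × (Set.Iic T → EuclideanSpace ℝ (Fin n))
        → EuclideanSpace ℝ (Fin n), Measurable G ∧
      ∀ ω, apmcPnP ℓ S γ α σ B x₀ k ω = G (x₀ ω, fun u : Set.Iic T => B u ω) := by
  induction k with
  | zero => exact ⟨Prod.fst, measurable_fst, fun ω => rfl⟩
  | succ k ih =>
    have hle : Real.toNNReal (k * γ) ≤ Real.toNNReal (((k : ℝ) + 1) * γ) := by
      refine Real.toNNReal_le_toNNReal ?_
      nlinarith
    push_cast at hkT
    obtain ⟨G, hG, hGe⟩ := ih (by omega) (hle.trans hkT)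
    have hPk := hP k (by omega)
    refine ⟨fun z => G z - γ • pnpMap ℓ S γ (α k) (σ k) (G z)
      + √2 • (z.2 ⟨Real.toNNReal (((k : ℝ) + 1) * γ), hkT⟩
        - z.2 ⟨Real.toNNReal (k * γ), hle.trans hkT⟩), ?_, fun ω => ?_⟩
    · have h1 : Measurable fun z : EuclideanSpace ℝ (Fin n) ×
          (Set.Iic T → EuclideanSpace ℝ (Fin n)) => pnpMap ℓ S γ (α k) (σ k) (G z) :=
        hPk.comp hG
      fun_prop
    · rw [apmcPnP, hGe]

variable [MeasurableSpace Ω] {P : Measure Ω}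

lemma map_apmcPnPInterp_zero :
    P.map (apmcPnPInterp ℓ S γ α σ B x₀ 0) = P.map (apmcPnP ℓ S γ α σ B x₀ 0) := by
  congr 1
  ext ω : 1
  simp [apmcPnPInterp]

lemma measurable_apmcPnP (hP : ∀ k, k < N → Measurable (pnpMap ℓ S γ (α k) (σ k)))
    (hB : ∀ t, Measurable (B t)) (hx₀ : Measurable x₀) (k : ℕ) (hk : k ≤ N) :
    Measurable (apmcPnP ℓ S γ α σ B x₀ k) := by
  induction k with
  | zero => exact hx₀
  | succ k ih =>
    have h1 := ih (by omega)
    have h2 : Measurable fun ω => pnpMap ℓ S γ (α k) (σ k) (apmcPnP ℓ S γ α σ B x₀ k ω) :=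
      (hP k (by omega)).comp h1
    have h3 := hB (Real.toNNReal ((k + 1) * γ))
    have h4 := hB (Real.toNNReal (k * γ))
    exact (h1.sub (h2.const_smul γ)).add ((h3.sub h4).const_smul √2)

variable [IsProbabilityMeasure P]

/-- There is no upper limit on `t`: the same formula gives the interpolation inside a step and, at
`t = (k + 1) γ`, the next iterate. -/
lemma map_apmcPnP_add (hP : ∀ k, k < N → Measurable (pnpMap ℓ S γ (α k) (σ k)))
    (hB : IsStandardBrownianMotion B P) (hx₀ : Measurable x₀)
    (hindep : IndepFun x₀ (fun ω t => B t ω) P) (hγ : 0 < γ) {k : ℕ} (hk : k < N) {t : ℝ}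
    (ht : k * γ < t) :
    P.map (fun ω => apmcPnP ℓ S γ α σ B x₀ k ω
      - (t - k * γ) • pnpMap ℓ S γ (α k) (σ k) (apmcPnP ℓ S γ α σ B x₀ k ω)
      + √2 • (B (Real.toNNReal t) ω - B (Real.toNNReal (k * γ)) ω))
    = stepLaw (fun x => -pnpMap ℓ S γ (α k) (σ k) x) (P.map (apmcPnP ℓ S γ α σ B x₀ k))
        (t - k * γ) := by
  have hkγ : 0 ≤ k * γ := by positivity
  have hlt : Real.toNNReal (k * γ) < Real.toNNReal t :=
    (Real.toNNReal_lt_toNNReal_iff_of_nonneg hkγ).2 ht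
  obtain ⟨G, hG, hGe⟩ := exists_apmcPnP_eq_comp (B := B) (x₀ := x₀) hP hγ _ k hk.le le_rfl
  have hlaw := hB.map_increment hlt
  rw [Real.coe_toNNReal _ hkγ, Real.coe_toNNReal _ (hkγ.trans ht.le)] at hlaw
  have hind := (hB.indepFun_past hx₀ hindep hlt.le).comp (ψ := fun u => √2 • u) hG
    (by fun_prop)
  have h1 := hB.measurable (Real.toNNReal t)
  have h2 := hB.measurable (Real.toNNReal (k * γ))
  have h := map_add_smul_add (P := P) (b := fun x => -pnpMap ℓ S γ (α k) (σ k) x) (hP k hk).neg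
    (sub_pos.2 ht) (measurable_apmcPnP hP hB.measurable hx₀ k hk.le)
    (W := fun ω => √2 • (B (Real.toNNReal t) ω - B (Real.toNNReal (k * γ)) ω))
    (by fun_prop) (by
      rw [show apmcPnP ℓ S γ α σ B x₀ k = _ from funext hGe]
      exact hind) hlaw
  simpa only [smul_neg, ← sub_eq_add_neg] using h

/-- The right endpoint is excluded because the floor in `apmcPnPInterp` passes to the next index
there. -/
lemma map_apmcPnPInterp (hP : ∀ k, k < N → Measurable (pnpMap ℓ S γ (α k) (σ k)))
    (hB : IsStandardBrownianMotion B P) (hx₀ : Measurable x₀)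
    (hindep : IndepFun x₀ (fun ω t => B t ω) P) (hγ : 0 < γ) {k : ℕ} (hk : k < N) {t : ℝ}
    (ht : k * γ < t) (ht' : t < (k + 1) * γ) :
    P.map (apmcPnPInterp ℓ S γ α σ B x₀ t)
      = stepLaw (fun x => -pnpMap ℓ S γ (α k) (σ k) x) (P.map (apmcPnP ℓ S γ α σ B x₀ k))
        (t - k * γ) := by
  have hfl : ⌊t / γ⌋₊ = k := by
    rw [Nat.floor_eq_iff (by have : 0 ≤ k * γ := by positivity
                             exact div_nonneg (this.trans ht.le) hγ.le)]
    exact ⟨by rw [le_div_iff₀ hγ]; exact ht.le, by rwa [div_lt_iff₀ hγ]⟩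
  rw [← map_apmcPnP_add hP hB hx₀ hindep hγ hk ht]
  unfold apmcPnPInterp
  simp only [hfl]

lemma map_apmcPnP_succ (hP : ∀ k, k < N → Measurable (pnpMap ℓ S γ (α k) (σ k)))
    (hB : IsStandardBrownianMotion B P) (hx₀ : Measurable x₀)
    (hindep : IndepFun x₀ (fun ω t => B t ω) P) (hγ : 0 < γ) {k : ℕ} (hk : k < N) :
    P.map (apmcPnP ℓ S γ α σ B x₀ (k + 1))
      = stepLaw (fun x => -pnpMap ℓ S γ (α k) (σ k) x) (P.map (apmcPnP ℓ S γ α σ B x₀ k)) γ := by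
  have ht : k * γ < (k + 1) * γ := by linarith
  have h := map_apmcPnP_add hP hB hx₀ hindep hγ hk ht
  have h2 : ((k : ℝ) + 1) * γ - k * γ = γ := by ring
  rw [h2] at h
  exact h

end Iterates

/-! ### Summation over the steps -/

section Telescope

variable {n : ℕ} {b F : EuclideanSpace ℝ (Fin n) → EuclideanSpace ℝ (Fin n)}
  (ν : Measure (EuclideanSpace ℝ (Fin n))) [IsProbabilityMeasure ν] {M : ℝ}
  {q : EuclideanSpace ℝ (Fin n) → ℝ}

lemma lintegral_fisherInfo_le (hb : Measurable b) (hF : Measurable F) (hFM : ∀ x, ‖F x‖ ≤ M)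
    (hqm : Measurable q) (hq : ∀ x, 0 < q x)
    (hqF : ∀ x, HasGradientAt (fun x => Real.log (q x)) (F x) x)
    {μ : ℝ → Measure (EuclideanSpace ℝ (Fin n))} {a c : ℝ}
    (hμ : ∀ t, a < t → t < a + c → μ t = stepLaw b ν (t - a)) :
    ∫⁻ t in Set.Ioc a (a + c),
        fisherInfo (μ t) (volume.withDensity fun x => ENNReal.ofReal (q x))
      ≤ ∫⁻ s in Set.Ioc 0 c, ENNReal.ofReal (stepFisher b ν F s) := by
  have hpre : (fun t => t - a) ⁻¹' Set.Ioo 0 c = Set.Ioo a (a + c) := by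
    ext t
    simp only [Set.mem_preimage, Set.mem_Ioo, sub_pos, sub_lt_iff_lt_add']
  -- Endpoints are null, so open intervals suffice. Neither the translation along a measurable
  -- embedding nor the comparison asks for measurability of the Fisher information in time.
  rw [← restrict_Ioo_eq_restrict_Ioc, ← restrict_Ioo_eq_restrict_Ioc,
    ← (measurePreserving_sub_right volume a).setLIntegral_comp_preimage_emb
      (MeasurableEquiv.subRight a).measurableEmbedding _ (Set.Ioo 0 c), hpre]
  refine setLIntegral_mono' measurableSet_Ioo fun t ht => ?_
  rw [hμ t ht.1 ht.2]
  exact fisherInfo_stepLaw_le ν hb hF hFM hqm hq hqF (sub_pos.2 ht.1)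

/-- Summation of one-step inequalities along a grid. -/
lemma add_lintegral_le_of_step {f : ℝ → ℝ≥0∞} {H : ℕ → ℝ≥0∞} {R : ℕ → ℝ≥0∞} {κ : ℝ≥0∞} {γ : ℝ}
    (hγ : 0 < γ) {N : ℕ}
    (h : ∀ k, k < N → H (k + 1) + κ * ∫⁻ t in Set.Ioc (k * γ) (k * γ + γ), f t ≤ H k + R k) :
    H N + κ * ∫⁻ t in Set.Ioc 0 (N * γ), f t ≤ H 0 + ∑ k ∈ Finset.range N, R k := by
  induction N with
  | zero => simp
  | succ N ih =>
    have hN : 0 ≤ N * γ := by positivity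
    have hU : Set.Ioc 0 (((N + 1 : ℕ) : ℝ) * γ)
        = Set.Ioc 0 (N * γ) ∪ Set.Ioc (N * γ) (N * γ + γ) := by
      rw [Set.Ioc_union_Ioc_eq_Ioc hN (by linarith)]
      push_cast
      ring_nf
    calc _ ≤ H (N + 1) + κ * ((∫⁻ t in Set.Ioc 0 (N * γ), f t)
          + ∫⁻ t in Set.Ioc (N * γ) (N * γ + γ), f t) := by
          rw [hU]
          exact add_le_add le_rfl (mul_le_mul' le_rfl (lintegral_union_le _ _ _))
      _ = (H (N + 1) + κ * ∫⁻ t in Set.Ioc (N * γ) (N * γ + γ), f t)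
          + κ * ∫⁻ t in Set.Ioc 0 (N * γ), f t := by ring
      _ ≤ (H N + R N) + κ * ∫⁻ t in Set.Ioc 0 (N * γ), f t :=
          add_le_add (h N (by omega)) le_rfl
      _ = (H N + κ * ∫⁻ t in Set.Ioc 0 (N * γ), f t) + R N := by ring
      _ ≤ (H 0 + ∑ k ∈ Finset.range N, R k) + R N :=
          add_le_add (ih fun k hk => h k (by omega)) le_rfl
      _ = _ := by rw [Finset.sum_range_succ, add_assoc]

end Telescope

/-! ### The score of the posterior and its distance from the drift -/

section Posterior

variable {n : ℕ} {p ℓ : EuclideanSpace ℝ (Fin n) → ℝ}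

lemma gradFidelity_eq_neg_score (x : EuclideanSpace ℝ (Fin n)) :
    gradFidelity ℓ x = -score ℓ x := by
  simp [gradFidelity, score, gradient, fderiv_fun_neg]

lemma continuous_of_differentiable_log (hp : ∀ x, 0 < p x)
    (hd : Differentiable ℝ fun x => Real.log (p x)) : Continuous p := by
  have h : p = fun x => Real.exp (Real.log (p x)) := by
    ext x; rw [Real.exp_log (hp x)]
  rw [h]
  exact Real.continuous_exp.comp hd.continuous

lemma integral_posterior_pos (hp : ∀ x, 0 < p x) (hℓ : ∀ x, 0 < ℓ x)
    (hpost : Integrable fun x => ℓ x * p x) : 0 < ∫ x, ℓ x * p x := by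
  rw [integral_pos_iff_support_of_nonneg (fun x => (mul_pos (hℓ x) (hp x)).le) hpost]
  have : (Function.support fun x => ℓ x * p x) = Set.univ :=
    Set.eq_univ_of_forall fun x => (mul_pos (hℓ x) (hp x)).ne'
  rw [this]
  exact Measure.measure_univ_pos.2 (NeZero.ne _)

/-- The normalizing constant is additive in the logarithm and drops out. -/
lemma hasGradientAt_log_posterior (hp : ∀ x, 0 < p x) (hℓ : ∀ x, 0 < ℓ x)
    (hpd : Differentiable ℝ fun x => Real.log (p x))
    (hℓd : Differentiable ℝ fun x => Real.log (ℓ x)) {Z : ℝ} (hZ : 0 < Z)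
    (x : EuclideanSpace ℝ (Fin n)) :
    HasGradientAt (fun x => Real.log (ℓ x * p x / Z)) (score ℓ x + score p x) x := by
  have h1 := (hℓd x).hasGradientAt.hasFDerivAt
  have h2 := (hpd x).hasGradientAt.hasFDerivAt
  rw [hasGradientAt_iff_hasFDerivAt, map_add]
  have h : (fun x => Real.log (ℓ x * p x / Z))
      = fun x => Real.log (ℓ x) + Real.log (p x) - Real.log Z := by
    ext x
    rw [Real.log_div (mul_pos (hℓ x) (hp x)).ne' hZ.ne', Real.log_mul (hℓ x).ne' (hp x).ne']
  rw [h]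
  exact (h1.add h2).sub_const _

end Posterior

section Drift

variable {n : ℕ} {p pσ ℓ : EuclideanSpace ℝ (Fin n) → ℝ}
  {S : EuclideanSpace ℝ (Fin n) → ℝ → EuclideanSpace ℝ (Fin n)} {γ a s Lg L Rg Rs ε C : ℝ}

/-- The network is evaluated at `x - γ ∇g(x)`, a map with Lipschitz constant `1 + γ Lg`; this
produces the product term in `stepLipschitz`. -/
lemma norm_pnpMap_sub_le (hγ : 0 ≤ γ) (ha : 0 ≤ a) (hL : 0 ≤ L)
    (hℓ : ∀ x y, ‖score ℓ x - score ℓ y‖ ≤ Lg * ‖x - y‖)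
    (hS : ∀ x y, ‖S x s - S y s‖ ≤ L * ‖x - y‖) (x y : EuclideanSpace ℝ (Fin n)) :
    ‖pnpMap ℓ S γ a s x - pnpMap ℓ S γ a s y‖ ≤ (Lg + (a * L + a * γ * Lg * L)) * ‖x - y‖ := by
  have hg : ‖gradFidelity ℓ x - gradFidelity ℓ y‖ ≤ Lg * ‖x - y‖ := by
    rw [gradFidelity_eq_neg_score, gradFidelity_eq_neg_score, neg_sub_neg, norm_sub_rev]
    exact hℓ x y
  have h1 : ‖(x - γ • gradFidelity ℓ x) - (y - γ • gradFidelity ℓ y)‖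
      ≤ ‖x - y‖ + γ * (Lg * ‖x - y‖) := by
    rw [show (x - γ • gradFidelity ℓ x) - (y - γ • gradFidelity ℓ y)
      = (x - y) - γ • (gradFidelity ℓ x - gradFidelity ℓ y) by module]
    refine (norm_sub_le _ _).trans ?_
    rw [norm_smul, Real.norm_of_nonneg hγ]
    gcongr
  unfold pnpMap
  rw [show gradFidelity ℓ x - a • S (x - γ • gradFidelity ℓ x) s
      - (gradFidelity ℓ y - a • S (y - γ • gradFidelity ℓ y) s)
    = (gradFidelity ℓ x - gradFidelity ℓ y) - a • (S (x - γ • gradFidelity ℓ x) s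
      - S (y - γ • gradFidelity ℓ y) s) by module]
  refine (norm_sub_le _ _).trans ?_
  rw [norm_smul, Real.norm_of_nonneg ha]
  have h2 := (hS (x - γ • gradFidelity ℓ x) (y - γ • gradFidelity ℓ y)).trans
    (mul_le_mul_of_nonneg_left h1 hL)
  nlinarith [mul_le_mul_of_nonneg_left h2 ha]

lemma norm_pnpMap_le (ha : 0 ≤ a) (hg : ∀ x, ‖gradFidelity ℓ x‖ ≤ Rg) (hS : ∀ x, ‖S x s‖ ≤ Rs)
    (x : EuclideanSpace ℝ (Fin n)) : ‖pnpMap ℓ S γ a s x‖ ≤ Rg + a * Rs := by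
  unfold pnpMap
  refine (norm_sub_le _ _).trans ?_
  rw [norm_smul, Real.norm_of_nonneg ha]
  gcongr
  · exact hg x
  · exact hS _

/-- The drift of the plug-and-play discretization is close to the score of the posterior. -/
lemma norm_neg_pnpMap_sub_le (hγ : 0 ≤ γ) (ha : 1 ≤ a) (hL : 0 ≤ L)
    (hg : ∀ x, ‖gradFidelity ℓ x‖ ≤ Rg) (hSR : ∀ x, ‖S x s‖ ≤ Rs)
    (hS : ∀ x y, ‖S x s - S y s‖ ≤ L * ‖x - y‖)
    (hε : ∀ x, ‖S x s - score pσ x‖ ≤ ε) (hC : ∀ x, ‖score pσ x - score p x‖ ≤ s * C)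
    (x : EuclideanSpace ℝ (Fin n)) :
    ‖-pnpMap ℓ S γ a s x - (score ℓ x + score p x)‖
      ≤ ε + s * C + L * (γ * Rg) + (a - 1) * Rs := by
  set z := x - γ • gradFidelity ℓ x with hz
  -- The four summands are the network error, the smoothing error, the shift of the network's
  -- argument and the excess annealing weight.
  have h1 : -pnpMap ℓ S γ a s x - (score ℓ x + score p x)
      = (S x s - score pσ x) + (score pσ x - score p x) + (S z s - S x s) + (a - 1) • S z s := by
    rw [pnpMap, gradFidelity_eq_neg_score] at *
    rw [← hz]
    module
  have h2 : ‖S z s - S x s‖ ≤ L * (γ * Rg) := by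
    refine (hS z x).trans (mul_le_mul_of_nonneg_left ?_ hL)
    rw [hz, sub_sub_cancel_left, norm_neg, norm_smul, Real.norm_of_nonneg hγ]
    exact mul_le_mul_of_nonneg_left (hg x) hγ
  have h3 : ‖(a - 1) • S z s‖ ≤ (a - 1) * Rs := by
    rw [norm_smul, Real.norm_of_nonneg (by linarith)]
    exact mul_le_mul_of_nonneg_left (hSR z) (by linarith)
  rw [h1]
  refine (norm_add_le _ _).trans (add_le_add ((norm_add_le _ _).trans (add_le_add
    ((norm_add_le _ _).trans (add_le_add (hε x) (hC x))) h2)) h3)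

end Drift

end

/-! ### Numerical constants and the final assembly -/

noncomputable section

/-- The error terms of a single step, after multiplication by `12 / 5`. -/
lemma step_error_le {m L Lσ Lσmax γ Rg Rs ε D δ C e : ℝ} (hm : 0 ≤ m) (hγ : 0 < γ)
    (hLσ : 0 ≤ Lσ) (hLσmax : Lσ ≤ Lσmax) (hLσL : Lσ ≤ L) (hstep : (γ * L) ^ 2 ≤ 1 / 32) (he : e = ε + D * C + Lσ * (γ * Rg) + δ * Rs) :
    12 / 5 * (22 / 3 * m * L ^ 2 * γ ^ 2 + 8 / 3 * e ^ 2 * γ)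
      ≤ γ * (48 * (δ ^ 2 * Rs ^ 2)) + γ * ((24 * m * L ^ 2 + 9 * Lσmax * Rg ^ 2) * γ)
        + γ * (48 * C ^ 2 * D ^ 2) + γ * (48 * ε ^ 2) := by
  have h1 : e ^ 2 ≤ 4 * (ε ^ 2 + (D * C) ^ 2 + (Lσ * (γ * Rg)) ^ 2 + (δ * Rs) ^ 2) := by
    rw [he]
    nlinarith [sq_nonneg (ε - D * C), sq_nonneg (ε - Lσ * (γ * Rg)), sq_nonneg (ε - δ * Rs),
      sq_nonneg (D * C - Lσ * (γ * Rg)), sq_nonneg (D * C - δ * Rs),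
      sq_nonneg (Lσ * (γ * Rg) - δ * Rs)]
  -- `1/√32 < 1/5`. This trades one factor `γ Lσ` of the squared shift error for a number, so that
  -- the bound is linear in `Lσmax` and in `γ`.
  have h2 : γ * Lσ ≤ 1 / 5 := by
    have h3 : γ * Lσ ≤ γ * L := by gcongr
    nlinarith [mul_nonneg hγ.le hLσ]
  have h3 : (Lσ * (γ * Rg)) ^ 2 ≤ 1 / 5 * (Lσmax * Rg ^ 2 * γ) := by
    calc (Lσ * (γ * Rg)) ^ 2 = (γ * Lσ) * (Lσ * Rg ^ 2 * γ) := by ring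
      _ ≤ 1 / 5 * (Lσmax * Rg ^ 2 * γ) := by gcongr
  have h4 : γ * e ^ 2
      ≤ γ * (4 * (ε ^ 2 + (D * C) ^ 2 + 1 / 5 * (Lσmax * Rg ^ 2 * γ) + (δ * Rs) ^ 2)) := by
    gcongr
    linarith
  have h5 : 0 ≤ m * L ^ 2 * γ ^ 2 := by positivity
  have h6 : 0 ≤ γ * ε ^ 2 := by positivity
  have h7 : 0 ≤ γ * (D * C) ^ 2 := by positivity
  have h8 : 0 ≤ γ * (δ * Rs) ^ 2 := by positivity
  have h9 : 0 ≤ Lσmax * Rg ^ 2 * γ ^ 2 := by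
    have : 0 ≤ Lσmax := hLσ.trans hLσmax
    positivity
  -- The coefficients compare as `12/5 · 22/3 = 88/5 ≤ 24`, `12/5 · 8/3 · 4 = 128/5 ≤ 48` and
  -- `128/25 ≤ 9`.
  nlinarith

/-- From a bound on the integral to a bound on the average. -/
lemma ENNReal.div_ofReal_le_of_mul_le {A H : ℝ≥0∞} {T r z R : ℝ} (hT : 0 < T) (hr : 0 ≤ r)
    (hz : 0 ≤ z) (h : ENNReal.ofReal (5 / 12) * A ≤ H + ENNReal.ofReal R)
    (hR : 12 / 5 * R ≤ z + T * r) :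
    A / ENNReal.ofReal T ≤ (4 * H + ENNReal.ofReal z) / ENNReal.ofReal T + ENNReal.ofReal r := by
  have hT0 : ENNReal.ofReal T ≠ 0 := (ENNReal.ofReal_pos.2 hT).ne'
  refine ENNReal.div_le_of_le_mul ?_
  rw [add_mul, ENNReal.div_mul_cancel hT0 ENNReal.ofReal_ne_top, ← ENNReal.ofReal_mul hr]
  have h1 : A = ENNReal.ofReal (12 / 5) * (ENNReal.ofReal (5 / 12) * A) := by
    rw [← mul_assoc, ← ENNReal.ofReal_mul (by norm_num)]
    norm_num
  rw [h1]
  refine (mul_le_mul' le_rfl h).trans ?_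
  rw [mul_add, ← ENNReal.ofReal_mul (by norm_num), add_assoc,
    ← ENNReal.ofReal_add hz (mul_nonneg hr hT.le)]
  -- The initial divergence comes with `12/5`, which is enlarged to 4.
  refine add_le_add (mul_le_mul' ?_ le_rfl) (ENNReal.ofReal_le_ofReal (by linarith))
  rw [show (4 : ℝ≥0∞) = ENNReal.ofReal 4 by simp]
  exact ENNReal.ofReal_le_ofReal (by norm_num)

end

theorem theorem4 {n : ℕ}
    -- prior density and likelihood of the fixed observation, with a well-defined posterior
    (p : EuclideanSpace ℝ (Fin n) → ℝ) (hp_pos : ∀ x, 0 < p x) (hp_one : ∫ x, p x = 1)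
    (ℓ : EuclideanSpace ℝ (Fin n) → ℝ) (hℓ_pos : ∀ x, 0 < ℓ x)
    (hpost : Integrable fun x => ℓ x * p x)
    -- Lipschitz gradient of the log-likelihood
    (Lg : ℝ) (hLg : 0 < Lg) (hℓ_diff : Differentiable ℝ fun x => Real.log (ℓ x))
    (hA1 : ∀ x₁ x₂, ‖score ℓ x₁ - score ℓ x₂‖ ≤ Lg * ‖x₁ - x₂‖)
    -- Lipschitz gradient of the log-prior
    (Lp : ℝ) (hLp : 0 < Lp) (hp_diff : Differentiable ℝ fun x => Real.log (p x))
    (hA2 : ∀ x₁ x₂, ‖score p x₁ - score p x₂‖ ≤ Lp * ‖x₁ - x₂‖)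
    -- score network: Lipschitz continuity and approximation error
    (S : EuclideanSpace ℝ (Fin n) → ℝ → EuclideanSpace ℝ (Fin n)) (L ε : ℝ → ℝ)
    (hL : ∀ s, 0 < s → 0 < L s)
    (hA3a : ∀ s, 0 < s → ∀ x₁ x₂, ‖S x₁ s - S x₂ s‖ ≤ L s * ‖x₁ - x₂‖)
    (hA3b : ∀ s, 0 < s → ∀ x, ‖S x s - score (smoothedPrior p s) x‖ ≤ ε s)
    -- score mismatch between the smoothed prior and the prior
    (C : ℝ) (hA4 : ∀ s, 0 < s → ∀ x, ‖score (smoothedPrior p s) x - score p x‖ ≤ s * C)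
    -- bounded gradient of the data-fidelity term
    (Rg : ℝ) (hRg : 0 < Rg) (hA5 : ∀ x, ‖gradFidelity ℓ x‖ ≤ Rg)
    -- bounded output of the score network
    (Rs : ℝ) (hA6 : ∀ s, 0 < s → ∀ x, ‖S x s‖ ≤ Rs)
    -- annealing schedules
    (N K : ℕ) (hKN : K < N) (α σ : ℕ → ℝ)
    (hα : AntitoneOn α (Set.Iio N)) (hσ : AntitoneOn σ (Set.Iio N))
    (hα_one : ∀ k, K ≤ k → k < N → α k = 1) (hσ_pos : ∀ k, k < N → 0 < σ k)
    -- step size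
    (γ : ℝ) (hγ : 0 < γ) (Lmax Lσmax : ℝ)
    (hLmax : Lmax = ⨆ k : Fin N, stepLipschitz Lg Lp γ L α σ k)
    (hLσmax : Lσmax = ⨆ k : Fin N, L (σ k))
    (hstep : γ * Lmax ≤ 1 / √32)
    -- initialization, driving Brownian motion, and law of the continuous interpolation
    {Ω : Type*} [MeasurableSpace Ω] (P : Measure Ω) [IsProbabilityMeasure P]
    (B : ℝ≥0 → Ω → EuclideanSpace ℝ (Fin n)) (hB : IsStandardBrownianMotion B P)
    (x₀ : Ω → EuclideanSpace ℝ (Fin n)) (hx₀ : Measurable x₀)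
    (hindep : IndepFun x₀ (fun ω t => B t ω) P)
    (ν : ℝ → Measure (EuclideanSpace ℝ (Fin n)))
    (hν : ∀ t, ν t = P.map (apmcPnPInterp ℓ S γ α σ B x₀ t))
    -- averages and the annealing constant
    (σavg εavg ζ : ℝ)
    (hσavg : σavg = (1 / N) * ∑ k ∈ Finset.range N, σ k ^ 2)
    (hεavg : εavg = (1 / N) * ∑ k ∈ Finset.range N, ε (σ k) ^ 2)
    (hζ : ζ = 48 * ∑ k ∈ Finset.range K, (α k - 1) ^ 2 * Rs ^ 2) :
    (∫⁻ t in Set.Ioc 0 (N * γ), fisherInfo (ν t) (posteriorLaw ℓ p)) / ENNReal.ofReal (N * γ) ≤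
      (4 * InformationTheory.klDiv (ν 0) (posteriorLaw ℓ p) + ENNReal.ofReal (γ * ζ))
          / ENNReal.ofReal (N * γ)
        + ENNReal.ofReal ((24 * n * Lmax ^ 2 + 9 * Lσmax * Rg ^ 2) * γ
            + 48 * C ^ 2 * σavg + 48 * εavg) := by
  have hN : (0 : ℝ) < N := by exact_mod_cast (Nat.zero_le K).trans_lt hKN
  -- the schedules
  have hα1 : ∀ k, k < N → 1 ≤ α k := fun k hk => by
    have h := hα (Set.mem_Iio.2 hk) (Set.mem_Iio.2 (show N - 1 < N by omega))
      (show k ≤ N - 1 by omega)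
    rwa [hα_one (N - 1) (by omega) (by omega)] at h
  have hLk : ∀ k, k < N → stepLipschitz Lg Lp γ L α σ k ≤ Lmax := fun k hk => by
    rw [hLmax]
    exact le_ciSup (f := fun k : Fin N => stepLipschitz Lg Lp γ L α σ k)
      (Set.finite_range _).bddAbove ⟨k, hk⟩
  have hLσk : ∀ k, k < N → L (σ k) ≤ Lσmax := fun k hk => by
    rw [hLσmax]
    exact le_ciSup (f := fun k : Fin N => L (σ k)) (Set.finite_range _).bddAbove ⟨k, hk⟩
  have hdrift : ∀ k, k < N → Lg + (α k * L (σ k) + α k * γ * Lg * L (σ k)) ≤ Lmax :=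
    fun k hk => le_trans (by unfold stepLipschitz; gcongr; exact le_max_left _ _) (hLk k hk)
  have hprior : Lg + Lp ≤ Lmax := le_trans
    (by unfold stepLipschitz; gcongr; exact le_max_right _ _) (hLk K hKN)
  -- Uses `α k ≥ 1`, which holds because the schedule decreases to the value 1.
  have hLσL : ∀ k, k < N → L (σ k) ≤ Lmax := fun k hk => by
    have h1 := hL _ (hσ_pos k hk)
    have h2 := hα1 k hk
    have h3 : 0 ≤ α k * γ * Lg * L (σ k) := by positivity
    nlinarith [hdrift k hk]
  have hLmax0 : 0 < Lmax := by linarith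
  have hstep2 : (γ * Lmax) ^ 2 ≤ 1 / 32 := by
    refine (pow_le_pow_left₀ (by positivity) hstep 2).trans (le_of_eq ?_)
    rw [div_pow, Real.sq_sqrt (by norm_num), one_pow]
  have hRs : 0 ≤ Rs := (norm_nonneg _).trans (hA6 1 one_pos 0)
  -- the posterior
  have hZ := integral_posterior_pos hp_pos hℓ_pos hpost
  set Z := ∫ z, ℓ z * p z with hZdef
  set q : EuclideanSpace ℝ (Fin n) → ℝ := fun x => ℓ x * p x / Z with hqdef
  have hπ : posteriorLaw ℓ p = volume.withDensity fun x => ENNReal.ofReal (q x) := rfl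
  have hq : ∀ x, 0 < q x := fun x => div_pos (mul_pos (hℓ_pos x) (hp_pos x)) hZ
  have hqm : Measurable q := ((continuous_of_differentiable_log hℓ_pos hℓ_diff).mul
    (continuous_of_differentiable_log hp_pos hp_diff)).measurable.div_const _
  have hqi : Integrable q := hpost.div_const _
  have hq1 : ∫ x, q x = 1 := by
    rw [hqdef, integral_div, ← hZdef, div_self hZ.ne']
  have hqF := hasGradientAt_log_posterior hp_pos hℓ_pos hp_diff hℓ_diff hZ
  have hFL : ∀ x y, ‖(score ℓ x + score p x) - (score ℓ y + score p y)‖ ≤ Lmax * ‖x - y‖ := by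
    intro x y
    rw [add_sub_add_comm]
    refine (norm_add_le _ _).trans ((add_le_add (hA1 x y) (hA2 x y)).trans ?_)
    rw [← add_mul]
    gcongr
  have hF : Measurable fun x => score ℓ x + score p x :=
    (LipschitzWith.of_dist_le_mul (K := Lmax.toNNReal) fun x y => by
      rw [dist_eq_norm, dist_eq_norm, Real.coe_toNNReal _ hLmax0.le]
      exact hFL x y).continuous.measurable
  have hbL : ∀ k, k < N → ∀ x y, ‖-pnpMap ℓ S γ (α k) (σ k) x - -pnpMap ℓ S γ (α k) (σ k) y‖
      ≤ Lmax * ‖x - y‖ := by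
    intro k hk x y
    rw [neg_sub_neg, norm_sub_rev]
    refine (norm_pnpMap_sub_le hγ.le (zero_le_one.trans (hα1 k hk)) (hL _ (hσ_pos k hk)).le hA1
      (hA3a _ (hσ_pos k hk)) x y).trans ?_
    gcongr
    exact hdrift k hk
  have hb : ∀ k, k < N → Measurable fun x => -pnpMap ℓ S γ (α k) (σ k) x := fun k hk =>
    (LipschitzWith.of_dist_le_mul (K := Lmax.toNNReal) fun x y => by
      rw [dist_eq_norm, dist_eq_norm, Real.coe_toNNReal _ hLmax0.le]
      exact hbL k hk x y).continuous.measurable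
  have hP : ∀ k, k < N → Measurable (pnpMap ℓ S γ (α k) (σ k)) := fun k hk => by
    simpa only [Pi.neg_def, neg_neg] using (hb k hk).neg
  -- the entropy along the iterates
  set e : ℕ → ℝ := fun k => ε (σ k) + σ k * C + L (σ k) * (γ * Rg) + (α k - 1) * Rs with he
  set R : ℕ → ℝ := fun k => 22 / 3 * n * Lmax ^ 2 * γ ^ 2 + 8 / 3 * e k ^ 2 * γ with hR
  have hmain := add_lintegral_le_of_step (f := fun t => fisherInfo (ν t) (posteriorLaw ℓ p))
    (H := fun k => InformationTheory.klDiv (P.map (apmcPnP ℓ S γ α σ B x₀ k)) (posteriorLaw ℓ p))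
    (R := fun k => ENNReal.ofReal (R k)) (κ := ENNReal.ofReal (5 / 12)) hγ (N := N) (by
      intro k hk
      have hσk := hσ_pos k hk
      have hprob := Measure.isProbabilityMeasure_map (μ := P)
        (measurable_apmcPnP (S := S) (ℓ := ℓ) hP hB.measurable hx₀ k hk.le).aemeasurable
      -- The prior score is bounded since it lies within a fixed distance of the bounded network.
      -- The bound is written so that it also serves for the drift, as a single constant `M` is
      -- required; it may depend on `k`, since it does not enter the final estimate.
      have hFe : ∀ x, ‖score ℓ x + score p x‖ ≤ Rg + α k * Rs + (ε (σ k) + σ k * C) := by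
        intro x
        have h1 : ‖score ℓ x‖ ≤ Rg := by
          have := hA5 x
          rwa [gradFidelity_eq_neg_score, norm_neg] at this
        have h2 : ‖score p x‖ ≤ Rs + (ε (σ k) + σ k * C) := by
          rw [show score p x = S x (σ k) - ((S x (σ k) - score (smoothedPrior p (σ k)) x)
            + (score (smoothedPrior p (σ k)) x - score p x)) by abel]
          exact (norm_sub_le _ _).trans (add_le_add (hA6 _ hσk x)
            ((norm_add_le _ _).trans (add_le_add (hA3b _ hσk x) (hA4 _ hσk x))))
        have h3 : Rs ≤ α k * Rs := le_mul_of_one_le_left hRs (hα1 k hk)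
        exact (norm_add_le _ _).trans (by linarith)
      have hbe : ∀ x, ‖-pnpMap ℓ S γ (α k) (σ k) x‖
          ≤ Rg + α k * Rs + (ε (σ k) + σ k * C) := by
        intro x
        rw [norm_neg]
        have h1 := norm_pnpMap_le (γ := γ) (zero_le_one.trans (hα1 k hk)) hA5 (hA6 _ hσk) x
        have h2 := (norm_nonneg _).trans (hA3b _ hσk 0)
        have h3 := (norm_nonneg _).trans (hA4 _ hσk 0)
        linarith
      rw [map_apmcPnP_succ hP hB hx₀ hindep hγ hk, hπ]
      refine le_trans (add_le_add le_rfl (mul_le_mul' le_rfl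
        (lintegral_fisherInfo_le (P.map (apmcPnP ℓ S γ α σ B x₀ k)) (hb k hk) hF hFe hqm hq hqF
          fun t ht ht' => ?_)))
        (klDiv_stepLaw_add_lintegral_le (P.map (apmcPnP ℓ S γ α σ B x₀ k)) (hb k hk) hF hbe hFe
          hFL (hbL k hk) (norm_neg_pnpMap_sub_le hγ.le (hα1 k hk) (hL _ hσk).le hA5 (hA6 _ hσk)
            (hA3a _ hσk) (hA3b _ hσk) (hA4 _ hσk)) hqm hqi hq1 hq hqF hγ (by
            rwa [← mul_pow]))
      rw [hν]
      exact map_apmcPnPInterp hP hB hx₀ hindep hγ hk ht (by linarith))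
  rw [← ENNReal.ofReal_sum_of_nonneg fun k _ => by positivity] at hmain
  have hν0 : ν 0 = P.map (apmcPnP ℓ S γ α σ B x₀ 0) := by
    rw [hν, map_apmcPnPInterp_zero]
  -- From index `K` on the annealing weight is 1, so the annealing error vanishes.
  have hsplit : ∑ k ∈ Finset.range N, (α k - 1) ^ 2 * Rs ^ 2
      = ∑ k ∈ Finset.range K, (α k - 1) ^ 2 * Rs ^ 2 := by
    refine (Finset.sum_subset (Finset.range_subset_range.2 hKN.le) fun k hk hkK => ?_).symm
    rw [hα_one k (by simpa using hkK) (by simpa using hk), sub_self]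
    ring
  have hLσmax0 : 0 ≤ Lσmax := (hL _ (hσ_pos K hKN)).le.trans (hLσk K hKN)
  refine ENNReal.div_ofReal_le_of_mul_le (R := ∑ k ∈ Finset.range N, R k) (mul_pos hN hγ) ?_ ?_
    ?_ ?_
  · rw [hσavg, hεavg]
    positivity
  · rw [hζ]
    have : 0 ≤ ∑ k ∈ Finset.range K, (α k - 1) ^ 2 * Rs ^ 2 :=
      Finset.sum_nonneg fun k _ => by positivity
    positivity
  · rw [hν0]
    -- The divergence at the final time is nonnegative and is discarded.
    exact le_add_self.trans hmain
  · have hsum := Finset.sum_le_sum fun k (hk : k ∈ Finset.range N) =>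
      step_error_le (m := n) (Rg := Rg) (Rs := Rs) (ε := ε (σ k)) (D := σ k) (δ := α k - 1)
        (C := C) (e := e k) (Nat.cast_nonneg n) hγ
        (hL _ (hσ_pos k (Finset.mem_range.1 hk))).le (hLσk k (Finset.mem_range.1 hk))
        (hLσL k (Finset.mem_range.1 hk)) hstep2 rfl
    simp only [Finset.sum_add_distrib, ← Finset.mul_sum, Finset.sum_const, Finset.card_range,
      nsmul_eq_mul] at hsum
    rw [hsplit] at hsum
    have h1 : N * σavg = ∑ k ∈ Finset.range N, σ k ^ 2 := by
      rw [hσavg]; field_simp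
    have h2 : N * εavg = ∑ k ∈ Finset.range N, ε (σ k) ^ 2 := by
      rw [hεavg]; field_simp
    rw [← h1, ← h2] at hsum
    rw [hζ]
    simp only [hR, Finset.sum_add_distrib, ← Finset.mul_sum, Finset.sum_const, Finset.card_range,
      nsmul_eq_mul]
    linarith
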